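/- **Setting.** Let $K\ge 1$ tasks be discounted MDPs $\mathcal M_k=(\mathcal S,\mathcal A,\gamma,P_k,r_k)$ with common (measurable) state and action spaces, discount factor $\gamma\in[0,1)$, rewards $r_k\in[0,1]$ and initial distributions $\xi_0^k$. Policies $\pi_\theta(a|s)>0$, $\theta\in\mathbb R^p$, are densities with respect to a fixed reference measure on $\mathcal A$. $Q^k_{\pi_\theta}$ is the action-value function, $J^k(\theta)=\mathbb E[\sum_t\gamma^t r_k(s_t,a_t)\mid s_0\sim\xi_0^k]$, $d^k_\theta=(1-\gamma)\sum_t\gamma^t\,\mathbb P((s_t,a_t)\in\cdot\mid s_0\sim\xi_0^k,\pi_\theta,P_k)$, and $\psi_\theta=\nabla_\theta\log\pi_\theta$. The feature maps are $\phi^k:\mathcal S\times\mathcal A\to\mathbb R^m$. With $(s,a)\sim d^k_\theta$, $s'\sim P_k(\cdot|s,a)$, $a'\sim\pi_\theta(\cdot|s')$, put $A^k_\theta=\mathbb E[\phi^k(s,a)(\gamma\phi^k(s',a')-\phi^k(s,a))^\top]$ and $b^k_\theta=\mathbb E[\phi^k(s,a)r_k(s,a)]$; $w^{*k}_\theta$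 solves $A^k_\theta w+b^k_\theta=0$, and $$\epsilon_{\rm app}=\sup_{\theta,k}\sqrt{\mathbb E_{d^k_\theta}[(\phi^k(s,a)^\top w^{*k}_\theta-Q^k_{\pi_\theta}(s,a))^2]}.$$ $\Lambda$ is the probability simplex over the tasks. A (random) policy $\pi_\theta$ is $\varepsilon$-accurate Pareto stationary if $\mathbb E[\min_{\lambda\in\Lambda}\|\sum_k\lambda^k\nabla J^k(\theta)\|^2]\le\varepsilon$. **Algorithm MTAC-FC.** Parameters: $\beta,c',\lambda_A,B>0$ and $T,N_{\rm critic},N_{\rm FC},N_{\rm actor}\in\mathbb N$; start: $\theta_0$, $w_0^k$ arbitrary, $\lambda_0\in\Lambda$. For $t=0,\dots,T-1$: (1) Critic, independently for each $k$: $w^k_{t,0}=w^k_t$, $(s_0,a_0)\sim d^k_{\theta_t}$; for $j<N_{\rm critic}$ draw $s_{j+1}\sim P_k(\cdot|s_j,a_j)$, $a_{j+1}\sim\pi_{\theta_t}(\cdot|s_{j+1})$ and set $w^k_{t,j+1}=\mathcal T_B\big(w^k_{t,j}+\frac{1}{2\lambda_A(j+1)}\delta_j\phi^k(s_j,a_j)\big)$,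 $\delta_j=r_k(s_j,a_j)+\gamma\phi^k(s_{j+1},a_{j+1})^\top w^k_{t,j}-\phi^k(s_j,a_j)^\top w^k_{t,j}$, where $\mathcal T_B$ is the projection onto the ball of radius $B$; $w^k_{t+1}=w^k_{t,N_{\rm critic}}$. (2) Weights: draw for each $k$ two batches of $N_{\rm FC}$ independent samples from $d^k_{\theta_t}$, and set $\lambda_{t+1}=\mathcal T_\Lambda(\lambda_t-c'\lambda_t^\top\bar\nabla J\,(\bar\nabla J')^\top)$, where $\mathcal T_\Lambda$ is the projection onto $\Lambda$, $\bar\nabla J^k$ is the average of $\phi^k(s,a)^\top w^k_{t+1}\,\psi_{\theta_t}(s,a)$ over the first batch, and $\bar\nabla J'$ is either $\bar\nabla J$ itself or the same average over the second batch (the result holds for both variants). (3) Actor: $\theta_{t+1}=\theta_t+\beta\sum_k\lambda_t^k\widetilde\nabla J^k$, where $\widetilde\nabla J^k$ is the same average over $N_{\rm actor}$ fresh independent samples from $d^k_{\theta_t}$. The output is $\pi_{\theta_\tau}$ with $\tau$ uniform on $\{0,\dots,T-1\}$, independent of the run; $T\,(N_{\rm critic}+1+2N_{\rm FC}+N_{\rm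 actor})$ samples are used per task. **Assumptions**, with positive constants $C_\phi,C_\pi,L_\phi,\kappa,\lambda_A,B$ and $\rho\in(0,1)$, for all $k,\theta,\theta',s,a$: (i) $\log\pi_\theta(a|s)$ is differentiable in $\theta$, $\|\psi_\theta(s,a)\|\le C_\phi$, $\|\phi^k(s,a)\|\le C_\phi$, $|\pi_\theta(a|s)-\pi_{\theta'}(a|s)|\le C_\pi\|\theta-\theta'\|$, $\|\psi_\theta(s,a)-\psi_{\theta'}(s,a)\|\le L_\phi\|\theta-\theta'\|$; (ii) $\sup_s\|\mathbb P((s_t,a_t)\in\cdot\mid s_0=s,\pi_\theta,P_k)-d^k_\theta\|_{TV}\le\kappa\rho^t$ for all $t\ge0$; (iii) $x^\top A^k_\theta x\le-\lambda_A\|x\|^2$ for all $x\in\mathbb R^m$; (iv) $\|w^{*k}_\theta\|\le B$. Let $L_J$ be the least common Lipschitz constant of the gradients $\nabla J^k$. **Corollary.** There is $c_{\max}\in(0,\frac1{8C_\phi^2B}]$ depending only on $K,\gamma,C_\phi,C_\pi,L_\phi,\kappa,\rho,\lambda_A,B$ such that for all constants $\beta>0$ and $c'\in(0,c_{\max}]$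 there are constants $b_0,C>0$, and for each $b_1\ge b_0$ a constant $C'>0$, depending only on these quantities ($C'$ also on $b_1$), for which the following holds. For every problem satisfying (i)–(iv) and $\beta L_J\le1$, the functions $J^k$ are differentiable, and for every initialisation with $\lambda_0\in\Lambda$, every $\epsilon\in(0,1]$, and all $T,N_{\rm FC},N_{\rm actor}\in[b_0\epsilon^{-1},b_1\epsilon^{-1}]$ and $N_{\rm critic}\in[b_0\epsilon^{-2},b_1\epsilon^{-2}]$, the output of MTAC-FC is an $(\epsilon+C\epsilon_{\rm app})$-accurate Pareto stationary policy, and each task uses at most $C'\epsilon^{-3}$ samples. -/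

import Mathlib

open MeasureTheory ProbabilityTheory
open scoped ENNReal

noncomputable section

namespace MTAC

/-- `Vec n` is `ℝⁿ` with the Euclidean norm. -/
abbrev Vec (n : ℕ) : Type := EuclideanSpace ℝ (Fin n)

/-! ### Two general tools: metric projection, finite products of Markov kernels -/

/-- The metric projection `argmin_{u ∈ C} ‖v - u‖` onto a set `C` (the minimiser exists and is
unique when `C` is nonempty, closed and convex, the only case used). -/
def metricProj {n : ℕ} (C : Set (Vec n)) (v : Vec n) : Vec n :=
  open Classical in
  if h : ∃ u ∈ C, ∀ u' ∈ C, ‖v - u‖ ≤ ‖v - u'‖ then h.choose else v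

theorem metricProj_spec {n : ℕ} {C : Set (Vec n)} (hne : C.Nonempty) (hcl : IsClosed C)
    (v : Vec n) :
    metricProj C v ∈ C ∧ ∀ u' ∈ C, ‖v - metricProj C v‖ ≤ ‖v - u'‖ := by
  have h : ∃ u ∈ C, ∀ u' ∈ C, ‖v - u‖ ≤ ‖v - u'‖ := by
    obtain ⟨u, hu, hd⟩ := hcl.exists_infDist_eq_dist hne v
    refine ⟨u, hu, fun u' hu' => ?_⟩
    rw [← dist_eq_norm, ← dist_eq_norm, ← hd]
    exact Metric.infDist_le_dist_of_mem hu'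
  rw [metricProj, dif_pos h]
  exact h.choose_spec

theorem metricProj_inner_le {n : ℕ} {C : Set (Vec n)} (hne : C.Nonempty) (hcl : IsClosed C)
    (hcv : Convex ℝ C) (v u' : Vec n) (hu' : u' ∈ C) :
    inner ℝ (v - metricProj C v) (u' - metricProj C v) ≤ 0 := by
  obtain ⟨hm, hmin⟩ := metricProj_spec hne hcl v
  have : Nonempty C := hne.to_subtype
  refine (norm_eq_iInf_iff_real_inner_le_zero hcv hm).1 ?_ u' hu'
  refine le_antisymm (le_ciInf fun w => hmin w w.2) ?_
  exact ciInf_le ⟨0, by rintro _ ⟨w, rfl⟩; exact norm_nonneg _⟩ (⟨_, hm⟩ : C)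

theorem continuous_metricProj {n : ℕ} {C : Set (Vec n)} (hne : C.Nonempty) (hcl : IsClosed C)
    (hcv : Convex ℝ C) : Continuous (metricProj C) := by
  have hL : LipschitzWith 1 (metricProj C) := by
    refine LipschitzWith.of_dist_le_mul fun x y => ?_
    rw [NNReal.coe_one, one_mul, dist_eq_norm, dist_eq_norm]
    set a := metricProj C x
    set b := metricProj C y
    have h1 := metricProj_inner_le hne hcl hcv x b (metricProj_spec hne hcl y).1
    have h2 := metricProj_inner_le hne hcl hcv y a (metricProj_spec hne hcl x).1
    have h3 : ‖a - b‖ ^ 2 ≤ inner ℝ (x - y) (a - b) := by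
      rw [← real_inner_self_eq_norm_sq]
      have e1 : inner ℝ (x - a) (b - a) = - inner ℝ (x - a) (a - b) := by
        rw [← inner_neg_right, neg_sub]
      have e2 : inner ℝ (x - y) (a - b) - inner ℝ (a - b) (a - b)
          = inner ℝ (x - a) (a - b) - inner ℝ (y - b) (a - b) := by
        rw [← inner_sub_left, ← inner_sub_left]
        congr 1
        abel
      linarith
    have h4 : inner ℝ (x - y) (a - b) ≤ ‖x - y‖ * ‖a - b‖ := real_inner_le_norm _ _
    by_contra hc
    push Not at hc
    have : 0 < ‖a - b‖ := lt_of_le_of_lt (norm_nonneg _) hc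
    nlinarith
  exact hL.continuous

/-- Finite product of Markov kernels: `prodKernel κ x` is the law of an independent family
`(Yᵢ)ᵢ` with `Yᵢ ∼ κᵢ(x)`. -/
def prodKernel {ι α β : Type*} [Fintype ι] [MeasurableSpace α] [MeasurableSpace β]
    (κ : ι → Kernel α β) [∀ i, IsMarkovKernel (κ i)] : Kernel α (ι → β) where
  toFun x := Measure.pi fun i => κ i x
  measurable' := by
    refine Measurable.measure_of_isPiSystem_of_isProbabilityMeasure
      (S := Set.pi Set.univ '' Set.pi Set.univ fun _ => {s : Set β | MeasurableSet s})
      generateFrom_pi.symm isPiSystem_pi ?_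
    rintro _ ⟨s, hs, rfl⟩
    simp_rw [Measure.pi_pi]
    exact Finset.measurable_prod _ fun i _ => (κ i).measurable_coe (hs i (Set.mem_univ i))

instance {ι α β : Type*} [Fintype ι] [MeasurableSpace α] [MeasurableSpace β]
    (κ : ι → Kernel α β) [∀ i, IsMarkovKernel (κ i)] : IsMarkovKernel (prodKernel κ) :=
  ⟨fun x => by
    change IsProbabilityMeasure (Measure.pi fun i => κ i x)
    infer_instance⟩

/-! ### Multi-task MDPs with a parametrised policy and linear features -/

/-- `K` discounted MDPs on common state and action spaces (arbitrary measurable spaces), a policy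
class `π_θ`, `θ ∈ ℝᵖ`, given by strictly positive densities `pol θ s a = π_θ(a|s)` with respect to
a reference measure on the actions (the counting measure, if the actions are discrete), and
feature maps with values in `ℝᵐ`. -/
structure MultiTaskMDP (S A : Type*) [MeasurableSpace S] [MeasurableSpace A] (K p m : ℕ) where
  /-- discount factor -/
  γ : ℝ
  γ_nonneg : 0 ≤ γ
  γ_lt_one : γ < 1
  /-- transition kernels -/
  P : Fin K → Kernel (S × A) S
  P_markov : ∀ k, IsMarkovKernel (P k)
  /-- reward functions, with values in `[0, 1]` -/
  r : Fin K → S × A → ℝ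
  r_meas : ∀ k, Measurable (r k)
  r_mem : ∀ k z, r k z ∈ Set.Icc (0 : ℝ) 1
  /-- initial state distributions -/
  ξ : Fin K → Measure S
  ξ_prob : ∀ k, IsProbabilityMeasure (ξ k)
  /-- reference measure on the actions -/
  ν : Measure A
  ν_sigmaFinite : SigmaFinite ν
  /-- policy densities -/
  pol : Vec p → S → A → ℝ
  pol_meas : Measurable fun x : (Vec p × S) × A => pol x.1.1 x.1.2 x.2
  pol_pos : ∀ θ s a, 0 < pol θ s a
  pol_mass : ∀ θ s, ∫⁻ a, ENNReal.ofReal (pol θ s a) ∂ν = 1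
  /-- feature maps -/
  φ : Fin K → S × A → Vec m
  φ_meas : ∀ k, Measurable (φ k)

namespace MultiTaskMDP

variable {S A : Type*} [MeasurableSpace S] [MeasurableSpace A] {K p m : ℕ}
  (M : MultiTaskMDP S A K p m)

instance (k : Fin K) : IsMarkovKernel (M.P k) := M.P_markov k
instance (k : Fin K) : IsProbabilityMeasure (M.ξ k) := M.ξ_prob k
instance : SigmaFinite M.ν := M.ν_sigmaFinite

/-- The policy as a kernel: `(θ, s) ↦ π_θ(·|s)`. -/
def polKernel : Kernel (Vec p × S) A :=
  Kernel.withDensity (Kernel.const _ M.ν) fun x a => ENNReal.ofReal (M.pol x.1 x.2 a)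

instance : IsMarkovKernel M.polKernel := ⟨fun x => ⟨by
  rw [polKernel, Kernel.withDensity_apply' _ M.pol_meas.ennreal_ofReal]
  simpa using M.pol_mass x.1 x.2⟩⟩

/-- The state-action chain of task `k`:
`(θ, (s, a)) ↦` law of `(s', a')`, `s' ∼ P_k(·|s, a)`, `a' ∼ π_θ(·|s')`. -/
def saStep (k : Fin K) : Kernel (Vec p × (S × A)) (S × A) :=
  (M.P k).comap Prod.snd measurable_snd ⊗ₖ
    M.polKernel.comap (fun x : (Vec p × (S × A)) × S => (x.1.1, x.2)) (by fun_prop)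

instance (k : Fin K) : IsMarkovKernel (M.saStep k) := by
  unfold saStep; infer_instance

/-- `(θ, (s, a)) ↦` law of `(s_t, a_t)` given `(s₀, a₀) = (s, a)` under `π_θ` and `P_k`. -/
def saIter (k : Fin K) : ℕ → Kernel (Vec p × (S × A)) (S × A)
  | 0 => Kernel.deterministic Prod.snd measurable_snd
  | t + 1 => M.saStep k ∘ₖ (Kernel.deterministic Prod.fst measurable_fst ×ₖ saIter k t)

instance (k : Fin K) (t : ℕ) : IsMarkovKernel (M.saIter k t) := by
  induction t with
  | zero => unfold saIter; infer_instance
  | succ t ih => unfold saIter; infer_instance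

/-- `θ ↦` law of `(s₀, a₀)` with `s₀ ∼ μ`, `a₀ ∼ π_θ(·|s₀)`. -/
def startLaw (μ : Measure S) : Kernel (Vec p) (S × A) :=
  Kernel.const _ μ ⊗ₖ M.polKernel

instance (μ : Measure S) [IsProbabilityMeasure μ] : IsMarkovKernel (M.startLaw μ) := by
  unfold startLaw; infer_instance

/-- `θ ↦` law of `(s_t, a_t)` given `s₀ ∼ μ`, under `π_θ` and `P_k`. -/
def lawAt (k : Fin K) (μ : Measure S) (t : ℕ) : Kernel (Vec p) (S × A) :=
  M.saIter k t ∘ₖ (Kernel.id ×ₖ M.startLaw μ)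

instance (k : Fin K) (μ : Measure S) [IsProbabilityMeasure μ] (t : ℕ) :
    IsMarkovKernel (M.lawAt k μ t) := by
  unfold lawAt; infer_instance

/-- The visitation distribution
`d^k_θ = (1 - γ) ∑ₜ γᵗ ℙ((s_t, a_t) ∈ · | s₀ ∼ ξ_k, π_θ, P_k)`. -/
def visit (k : Fin K) : Kernel (Vec p) (S × A) where
  toFun θ := Measure.sum fun t : ℕ =>
    ENNReal.ofReal ((1 - M.γ) * M.γ ^ t) • M.lawAt k (M.ξ k) t θ
  measurable' := by
    refine Measure.measurable_of_measurable_coe _ fun s hs => ?_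
    simp_rw [Measure.sum_apply _ hs, Measure.smul_apply, smul_eq_mul]
    exact Measurable.tsum fun t => ((M.lawAt k (M.ξ k) t).measurable_coe hs).const_mul _

instance (k : Fin K) : IsMarkovKernel (M.visit k) := ⟨fun θ => ⟨by
  change (Measure.sum fun t : ℕ =>
    ENNReal.ofReal ((1 - M.γ) * M.γ ^ t) • M.lawAt k (M.ξ k) t θ) Set.univ = 1
  have h0 : 0 < 1 - M.γ := sub_pos.2 M.γ_lt_one
  have hs : HasSum (fun t : ℕ => (1 - M.γ) * M.γ ^ t) 1 := by
    have := (hasSum_geometric_of_lt_one M.γ_nonneg M.γ_lt_one).mul_left (1 - M.γ)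
    rwa [mul_inv_cancel₀ h0.ne'] at this
  rw [Measure.sum_apply _ MeasurableSet.univ]
  simp only [Measure.smul_apply, measure_univ, smul_eq_mul, mul_one]
  rw [← ENNReal.ofReal_tsum_of_nonneg
    (fun t => mul_nonneg h0.le (pow_nonneg M.γ_nonneg t)) hs.summable, hs.tsum_eq,
    ENNReal.ofReal_one]⟩⟩

/-- The action-value function `Q^k_{π_θ}(s, a) = 𝔼[∑ₜ γᵗ r_k(s_t, a_t) | (s₀, a₀) = (s, a)]`. -/
def Q (k : Fin K) (θ : Vec p) (z : S × A) : ℝ :=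
  ∑' t : ℕ, M.γ ^ t * ∫ y, M.r k y ∂(M.saIter k t (θ, z))

/-- The objective `J^k(θ) = 𝔼[∑ₜ γᵗ r_k(s_t, a_t) | s₀ ∼ ξ_k]`. -/
def J (k : Fin K) (θ : Vec p) : ℝ :=
  ∑' t : ℕ, M.γ ^ t * ∫ y, M.r k y ∂(M.lawAt k (M.ξ k) t θ)

/-- The score function `ψ_θ(s, a) = ∇_θ log π_θ(a|s)`. -/
def ψ (θ : Vec p) (z : S × A) : Vec p :=
  gradient (fun θ' => Real.log (M.pol θ' z.1 z.2)) θ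

/-- `L_J`: the least common Lipschitz constant of the gradients `∇J^k`. -/
def lipJ : ℝ :=
  sInf {L : ℝ | 0 ≤ L ∧ ∀ k θ θ', ‖gradient (M.J k) θ - gradient (M.J k) θ'‖ ≤ L * ‖θ - θ'‖}

/-! ### Assumptions of the analysis -/

/-- Smoothness and boundedness of the policy class and of the features. -/
structure Smooth (Cφ Cπ Lφ : ℝ) : Prop where
  diff : ∀ s a, Differentiable ℝ fun θ => Real.log (M.pol θ s a)
  score_le : ∀ θ z, ‖M.ψ θ z‖ ≤ Cφ
  feature_le : ∀ k z, ‖M.φ k z‖ ≤ Cφ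
  pol_lip : ∀ θ θ' s a, |M.pol θ s a - M.pol θ' s a| ≤ Cπ * ‖θ - θ'‖
  score_lip : ∀ θ θ' z, ‖M.ψ θ z - M.ψ θ' z‖ ≤ Lφ * ‖θ - θ'‖

/-- Uniform ergodicity: `sup_s ‖ℙ((s_t, a_t) ∈ · | s₀ = s, π_θ, P_k) - d^k_θ‖_TV ≤ κ ρᵗ`. -/
def UniformlyErgodic (κ ρ : ℝ) : Prop :=
  ∀ (k : Fin K) (θ : Vec p) (s : S) (t : ℕ) (E : Set (S × A)), MeasurableSet E →
    |(M.lawAt k (Measure.dirac s) t θ).real E - (M.visit k θ).real E| ≤ κ * ρ ^ t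

/-- Law of `((s, a), (s', a'))` with `(s, a) ∼ d^k_θ`, `s' ∼ P_k(·|s, a)`, `a' ∼ π_θ(·|s')`. -/
def pairLaw (k : Fin K) (θ : Vec p) : Measure ((S × A) × (S × A)) :=
  M.visit k θ ⊗ₘ (M.saStep k).comap (fun z => (θ, z)) (by fun_prop)

/-- `A^k_θ = 𝔼[φ_k(s, a) (γ φ_k(s', a') - φ_k(s, a))ᵀ]`. -/
def tdMatrix (k : Fin K) (θ : Vec p) : Matrix (Fin m) (Fin m) ℝ :=
  Matrix.of fun i j => ∫ x, M.φ k x.1 i * (M.γ * M.φ k x.2 j - M.φ k x.1 j) ∂(M.pairLaw k θ)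

/-- `b^k_θ = 𝔼_{d^k_θ}[φ_k(s, a) r_k(s, a)]`. -/
def tdVector (k : Fin K) (θ : Vec p) : Fin m → ℝ :=
  fun i => ∫ z, M.φ k z i * M.r k z ∂(M.visit k θ)

/-- Every `A^k_θ` is negative definite, the quadratic form being at most `-lamA ‖x‖²`. -/
def Solvable (lamA : ℝ) : Prop :=
  ∀ (k : Fin K) (θ : Vec p) (x : Fin m → ℝ),
    x ⬝ᵥ (M.tdMatrix k θ).mulVec x ≤ -lamA * (x ⬝ᵥ x)

/-- The TD limiting point: the solution `w^{*k}_θ` of `A^k_θ w + b^k_θ = 0`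
(unique, as `A^k_θ` is invertible when it is negative definite). -/
def wStar (k : Fin K) (θ : Vec p) : Vec m :=
  WithLp.toLp 2 (-((M.tdMatrix k θ)⁻¹.mulVec (M.tdVector k θ)))

/-- The function approximation error
`ε_app = sup_{θ, k} (𝔼_{d^k_θ}[(φ_k(s, a)ᵀ w^{*k}_θ - Q^k_θ(s, a))²])^{1/2}`. -/
def εapp : ℝ :=
  ⨆ x : Vec p × Fin K,
    √(∫ z, (inner ℝ (M.φ x.2 z) (M.wStar x.2 x.1) - M.Q x.2 x.1 z) ^ 2 ∂(M.visit x.2 x.1))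

end MultiTaskMDP

/-! ### The algorithm MTAC-FC -/

/-- The probability simplex `Λ` over the tasks. -/
def simplex (K : ℕ) : Set (Vec K) := {l | (∀ k, 0 ≤ l k) ∧ ∑ k, l k = 1}

/-- Parameters of MTAC-FC. -/
structure Params where
  /-- actor step size -/
  β : ℝ
  /-- step size of the weight update -/
  c : ℝ
  /-- the critic step sizes are `1 / (2 lamA (j + 1))` -/
  lamA : ℝ
  /-- radius of the ball onto which the critic projects -/
  B : ℝ
  Ncritic : ℕ
  NFC : ℕ
  Nactor : ℕ
  /-- whether the second factor of the weight update uses the second batch of samples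
  (`true`) or the first batch again (`false`) -/
  twoBatches : Bool

/-- Samples per task used in `T` iterations: each iteration uses a critic trajectory
`(s₀, a₀), …, (s_N, a_N)` with `N = Ncritic`, two batches of size `NFC`, and the actor batch. -/
def Params.samplesPerTask (a : Params) (T : ℕ) : ℕ :=
  T * ((a.Ncritic + 1) + 2 * a.NFC + a.Nactor)

/-- State `(θ_t, 𝐰_t, λ_t)` of the algorithm. -/
abbrev State (K p m : ℕ) : Type := Vec p × (Fin K → Vec m) × Vec K

namespace MultiTaskMDP

variable {S A : Type*} [MeasurableSpace S] [MeasurableSpace A] {K p m : ℕ}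
  (M : MultiTaskMDP S A K p m) (a : Params)

/-- One projected TD(0) update
`w ↦ 𝒯_B(w + α_j δ φ(z))`, `δ = r(z) + γ⟨φ(z'), w⟩ - ⟨φ(z), w⟩`, `α_j = 1 / (2 lamA (j + 1))`.
(For `B < 0`, where the ball is empty, the argmin is replaced by the identity.) -/
def tdUpdate (k : Fin K) (j : ℕ) (w : Vec m) (z z' : S × A) : Vec m :=
  metricProj (Metric.closedBall 0 a.B)
    (w + (1 / (2 * a.lamA * (j + 1)) *
      (M.r k z + M.γ * inner ℝ (M.φ k z') w - inner ℝ (M.φ k z) w)) • M.φ k z)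

theorem measurable_tdUpdate (k : Fin K) (j : ℕ) :
    Measurable fun x : (Vec m × (S × A)) × (S × A) => M.tdUpdate a k j x.1.1 x.1.2 x.2 := by
  have hp : Measurable (metricProj (Metric.closedBall (0 : Vec m) a.B)) := by
    rcases le_or_gt 0 a.B with hB | hB
    · exact (continuous_metricProj ⟨0, by simpa using hB⟩ Metric.isClosed_closedBall
        (convex_closedBall _ _)).measurable
    · have : metricProj (Metric.closedBall (0 : Vec m) a.B) = id := by
        funext v
        simp [metricProj, Metric.closedBall_eq_empty.2 hB]
      rw [this]
      exact measurable_id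
  have h1 := M.r_meas k
  have h2 := M.φ_meas k
  unfold tdUpdate
  refine hp.comp ?_
  fun_prop

/-- One critic step: `((θ, w₀), (w_j, z_j)) ↦` law of `(w_{j+1}, z_{j+1})`, where
`z_j = (s_j, a_j)`, `s_{j+1} ∼ P_k(·|s_j, a_j)` and `a_{j+1} ∼ π_θ(·|s_{j+1})`. -/
def criticStep (k : Fin K) (j : ℕ) :
    Kernel ((Vec p × Vec m) × (Vec m × (S × A))) (Vec m × (S × A)) :=
  (Kernel.deterministic Prod.snd measurable_snd ×ₖ
    (M.saStep k).comap (fun x : (Vec p × Vec m) × (Vec m × (S × A)) => (x.1.1, x.2.2))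
      (by fun_prop)).map
    fun y => (M.tdUpdate a k j y.1.1 y.1.2 y.2, y.2)

instance (k : Fin K) (j : ℕ) : IsMarkovKernel (M.criticStep a k j) :=
  Kernel.IsMarkovKernel.map _ ((M.measurable_tdUpdate a k j).prodMk measurable_snd)

/-- `(θ, w₀) ↦` law of `(w_j, z_j)`, the critic of task `k` being started at `w₀` and at
`z₀ ∼ d^k_θ`. -/
def criticLaw (k : Fin K) : ℕ → Kernel (Vec p × Vec m) (Vec m × (S × A))
  | 0 => Kernel.deterministic Prod.snd measurable_snd ×ₖ
      (M.visit k).comap Prod.fst measurable_fst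
  | j + 1 => M.criticStep a k j ∘ₖ (Kernel.id ×ₖ criticLaw k j)

instance (k : Fin K) (j : ℕ) : IsMarkovKernel (M.criticLaw a k j) := by
  induction j with
  | zero => unfold criticLaw; infer_instance
  | succ j ih => unfold criticLaw; infer_instance

/-- Critic phase: `(θ_t, 𝐰_t, λ_t) ↦` law of `𝐰_{t+1}` (independent critics for the tasks, that
of task `k` being started at `w^k_t`). -/
def criticPhase : Kernel (State K p m) (Fin K → Vec m) :=
  prodKernel fun k => (M.criticLaw a k a.Ncritic).fst.comap
    (fun x : State K p m => (x.1, x.2.1 k)) (by fun_prop)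

/-- A batch of `N` independent draws from `d^k_{θ_t}` for every task `k`, independent across the
tasks. -/
def batch (N : ℕ) : Kernel (State K p m) (Fin K → Fin N → S × A) :=
  prodKernel fun k => prodKernel fun _ : Fin N => (M.visit k).comap Prod.fst measurable_fst

/-- The gradient estimate of task `k` from a batch:
`(1/N) ∑ᵢ (φ_k(zᵢ)ᵀ w^k) ψ_θ(zᵢ)`. -/
def gradEst {N : ℕ} (θ : Vec p) (w : Fin K → Vec m) (z : Fin K → Fin N → S × A) (k : Fin K) :
    Vec p :=
  (N : ℝ)⁻¹ • ∑ i, inner ℝ (M.φ k (z k i)) (w k) • M.ψ θ (z k i)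

/-- FC subprocedure: `λ_{t+1} = 𝒯_Λ(λ_t - c λ_tᵀ ∇̄J ∇̄J'ᵀ)`. -/
def fcUpdate (θ : Vec p) (l : Vec K) (w : Fin K → Vec m) (z z' : Fin K → Fin a.NFC → S × A) :
    Vec K :=
  metricProj (simplex K) (l - a.c • WithLp.toLp 2 fun k =>
    inner ℝ (∑ i, l i • M.gradEst θ w z i) (M.gradEst θ w (if a.twoBatches then z' else z) k))

/-- Actor: `θ_{t+1} = θ_t + β λ_tᵀ ∇̃J(θ_t)`. -/
def actorUpdate (θ : Vec p) (l : Vec K) (w : Fin K → Vec m) (z : Fin K → Fin a.Nactor → S × A) :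
    Vec p :=
  θ + a.β • ∑ k, l k • M.gradEst θ w z k

/-- One iteration of MTAC-FC: `(θ_t, 𝐰_t, λ_t) ↦` law of `(θ_{t+1}, 𝐰_{t+1}, λ_{t+1})`; given
`(θ_t, 𝐰_t, λ_t)`, the critic phase, the two FC batches and the actor batch are independent. -/
def iteration : Kernel (State K p m) (State K p m) :=
  (Kernel.id ×ₖ (M.criticPhase a ×ₖ (M.batch a.NFC ×ₖ (M.batch a.NFC ×ₖ M.batch a.Nactor)))).map
    fun y => (M.actorUpdate a y.1.1 y.1.2.2 y.2.1 y.2.2.2.2, y.2.1,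
      M.fcUpdate a y.1.1 y.1.2.2 y.2.1 y.2.2.1 y.2.2.2.1)

/-- Law of `(θ_t, 𝐰_t, λ_t)` when MTAC-FC is initialised at `x₀ = (θ₀, 𝐰₀, λ₀)`. -/
def runLaw (x₀ : State K p m) : ℕ → Measure (State K p m)
  | 0 => Measure.dirac x₀
  | t + 1 => (runLaw x₀ t).bind (M.iteration a)

/-- Law of the parameter `θ_τ` of the policy that MTAC-FC returns after `T` iterations, where `τ`
is uniform on `{0, …, T - 1}` and independent of the run. -/
def outputLaw (x₀ : State K p m) (T : ℕ) : Measure (Vec p) :=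
  (T : ℝ≥0∞)⁻¹ • ∑ t ∈ Finset.range T, (M.runLaw a x₀ t).map Prod.fst

/-- `min_{λ ∈ Λ} ‖λᵀ ∇J(θ)‖²`. -/
def paretoGap (θ : Vec p) : ℝ :=
  ⨅ l : simplex K, ‖∑ k, (l : Vec K) k • gradient (M.J k) θ‖ ^ 2

/-- A random policy `π_θ`, `θ ∼ μ`, is `ε`-accurate Pareto stationary:
`𝔼[min_{λ ∈ Λ} ‖λᵀ ∇J(θ)‖²] ≤ ε`. The measurability that makes the expectation
meaningful is part of the claim. -/
def IsParetoStationary (μ : Measure (Vec p)) (ε : ℝ) : Prop :=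
  IsProbabilityMeasure μ ∧ Integrable M.paretoGap μ ∧ ∫ θ, M.paretoGap θ ∂μ ≤ ε

end MultiTaskMDP

end MTAC

end

/-! The argument is a Lyapunov analysis of the joint motion of parameter and weights. Fix a weight
`l₁` in the simplex (the initial one is taken) and consider `‖λ - l₁‖² / (2c) - (1-γ)/β · ∑ l₁ J`.
Let `b`, `b₁` be the mean gradient estimates weighted by the current `λ` and by `l₁`, and `d`, `d₁`
the corresponding exact directions `(1-γ) ∑ λ ∇J` and `(1-γ) ∑ l₁ ∇J`. The projected weight step
changes the first term by at most about `-⟨b, b⟩ + ⟨b, b₁⟩ + ‖b‖²/8`, and the actor step changes the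
second by at most `-⟨d₁, b⟩ + ‖b‖²/2`. The cross terms cancel up to the bias `⟨b, b₁ - d₁⟩`, and a
negative multiple of `‖b‖²` survives (`weightGain_add_actorGain_le`). So the potential falls on
average by `‖d‖²/8` up to errors, and `‖d‖²` dominates `(1-γ)²` times the Pareto gap. As the
potential is bounded, telescoping gives a rate `1/T` with constant step sizes `c` and `β`.

The errors are the sampling variance, of order `1/N` in the batch sizes, and the bias of the critic.
The latter consists of the mean-square distance of the critic to `wStar` and of `εapp`
(`Smooth.norm_meanGrad_sub_sq_le`). For projected TD(0) along one Markov trajectory the distance is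
controlled by `j ‖w_j - wStar‖²` corrected by a truncated solution of the Poisson equation, which
replaces the Markovian noise by its stationary mean (`integral_critic_error_le`). The resulting
bound is of order `1/√N`, so `ε⁻²` critic steps suffice; together with `ε⁻¹` iterations this gives
`ε⁻³` samples.

The gradients are accessible because ergodicity is assumed with the discounted visitation law as
limit. That law is therefore invariant, and the identity `d = (1-γ) μ₀ + γ d P`, with `μ₀` the law
of the first state-action pair, forces `d = μ₀`. The process started at `ξ` is thus stationary for
every `θ`, `J` is `(1-γ)⁻¹` times an expectation under `ξ ⊗ π_θ`, and differentiability, Lipschitz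
gradients and the policy gradient formula follow from the score identity for one action. -/

noncomputable section

namespace MTAC

/-! ### Bounded integrands, kernels and total variation -/

section Tools

variable {α β E : Type*} [MeasurableSpace α] [MeasurableSpace β]
  [NormedAddCommGroup E]

theorem integrable_of_norm_le {μ : Measure α} [IsFiniteMeasure μ] {f : α → E} {C : ℝ}
    (hf : StronglyMeasurable f) (hC : ∀ x, ‖f x‖ ≤ C) : Integrable f μ :=
  Integrable.of_bound hf.aestronglyMeasurable C (Filter.Eventually.of_forall hC)

variable [NormedSpace ℝ E]

theorem norm_integral_le_of_prob {μ : Measure α} [IsProbabilityMeasure μ] {f : α → E} {C : ℝ}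
    (hC : ∀ x, ‖f x‖ ≤ C) : ‖∫ x, f x ∂μ‖ ≤ C := by
  simpa using norm_integral_le_of_norm_le_const (μ := μ) (Filter.Eventually.of_forall hC)

theorem abs_integral_le_of_prob {μ : Measure α} [IsProbabilityMeasure μ] {f : α → ℝ} {C : ℝ}
    (hC : ∀ x, |f x| ≤ C) : |∫ x, f x ∂μ| ≤ C :=
  norm_integral_le_of_prob (f := f) hC

theorem integral_bind_of_integrable {μ : Measure α} {κ : Kernel α β} {f : β → E}
    (hf : Integrable f (μ.bind κ)) : ∫ y, f y ∂(μ.bind κ) = ∫ x, ∫ y, f y ∂(κ x) ∂μ := by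
  have h : μ.bind κ = (κ ∘ₖ Kernel.const Unit μ) () := by
    rw [Kernel.comp_apply, Kernel.const_apply]
  rw [h] at hf ⊢
  rw [Kernel.integral_comp hf, Kernel.const_apply]

/-- Layer-cake formula: each integral is that of the level-set probabilities over `(0, D]`, and
these differ by at most `δ` at every level. -/
theorem abs_integral_sub_le_of_nonneg {μ η : Measure α} [IsProbabilityMeasure μ]
    [IsProbabilityMeasure η] {δ : ℝ}
    (h : ∀ E : Set α, MeasurableSet E → |μ.real E - η.real E| ≤ δ) {f : α → ℝ}
    (hf : Measurable f) {D : ℝ} (h0 : ∀ x, 0 ≤ f x) (hD : ∀ x, f x ≤ D) :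
    |∫ x, f x ∂μ - ∫ x, f x ∂η| ≤ D * δ := by
  have hne : Nonempty α := nonempty_of_isProbabilityMeasure μ
  have hD0 : 0 ≤ D := (h0 hne.some).trans (hD _)
  have hb : ∀ x, ‖f x‖ ≤ D := fun x => by rw [Real.norm_of_nonneg (h0 x)]; exact hD x
  have hlc : ∀ (ζ : Measure α) [IsProbabilityMeasure ζ],
      ∫ x, f x ∂ζ = ∫ t in Set.Ioc 0 D, ζ.real {a | t ≤ f a} := fun ζ _ =>
    (integrable_of_norm_le hf.stronglyMeasurable hb).integral_eq_integral_Ioc_meas_le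
      (Filter.Eventually.of_forall h0) (Filter.Eventually.of_forall hD)
  have hint : ∀ (ζ : Measure α) [IsProbabilityMeasure ζ],
      Integrable (fun t => ζ.real {a | t ≤ f a}) (volume.restrict (Set.Ioc 0 D)) := fun ζ _ => by
    have hanti : Antitone fun t => ζ.real {a | t ≤ f a} := fun s t hst =>
      measureReal_mono fun a (ha : t ≤ f a) => hst.trans ha
    refine Integrable.of_bound hanti.measurable.aestronglyMeasurable 1
      (Filter.Eventually.of_forall fun t => ?_)
    rw [Real.norm_of_nonneg measureReal_nonneg]
    exact measureReal_le_one
  rw [hlc μ, hlc η, ← integral_sub (hint μ) (hint η), ← Real.norm_eq_abs]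
  refine (norm_setIntegral_le_of_norm_le_const (C := δ) (by simp)
    (fun t _ => h _ (measurableSet_le measurable_const hf))).trans_eq ?_
  rw [Real.volume_real_Ioc_of_le hD0]
  ring

/-- Adding `D` makes the function nonnegative with range in `[0, 2D]`, and the shift cancels between
two probability measures. -/
theorem abs_integral_sub_le_of_abs_le {μ η : Measure α} [IsProbabilityMeasure μ]
    [IsProbabilityMeasure η] {δ : ℝ}
    (h : ∀ E : Set α, MeasurableSet E → |μ.real E - η.real E| ≤ δ) {f : α → ℝ}
    (hf : Measurable f) {D : ℝ} (hD : ∀ x, |f x| ≤ D) :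
    |∫ x, f x ∂μ - ∫ x, f x ∂η| ≤ 2 * D * δ := by
  have hi : ∀ (ζ : Measure α) [IsProbabilityMeasure ζ], ∫ x, (f x + D) ∂ζ = ∫ x, f x ∂ζ + D :=
    fun ζ _ => by
      rw [integral_add (integrable_of_norm_le hf.stronglyMeasurable hD) (integrable_const _)]
      simp
  have := abs_integral_sub_le_of_nonneg h (hf.add_const D) (D := 2 * D)
    (fun x => by linarith [(abs_le.1 (hD x)).1]) (fun x => by linarith [(abs_le.1 (hD x)).2])
  rwa [hi μ, hi η, add_sub_add_right_eq_sub] at this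

theorem abs_integral_kernel_le {κ : Kernel α β} [IsMarkovKernel κ] {f : β → ℝ} {C : ℝ}
    (hC : ∀ x, |f x| ≤ C) (x : α) : |∫ y, f y ∂(κ x)| ≤ C :=
  norm_integral_le_of_prob (f := f) hC

theorem hasSum_mul_toReal {v : ℝ≥0∞} (hv : v ≠ ∞) {c : ℕ → ℝ} (hc : ∀ t, 0 ≤ c t)
    {f : ℕ → ℝ≥0∞} (h : v = ∑' t, ENNReal.ofReal (c t) * f t) :
    HasSum (fun t => c t * (f t).toReal) v.toReal := by
  have hne : ∑' t, ENNReal.ofReal (c t) * f t ≠ ∞ := h ▸ hv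
  have := ENNReal.hasSum_toReal hne
  rw [← ENNReal.tsum_toReal_eq fun t => ENNReal.ne_top_of_tsum_ne_top hne t, ← h] at this
  simpa only [ENNReal.toReal_mul, ENNReal.toReal_ofReal (hc _)] using this

end Tools

namespace MultiTaskMDP

variable {S A : Type*} [MeasurableSpace S] [MeasurableSpace A] {K p m : ℕ}
  (M : MultiTaskMDP S A K p m)

/-! ### The state-action chain for a fixed parameter -/

/-- The state-action chain of task `k` under `π_θ`. -/
def chain (k : Fin K) (θ : Vec p) : Kernel (S × A) (S × A) :=
  (M.saStep k).comap (fun z => (θ, z)) (by fun_prop)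

instance (k : Fin K) (θ : Vec p) : IsMarkovKernel (M.chain k θ) := by
  unfold chain; infer_instance

/-- The `t`-step transition kernel of the chain. -/
def chainIter (k : Fin K) (θ : Vec p) (t : ℕ) : Kernel (S × A) (S × A) :=
  (M.saIter k t).comap (fun z => (θ, z)) (by fun_prop)

instance (k : Fin K) (θ : Vec p) (t : ℕ) : IsMarkovKernel (M.chainIter k θ t) := by
  unfold chainIter; infer_instance

theorem chain_apply (k : Fin K) (θ : Vec p) (z : S × A) : M.chain k θ z = M.saStep k (θ, z) := rfl

theorem chainIter_apply (k : Fin K) (θ : Vec p) (t : ℕ) (z : S × A) :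
    M.chainIter k θ t z = M.saIter k t (θ, z) := rfl

theorem chainIter_zero (k : Fin K) (θ : Vec p) : M.chainIter k θ 0 = Kernel.id := by
  ext z : 1
  rw [chainIter_apply, saIter, Kernel.deterministic_apply, Kernel.id_apply]

theorem chainIter_succ (k : Fin K) (θ : Vec p) (t : ℕ) :
    M.chainIter k θ (t + 1) = M.chain k θ ∘ₖ M.chainIter k θ t := by
  ext z s hs
  rw [chainIter_apply, saIter, Kernel.comp_apply' _ _ _ hs, Kernel.comp_apply' _ _ _ hs,
    Kernel.lintegral_deterministic_prod _ _ _ (Kernel.measurable_coe _ hs)]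
  rfl

/-- The definition appends the new step at the end. Peeling it off at the start is the form needed
for the Poisson equation and for the policy gradient. -/
theorem chainIter_succ' (k : Fin K) (θ : Vec p) (t : ℕ) :
    M.chainIter k θ (t + 1) = M.chainIter k θ t ∘ₖ M.chain k θ := by
  induction t with
  | zero => rw [chainIter_succ, chainIter_zero, Kernel.comp_id, Kernel.id_comp]
  | succ t ih => rw [chainIter_succ, ih, ← Kernel.comp_assoc, ← chainIter_succ, ih]

theorem lawAt_eq_bind (k : Fin K) (μ : Measure S) [IsProbabilityMeasure μ] (t : ℕ) (θ : Vec p) :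
    M.lawAt k μ t θ = (M.startLaw μ θ).bind (M.chainIter k θ t) := by
  ext s hs
  rw [lawAt, Kernel.comp_apply' _ _ _ hs, Kernel.lintegral_id_prod
    (Kernel.measurable_coe _ hs), Measure.bind_apply hs (Kernel.aemeasurable _)]
  rfl

theorem lawAt_zero (k : Fin K) (μ : Measure S) [IsProbabilityMeasure μ] (θ : Vec p) :
    M.lawAt k μ 0 θ = M.startLaw μ θ := by
  rw [lawAt_eq_bind, chainIter_zero, Measure.id_comp]

theorem lawAt_succ (k : Fin K) (μ : Measure S) [IsProbabilityMeasure μ] (t : ℕ) (θ : Vec p) :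
    M.lawAt k μ (t + 1) θ = (M.lawAt k μ t θ).bind (M.chain k θ) := by
  rw [lawAt_eq_bind, lawAt_eq_bind, chainIter_succ, Measure.comp_assoc]

theorem chain_eq_bind (k : Fin K) (θ : Vec p) (z : S × A) :
    M.chain k θ z = M.P k z ⊗ₘ (M.polKernel.comap (fun s => (θ, s)) (by fun_prop)) := by
  ext s hs
  rw [chain_apply, saStep, Kernel.compProd_apply hs, Measure.compProd_apply hs]
  rfl

theorem startLaw_apply_eq (μ : Measure S) [IsProbabilityMeasure μ] (θ : Vec p) :
    M.startLaw μ θ = μ ⊗ₘ (M.polKernel.comap (fun s => (θ, s)) (by fun_prop)) := by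
  ext s hs
  rw [startLaw, Kernel.compProd_apply hs, Measure.compProd_apply hs]
  rfl

theorem chain_eq_startLaw (k : Fin K) (θ : Vec p) (z : S × A) :
    M.chain k θ z = M.startLaw (M.P k z) θ := by
  rw [chain_eq_bind, startLaw_apply_eq]

/-- One step from a state-action pair produces a fresh state with a fresh action. Ergodicity,
assumed for starts at a state, thereby reaches starts at a pair, at the cost of one unit of time in
the exponent of `ρ`. -/
theorem chainIter_succ_apply (k : Fin K) (θ : Vec p) (t : ℕ) (z : S × A) :
    M.chainIter k θ (t + 1) z = M.lawAt k (M.P k z) t θ := by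
  rw [chainIter_succ', Kernel.comp_apply, chain_eq_startLaw, lawAt_eq_bind]

theorem lawAt_real_eq_integral (k : Fin K) (μ : Measure S) [IsProbabilityMeasure μ] (t : ℕ)
    (θ : Vec p) {E : Set (S × A)} (hE : MeasurableSet E) :
    (M.lawAt k μ t θ).real E = ∫ s, (M.lawAt k (Measure.dirac s) t θ).real E ∂μ ∧
      Measurable fun s => (M.lawAt k (Measure.dirac s) t θ).real E := by
  have h1 : ∀ s, M.lawAt k (Measure.dirac s) t θ E
      = ∫⁻ a, M.chainIter k θ t (s, a) E ∂(M.polKernel (θ, s)) := fun s => by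
    rw [lawAt_eq_bind, Measure.bind_apply hE (Kernel.aemeasurable _), startLaw_apply_eq,
      Measure.lintegral_compProd (Kernel.measurable_coe _ hE), lintegral_dirac']
    · rfl
    · exact (Kernel.measurable_coe _ hE).lintegral_kernel_prod_right'
  have hm : Measurable fun s => M.lawAt k (Measure.dirac s) t θ E := by
    simp_rw [h1]
    exact (Kernel.measurable_coe (M.chainIter k θ t) hE).lintegral_kernel_prod_right'
      (κ := M.polKernel.comap (fun s => (θ, s)) (by fun_prop))
  refine ⟨?_, hm.ennreal_toReal⟩
  simp_rw [measureReal_def]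
  rw [integral_toReal hm.aemeasurable (Filter.Eventually.of_forall fun s => measure_lt_top _ _)]
  congr 1
  rw [lawAt_eq_bind, Measure.bind_apply hE (Kernel.aemeasurable _), startLaw_apply_eq,
      Measure.lintegral_compProd (Kernel.measurable_coe _ hE)]
  exact lintegral_congr fun s => (h1 s).symm

/-! ### Consequences of uniform ergodicity -/

variable {M}

theorem UniformlyErgodic.abs_lawAt_sub_le {κ ρ : ℝ} (h : M.UniformlyErgodic κ ρ) (k : Fin K)
    (θ : Vec p) (μ : Measure S) [IsProbabilityMeasure μ] (t : ℕ) {E : Set (S × A)}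
    (hE : MeasurableSet E) :
    |(M.lawAt k μ t θ).real E - (M.visit k θ).real E| ≤ κ * ρ ^ t := by
  obtain ⟨h1, h2⟩ := M.lawAt_real_eq_integral k μ t θ hE
  have hi : Integrable (fun s => (M.lawAt k (Measure.dirac s) t θ).real E) μ :=
    integrable_of_norm_le h2.stronglyMeasurable (C := 1) fun s => by
      rw [Real.norm_of_nonneg measureReal_nonneg]; exact measureReal_le_one
  have : (M.lawAt k μ t θ).real E - (M.visit k θ).real E
      = ∫ s, ((M.lawAt k (Measure.dirac s) t θ).real E - (M.visit k θ).real E) ∂μ := by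
    rw [integral_sub hi (integrable_const _), h1]
    simp
  rw [this, ← Real.norm_eq_abs]
  exact norm_integral_le_of_prob fun s => h k θ s t E hE

theorem UniformlyErgodic.abs_integral_chainIter_sub_le {κ ρ : ℝ} (h : M.UniformlyErgodic κ ρ)
    (k : Fin K) (θ : Vec p) (t : ℕ) (z : S × A) {f : S × A → ℝ} (hf : Measurable f) {D : ℝ}
    (hD : ∀ x, |f x| ≤ D) :
    |∫ y, f y ∂(M.chainIter k θ (t + 1) z) - ∫ y, f y ∂(M.visit k θ)| ≤ 2 * D * (κ * ρ ^ t) := by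
  rw [chainIter_succ_apply]
  exact abs_integral_sub_le_of_abs_le (fun E hE => h.abs_lawAt_sub_le k θ _ t hE) hf hD

/-- The limit law of a uniformly ergodic chain is invariant. -/
theorem UniformlyErgodic.bind_visit {κ ρ : ℝ} (hρ0 : 0 ≤ ρ) (hρ1 : ρ < 1)
    (h : M.UniformlyErgodic κ ρ) (k : Fin K) (θ : Vec p) :
    (M.visit k θ).bind (M.chain k θ) = M.visit k θ := by
  have : IsProbabilityMeasure ((M.visit k θ).bind (M.chain k θ)) := by infer_instance
  ext E hE
  rw [← measureReal_eq_measureReal_iff]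
  have hm : Measurable fun z => (M.chain k θ z).real E :=
    (Kernel.measurable_coe _ hE).ennreal_toReal
  have hle : ∀ z, |(M.chain k θ z).real E| ≤ 1 := fun z => by
    rw [abs_of_nonneg measureReal_nonneg]; exact measureReal_le_one
  have hb : ∀ (μ : Measure (S × A)) [IsProbabilityMeasure μ],
      (μ.bind (M.chain k θ)).real E = ∫ z, (M.chain k θ z).real E ∂μ := fun μ _ => by
    rw [measureReal_def, Measure.bind_apply hE (Kernel.aemeasurable _), ← integral_toReal
      (Kernel.measurable_coe _ hE).aemeasurable
      (Filter.Eventually.of_forall fun s => measure_lt_top _ _)]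
    rfl
  have hlim : Filter.Tendsto (fun t : ℕ => 2 * 1 * (κ * ρ ^ t) + κ * ρ ^ (t + 1)) Filter.atTop
      (nhds 0) := by
    have h0 := tendsto_pow_atTop_nhds_zero_of_lt_one hρ0 hρ1
    have := ((h0.const_mul κ).const_mul (2 * 1)).add
      (((Filter.tendsto_add_atTop_iff_nat 1).2 h0).const_mul κ)
    simpa using this
  -- Both `d P` and `d` are compared with the law at time `t + 1`: the first through the test
  -- function `z ↦ P(z, E)` at time `t`, the second directly. The sum of the errors vanishes as `t →
  -- ∞`.
  have hle' : ∀ t : ℕ, |((M.visit k θ).bind (M.chain k θ)).real E - (M.visit k θ).real E|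
      ≤ 2 * 1 * (κ * ρ ^ t) + κ * ρ ^ (t + 1) := fun t => by
    have h1 := abs_integral_sub_le_of_abs_le
      (fun E hE => h.abs_lawAt_sub_le k θ (M.ξ k) t (E := E) hE) hm hle
    have h2 := h.abs_lawAt_sub_le k θ (M.ξ k) (t + 1) hE
    rw [← hb, ← hb, ← lawAt_succ] at h1
    rw [abs_le] at *
    constructor <;> linarith [h1.1, h1.2, h2.1, h2.2]
  exact sub_eq_zero.1 (abs_nonpos_iff.1 (ge_of_tendsto' hlim hle'))

theorem visit_real_eq_tsum (k : Fin K) (θ : Vec p) {E : Set (S × A)} (hE : MeasurableSet E) :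
    HasSum (fun t : ℕ => (1 - M.γ) * M.γ ^ t * (M.lawAt k (M.ξ k) t θ).real E)
      ((M.visit k θ).real E) := by
  refine hasSum_mul_toReal (measure_ne_top _ _)
    (fun t => mul_nonneg (sub_pos.2 M.γ_lt_one).le (pow_nonneg M.γ_nonneg t)) ?_
  change (Measure.sum fun t : ℕ =>
    ENNReal.ofReal ((1 - M.γ) * M.γ ^ t) • M.lawAt k (M.ξ k) t θ) E = _
  simp_rw [Measure.sum_apply _ hE, Measure.smul_apply, smul_eq_mul]

/-- Every discounted visitation law satisfies `d = (1-γ) μ₀ + γ d P` with `μ₀` the law at time zero.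
Invariance `d P = d` turns this into `(1-γ) d = (1-γ) μ₀`. -/
theorem UniformlyErgodic.visit_eq_startLaw {κ ρ : ℝ} (hρ0 : 0 ≤ ρ) (hρ1 : ρ < 1)
    (h : M.UniformlyErgodic κ ρ) (k : Fin K) (θ : Vec p) :
    M.visit k θ = M.startLaw (M.ξ k) θ := by
  have hinv := h.bind_visit hρ0 hρ1 k θ
  have hγ : 1 - M.γ ≠ 0 := (sub_pos.2 M.γ_lt_one).ne'
  have hbind : (M.visit k θ).bind (M.chain k θ) = Measure.sum fun t : ℕ =>
      ENNReal.ofReal ((1 - M.γ) * M.γ ^ t) • M.lawAt k (M.ξ k) (t + 1) θ := by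
    ext E hE
    rw [Measure.bind_apply hE (Kernel.aemeasurable _)]
    change ∫⁻ a, _ ∂(Measure.sum fun t : ℕ =>
      ENNReal.ofReal ((1 - M.γ) * M.γ ^ t) • M.lawAt k (M.ξ k) t θ) = _
    rw [lintegral_sum_measure, Measure.sum_apply _ hE]
    refine tsum_congr fun t => ?_
    rw [lintegral_smul_measure, Measure.smul_apply, lawAt_succ,
      Measure.bind_apply hE (Kernel.aemeasurable _)]
  ext E hE
  rw [← measureReal_eq_measureReal_iff]
  have h1 := visit_real_eq_tsum (M := M) k θ hE
  have h2 : HasSum (fun t : ℕ => (1 - M.γ) * M.γ ^ t * (M.lawAt k (M.ξ k) (t + 1) θ).real E)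
      ((M.visit k θ).real E) := by
    refine hasSum_mul_toReal (measure_ne_top _ _)
      (fun t => mul_nonneg (sub_pos.2 M.γ_lt_one).le (pow_nonneg M.γ_nonneg t)) ?_
    rw [← hinv, hbind]
    simp_rw [Measure.sum_apply _ hE, Measure.smul_apply, smul_eq_mul]
  -- `γ` times the series for `(d P)(E) = d(E)` is the series for `d(E)` without its term at time
  -- zero, so the two sums can be equated.
  have h3 := (h2.mul_left M.γ)
  have h4 := (hasSum_nat_add_iff' 1).2 h1
  have h5 : (fun t : ℕ => (1 - M.γ) * M.γ ^ (t + 1) * (M.lawAt k (M.ξ k) (t + 1) θ).real E)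
      = fun t : ℕ => M.γ * ((1 - M.γ) * M.γ ^ t * (M.lawAt k (M.ξ k) (t + 1) θ).real E) := by
    funext t; ring
  rw [h5] at h4
  have h6 := h4.unique h3
  rw [Finset.sum_range_one, lawAt_zero, pow_zero, mul_one] at h6
  apply mul_left_cancel₀ hγ
  linarith

theorem UniformlyErgodic.lawAt_eq_visit {κ ρ : ℝ} (hρ0 : 0 ≤ ρ) (hρ1 : ρ < 1)
    (h : M.UniformlyErgodic κ ρ) (k : Fin K) (θ : Vec p) (t : ℕ) :
    M.lawAt k (M.ξ k) t θ = M.visit k θ := by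
  induction t with
  | zero => rw [lawAt_zero, h.visit_eq_startLaw hρ0 hρ1]
  | succ t ih => rw [lawAt_succ, ih, h.bind_visit hρ0 hρ1]

end MultiTaskMDP

namespace MultiTaskMDP

variable {S A : Type*} [MeasurableSpace S] [MeasurableSpace A] {K p m : ℕ}
  (M : MultiTaskMDP S A K p m)

/-! ### Densities and scores -/

theorem measurable_pol : Measurable fun x : Vec p × (S × A) => M.pol x.1 x.2.1 x.2.2 :=
  M.pol_meas.comp (f := fun x : Vec p × (S × A) => ((x.1, x.2.1), x.2.2)) (by fun_prop)

theorem polKernel_apply (θ : Vec p) (s : S) :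
    M.polKernel (θ, s) = M.ν.withDensity fun a => ENNReal.ofReal (M.pol θ s a) := by
  rw [polKernel, Kernel.withDensity_apply _ M.pol_meas.ennreal_ofReal, Kernel.const_apply]

/-- This moves all dependence on `θ` into a density with respect to a fixed measure, so that
expectations can be differentiated under the integral sign. -/
theorem startLaw_eq_withDensity (μ : Measure S) [IsProbabilityMeasure μ] (θ : Vec p) :
    M.startLaw μ θ
      = (μ.prod M.ν).withDensity fun z => ENNReal.ofReal (M.pol θ z.1 z.2) := by
  have hm : Measurable fun z : S × A => ENNReal.ofReal (M.pol θ z.1 z.2) :=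
    (M.measurable_pol.comp measurable_prodMk_left).ennreal_ofReal
  ext E hE
  rw [startLaw_apply_eq, Measure.compProd_apply hE, withDensity_apply _ hE,
    ← lintegral_indicator hE, lintegral_prod _ (hm.indicator hE).aemeasurable]
  refine lintegral_congr fun s => ?_
  rw [Kernel.comap_apply, polKernel_apply, withDensity_apply _ (measurable_prodMk_left hE),
    ← lintegral_indicator (measurable_prodMk_left hE)]
  rfl

variable {M}

section Smooth

variable {Cφ Cπ Lφ : ℝ} (hS : M.Smooth Cφ Cπ Lφ)
include hS

theorem Smooth.hasGradientAt_log (θ : Vec p) (z : S × A) :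
    HasGradientAt (fun θ' => Real.log (M.pol θ' z.1 z.2)) (M.ψ θ z) θ :=
  (hS.diff z.1 z.2 θ).hasGradientAt

theorem Smooth.abs_log_sub_le (θ θ' : Vec p) (z : S × A) :
    |Real.log (M.pol θ z.1 z.2) - Real.log (M.pol θ' z.1 z.2)| ≤ Cφ * ‖θ - θ'‖ := by
  refine (convex_univ (𝕜 := ℝ)).norm_image_sub_le_of_norm_hasFDerivWithin_le
    (f := fun θ => Real.log (M.pol θ z.1 z.2))
    (fun x _ => (hS.hasGradientAt_log x z).hasFDerivAt.hasFDerivWithinAt) (fun x _ => ?_)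
    (Set.mem_univ θ') (Set.mem_univ θ)
  rw [LinearIsometryEquiv.norm_map]
  exact hS.score_le x z

theorem Smooth.hasFDerivAt_pol (θ : Vec p) (z : S × A) :
    HasFDerivAt (fun θ' => M.pol θ' z.1 z.2)
      (M.pol θ z.1 z.2 • InnerProductSpace.toDual ℝ (Vec p) (M.ψ θ z)) θ := by
  have h := (hS.hasGradientAt_log θ z).hasFDerivAt.exp
  simpa only [Real.exp_log (M.pol_pos _ _ _)] using h

/-- A bounded score makes the log-density Lipschitz, hence densities at nearby parameters comparable
up to a factor. This supplies the integrable majorant for differentiation under the integral. -/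
theorem Smooth.pol_le (θ θ' : Vec p) (z : S × A) :
    M.pol θ z.1 z.2 ≤ Real.exp (Cφ * ‖θ - θ'‖) * M.pol θ' z.1 z.2 := by
  have h := (abs_le.1 (hS.abs_log_sub_le θ θ' z)).2
  rw [← Real.exp_log (M.pol_pos θ z.1 z.2), ← Real.exp_log (M.pol_pos θ' z.1 z.2), ← Real.exp_add,
    Real.log_exp, Real.log_exp] at *
  exact Real.exp_le_exp.2 (by linarith)

/-- From `1 + x ≤ exp x` applied to the difference of the log-densities. The bound is by the
densities themselves, so it integrates to `2 Cφ ‖θ - θ'‖`; a constant bound need not be integrable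
against the reference measure. -/
theorem Smooth.abs_pol_sub_le (θ θ' : Vec p) (z : S × A) :
    |M.pol θ z.1 z.2 - M.pol θ' z.1 z.2|
      ≤ Cφ * ‖θ - θ'‖ * (M.pol θ z.1 z.2 + M.pol θ' z.1 z.2) := by
  have key : ∀ θ θ' : Vec p, M.pol θ z.1 z.2 - M.pol θ' z.1 z.2
      ≤ Cφ * ‖θ - θ'‖ * (M.pol θ z.1 z.2 + M.pol θ' z.1 z.2) := fun θ θ' => by
    have h0 : 0 ≤ Cφ * ‖θ - θ'‖ := (abs_nonneg _).trans (hS.abs_log_sub_le θ θ' z)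
    have h := (abs_le.1 (hS.abs_log_sub_le θ' θ z)).1
    rw [norm_sub_rev] at h
    have h1 := M.pol_pos θ z.1 z.2
    have h2 := M.pol_pos θ' z.1 z.2
    have h3 : M.pol θ' z.1 z.2
        = M.pol θ z.1 z.2 * Real.exp (Real.log (M.pol θ' z.1 z.2) - Real.log (M.pol θ z.1 z.2)) := by
      rw [Real.exp_sub, Real.exp_log h1, Real.exp_log h2]
      field_simp
    have h4 := Real.add_one_le_exp
      (Real.log (M.pol θ' z.1 z.2) - Real.log (M.pol θ z.1 z.2))
    have h5 : M.pol θ z.1 z.2 * (1 - Cφ * ‖θ - θ'‖) ≤ M.pol θ' z.1 z.2 := by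
      rw [h3]
      exact mul_le_mul_of_nonneg_left (by linarith) h1.le
    nlinarith [mul_nonneg h0 h2.le]
  refine abs_le.2 ⟨?_, key θ θ'⟩
  have := key θ' θ
  rw [norm_sub_rev, add_comm (M.pol θ' z.1 z.2)] at this
  linarith

/-- Each coordinate of the score is a pointwise limit of the difference quotients of `log π` with
increment `1/n`, which are jointly measurable. -/
theorem Smooth.measurable_ψ : Measurable fun x : Vec p × (S × A) => M.ψ x.1 x.2 := by
  have hc : ∀ i : Fin p, Measurable fun x : Vec p × (S × A) => M.ψ x.1 x.2 i := fun i => by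
    refine measurable_of_tendsto_metrizable (f := fun (n : ℕ) (x : Vec p × (S × A)) =>
      (n : ℝ) • (Real.log (M.pol (x.1 + (n : ℝ)⁻¹ • EuclideanSpace.single i (1 : ℝ)) x.2.1 x.2.2)
        - Real.log (M.pol x.1 x.2.1 x.2.2))) (fun n => ?_) (tendsto_pi_nhds.2 fun x => ?_)
    · have h1 : Measurable fun x : Vec p × (S × A) =>
          M.pol (x.1 + (n : ℝ)⁻¹ • EuclideanSpace.single i (1 : ℝ)) x.2.1 x.2.2 :=
        M.measurable_pol.comp (f := fun x : Vec p × (S × A) =>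
          (x.1 + (n : ℝ)⁻¹ • EuclideanSpace.single i (1 : ℝ), x.2)) (by fun_prop)
      exact (h1.log.sub M.measurable_pol.log).const_mul (n : ℝ)
    · have h := ((hS.hasGradientAt_log x.1 x.2).hasFDerivAt.lim_real
        (EuclideanSpace.single i (1 : ℝ))).comp tendsto_natCast_atTop_atTop
      have e : (InnerProductSpace.toDual ℝ (Vec p)) (M.ψ x.1 x.2) (EuclideanSpace.single i (1 : ℝ))
          = M.ψ x.1 x.2 i := by
        simp [InnerProductSpace.toDual_apply_apply, EuclideanSpace.inner_single_right]
      rw [e] at h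
      exact h
  exact (WithLp.measurable_toLp 2 _).comp (measurable_pi_lambda _ hc)

theorem Smooth.measurable_ψ_right (θ : Vec p) : Measurable (M.ψ θ) :=
  hS.measurable_ψ.comp measurable_prodMk_left

end Smooth

variable (M) in
theorem measurable_pol_right (θ : Vec p) : Measurable fun z : S × A => M.pol θ z.1 z.2 :=
  M.measurable_pol.comp measurable_prodMk_left

variable (M) in
theorem integral_startLaw {E : Type*} [NormedAddCommGroup E] [NormedSpace ℝ E]
    (μ : Measure S) [IsProbabilityMeasure μ] (θ : Vec p) (f : S × A → E) :
    ∫ z, f z ∂(M.startLaw μ θ) = ∫ z, M.pol θ z.1 z.2 • f z ∂(μ.prod M.ν) := by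
  rw [startLaw_eq_withDensity, integral_withDensity_eq_integral_toReal_smul
    (M.measurable_pol_right θ).ennreal_ofReal (Filter.Eventually.of_forall fun _ => by simp)]
  refine integral_congr_ae (Filter.Eventually.of_forall fun z => ?_)
  simp only [ENNReal.toReal_ofReal (M.pol_pos _ _ _).le]

variable (M) in
theorem integrable_pol (μ : Measure S) [IsProbabilityMeasure μ] (θ : Vec p) :
    Integrable (fun z : S × A => M.pol θ z.1 z.2) (μ.prod M.ν) := by
  have h : Integrable (fun _ : S × A => (1 : ℝ)) (M.startLaw μ θ) := integrable_const _
  rw [startLaw_eq_withDensity, integrable_withDensity_iff_integrable_smul'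
    (M.measurable_pol_right θ).ennreal_ofReal (Filter.Eventually.of_forall fun _ => by simp)] at h
  refine h.congr (Filter.Eventually.of_forall fun z => ?_)
  simp [ENNReal.toReal_ofReal (M.pol_pos _ _ _).le]

variable (M) in
theorem integral_pol (μ : Measure S) [IsProbabilityMeasure μ] (θ : Vec p) :
    ∫ z : S × A, M.pol θ z.1 z.2 ∂(μ.prod M.ν) = 1 := by
  have := M.integral_startLaw μ θ (fun _ => (1 : ℝ))
  simpa using this.symm

/-! ### Differentiation of expectations with respect to the policy parameter -/

section Gradient

variable {Cφ Cπ Lφ : ℝ} (hS : M.Smooth Cφ Cπ Lφ)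
include hS

/-- The score-function identity: `∇π = π ψ`, and differentiation passes under the integral by
domination. -/
theorem Smooth.hasGradientAt_integral (μ : Measure S) [IsProbabilityMeasure μ] (θ : Vec p)
    {f : S × A → ℝ} (hf : Measurable f) {D : ℝ} (hD : ∀ z, |f z| ≤ D) :
    HasGradientAt (fun θ' => ∫ z, f z ∂(M.startLaw μ θ'))
      (∫ z, f z • M.ψ θ z ∂(M.startLaw μ θ)) θ := by
  simp_rw [integral_startLaw]
  have hCφ : ∀ z : S × A, 0 ≤ Cφ := fun z => (norm_nonneg _).trans (hS.score_le θ z)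
  have hm : ∀ θ', Measurable fun z : S × A => M.pol θ' z.1 z.2 • f z := fun θ' =>
    (M.measurable_pol_right θ').mul hf
  have hmψ : Measurable fun z : S × A => M.pol θ z.1 z.2 • f z • M.ψ θ z :=
    (M.measurable_pol_right θ).smul (hf.smul (hS.measurable_ψ_right θ))
  have hnorm : ∀ θ' z, ‖M.pol θ' z.1 z.2 • f z • M.ψ θ' z‖ ≤ M.pol θ' z.1 z.2 * (D * Cφ) :=
    fun θ' z => by
      rw [norm_smul, norm_smul, Real.norm_of_nonneg (M.pol_pos _ _ _).le, Real.norm_eq_abs]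
      exact mul_le_mul_of_nonneg_left (mul_le_mul (hD z) (hS.score_le θ' z) (norm_nonneg _)
        ((abs_nonneg _).trans (hD z))) (M.pol_pos _ _ _).le
  have hint : Integrable (fun z : S × A => M.pol θ z.1 z.2 • f z • M.ψ θ z) (μ.prod M.ν) :=
    ((M.integrable_pol μ θ).mul_const (D * Cφ)).mono' hmψ.aestronglyMeasurable
      (Filter.Eventually.of_forall (hnorm θ))
  have hdual : Continuous (InnerProductSpace.toDual ℝ (Vec p)) :=
    (InnerProductSpace.toDual ℝ (Vec p)).continuous
  -- On the unit ball around `θ` the density is at most `exp Cφ` times its value at `θ`, which is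
  -- integrable.
  have key := hasFDerivAt_integral_of_dominated_of_fderiv_le (μ := μ.prod M.ν) (𝕜 := ℝ)
    (F := fun θ' (z : S × A) => M.pol θ' z.1 z.2 • f z)
    (F' := fun θ' z => InnerProductSpace.toDual ℝ (Vec p) (M.pol θ' z.1 z.2 • f z • M.ψ θ' z))
    (bound := fun z => Real.exp Cφ * M.pol θ z.1 z.2 * (D * Cφ))
    (x₀ := θ) (Metric.ball_mem_nhds θ one_pos)
    (Filter.Eventually.of_forall fun θ' => (hm θ').aestronglyMeasurable)
    (((M.integrable_pol μ θ).mul_const D).mono' (hm θ).aestronglyMeasurable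
      (Filter.Eventually.of_forall fun z => by
        rw [norm_smul, Real.norm_of_nonneg (M.pol_pos _ _ _).le, Real.norm_eq_abs]
        exact mul_le_mul_of_nonneg_left (hD z) (M.pol_pos _ _ _).le))
    (hdual.comp_aestronglyMeasurable hmψ.aestronglyMeasurable)
    (Filter.Eventually.of_forall fun z θ' hθ' => by
      rw [LinearIsometryEquiv.norm_map]
      refine (hnorm θ' z).trans (mul_le_mul_of_nonneg_right ?_
        (mul_nonneg ((abs_nonneg _).trans (hD z)) (hCφ z)))
      refine (hS.pol_le θ' θ z).trans (mul_le_mul_of_nonneg_right (Real.exp_le_exp.2 ?_)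
        (M.pol_pos _ _ _).le)
      rw [Metric.mem_ball, dist_eq_norm] at hθ'
      exact mul_le_of_le_one_right (hCφ z) hθ'.le)
    (((M.integrable_pol μ θ).const_mul _).mul_const _)
    (Filter.Eventually.of_forall fun z θ' _ => by
      refine ((hS.hasFDerivAt_pol θ' z).mul_const (f z)).congr_fderiv ?_
      rw [map_smul, map_smul, smul_comm])
  rw [hasGradientAt_iff_hasFDerivAt]
  refine key.congr_fderiv ?_
  ext v
  rw [ContinuousLinearMap.integral_apply]
  · simp_rw [InnerProductSpace.toDual_apply_apply, real_inner_comm v]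
    exact integral_inner (𝕜 := ℝ) hint v
  · exact (InnerProductSpace.toDual ℝ (Vec p)).integrable_comp_iff.2 hint

theorem Smooth.norm_integral_smul_ψ_sub_le (μ : Measure S) [IsProbabilityMeasure μ]
    (θ θ' : Vec p) {f : S × A → ℝ} (hf : Measurable f) (hD : ∀ z, |f z| ≤ 1) :
    ‖∫ z, f z • M.ψ θ z ∂(M.startLaw μ θ) - ∫ z, f z • M.ψ θ' z ∂(M.startLaw μ θ')‖
      ≤ (Lφ + 2 * Cφ ^ 2) * ‖θ - θ'‖ := by
  simp_rw [integral_startLaw]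
  have hint : ∀ θ, Integrable (fun z : S × A => M.pol θ z.1 z.2 • f z • M.ψ θ z)
      (μ.prod M.ν) := fun θ => by
    refine ((M.integrable_pol μ θ).mul_const Cφ).mono'
      ((M.measurable_pol_right θ).smul (hf.smul (hS.measurable_ψ_right θ))).aestronglyMeasurable
      (Filter.Eventually.of_forall fun z => ?_)
    rw [norm_smul, norm_smul, Real.norm_of_nonneg (M.pol_pos _ _ _).le, Real.norm_eq_abs]
    refine mul_le_mul_of_nonneg_left ?_ (M.pol_pos _ _ _).le
    exact (mul_le_of_le_one_left (norm_nonneg _) (hD z)).trans (hS.score_le θ z)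
  rw [← integral_sub (hint θ) (hint θ')]
  have hi1 := (M.integrable_pol μ θ).const_mul (Lφ * ‖θ - θ'‖)
  have hi2 := ((M.integrable_pol μ θ).add (M.integrable_pol μ θ')).const_mul (Cφ * ‖θ - θ'‖ * Cφ)
  refine (norm_integral_le_of_norm_le (hi1.add hi2)
    (Filter.Eventually.of_forall fun z => ?_)).trans_eq ?_
  · have e : M.pol θ z.1 z.2 • f z • M.ψ θ z - M.pol θ' z.1 z.2 • f z • M.ψ θ' z
        = f z • (M.pol θ z.1 z.2 • (M.ψ θ z - M.ψ θ' z)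
          + (M.pol θ z.1 z.2 - M.pol θ' z.1 z.2) • M.ψ θ' z) := by
      module
    rw [e, norm_smul, Real.norm_eq_abs]
    refine (mul_le_of_le_one_left (norm_nonneg _) (hD z)).trans ((norm_add_le _ _).trans ?_)
    rw [norm_smul, norm_smul, Real.norm_of_nonneg (M.pol_pos _ _ _).le, Real.norm_eq_abs]
    have h1 := mul_le_mul_of_nonneg_left (hS.score_lip θ θ' z) (M.pol_pos θ z.1 z.2).le
    have h2 := mul_le_mul (hS.abs_pol_sub_le θ θ' z) (hS.score_le θ' z) (norm_nonneg _)
      ((abs_nonneg _).trans (hS.abs_pol_sub_le θ θ' z))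
    simp only [Pi.add_apply]
    linarith
  · rw [integral_add' hi1 hi2, integral_const_mul, integral_const_mul,
      integral_add' (M.integrable_pol μ θ) (M.integrable_pol μ θ'), integral_pol, integral_pol]
    ring

end Gradient

end MultiTaskMDP

namespace MultiTaskMDP

variable {S A : Type*} [MeasurableSpace S] [MeasurableSpace A] {K p m : ℕ}
  (M : MultiTaskMDP S A K p m)

/-! ### The objectives and their gradients -/

theorem abs_r_le (k : Fin K) (z : S × A) : |M.r k z| ≤ 1 := by
  rw [abs_of_nonneg (M.r_mem k z).1]; exact (M.r_mem k z).2

theorem one_sub_γ_pos : 0 < 1 - M.γ := sub_pos.2 M.γ_lt_one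

theorem abs_Q_summand_le (k : Fin K) (θ : Vec p) (z : S × A) (t : ℕ) :
    |M.γ ^ t * ∫ y, M.r k y ∂(M.saIter k t (θ, z))| ≤ M.γ ^ t := by
  rw [abs_mul, abs_of_nonneg (pow_nonneg M.γ_nonneg t)]
  exact mul_le_of_le_one_right (pow_nonneg M.γ_nonneg t)
    (abs_integral_kernel_le (M.abs_r_le k) _)

theorem summable_γ : Summable fun t : ℕ => M.γ ^ t :=
  summable_geometric_of_lt_one M.γ_nonneg M.γ_lt_one

theorem abs_Q_le (k : Fin K) (θ : Vec p) (z : S × A) : |M.Q k θ z| ≤ (1 - M.γ)⁻¹ := by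
  rw [← tsum_geometric_of_lt_one M.γ_nonneg M.γ_lt_one]
  rw [Q, ← Real.norm_eq_abs]
  exact tsum_of_norm_bounded M.summable_γ.hasSum fun t => M.abs_Q_summand_le k θ z t

theorem measurable_integral_chainIter (k : Fin K) (θ : Vec p) (t : ℕ) {f : S × A → ℝ}
    (hf : Measurable f) : Measurable fun z => ∫ y, f y ∂(M.chainIter k θ t z) :=
  (hf.stronglyMeasurable.integral_kernel).measurable

theorem measurable_Q (k : Fin K) (θ : Vec p) : Measurable (M.Q k θ) := by
  refine measurable_of_tendsto_metrizable
    (f := fun (n : ℕ) z => ∑ t ∈ Finset.range n, M.γ ^ t * ∫ y, M.r k y ∂(M.saIter k t (θ, z)))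
    (fun n => ?_) (tendsto_pi_nhds.2 fun z => ?_)
  · exact Finset.measurable_sum _ fun t _ =>
      (M.measurable_integral_chainIter k θ t (M.r_meas k)).const_mul _
  · exact (Summable.of_norm_bounded M.summable_γ
      fun t => M.abs_Q_summand_le k θ z t).hasSum.tendsto_sum_nat

variable {M}

section Ergodic

variable {κ ρ : ℝ} (hρ0 : 0 ≤ ρ) (hρ1 : ρ < 1) (hE : M.UniformlyErgodic κ ρ)
include hρ0 hρ1 hE

theorem UniformlyErgodic.J_eq (k : Fin K) (θ : Vec p) :
    M.J k θ = (1 - M.γ)⁻¹ * ∫ y, M.r k y ∂(M.startLaw (M.ξ k) θ) := by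
  rw [J]
  simp_rw [hE.lawAt_eq_visit hρ0 hρ1, ← hE.visit_eq_startLaw hρ0 hρ1]
  rw [tsum_mul_right, tsum_geometric_of_lt_one M.γ_nonneg M.γ_lt_one]

theorem UniformlyErgodic.J_mem (k : Fin K) (θ : Vec p) :
    M.J k θ ∈ Set.Icc 0 (1 - M.γ)⁻¹ := by
  have h := inv_pos.2 M.one_sub_γ_pos
  rw [hE.J_eq hρ0 hρ1]
  refine ⟨mul_nonneg h.le (integral_nonneg fun z => (M.r_mem k z).1),
    mul_le_of_le_one_right h.le ?_⟩
  exact (abs_le.1 (abs_integral_le_of_prob (M.abs_r_le k))).2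

/-- The invariant law has state marginal `ξ`, so `ξ` is preserved by one step of the chain under
every policy. What matters is that the right-hand side does not depend on `θ`. -/
theorem UniformlyErgodic.integral_integral_P (k : Fin K) (θ : Vec p) {V : S → ℝ}
    (hV : Measurable V) {D : ℝ} (hD : ∀ s, |V s| ≤ D) :
    ∫ z, ∫ s, V s ∂(M.P k z) ∂(M.startLaw (M.ξ k) θ) = ∫ s, V s ∂(M.ξ k) := by
  have hf : Measurable fun z : S × A => V z.1 := hV.comp measurable_fst
  have hmarg : ∀ (μ : Measure S) [IsProbabilityMeasure μ],
      ∫ z, V z.1 ∂(M.startLaw μ θ) = ∫ s, V s ∂μ := fun μ _ => by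
    have hi : Integrable (fun z : S × A => V z.1) (M.startLaw μ θ) :=
      integrable_of_norm_le hf.stronglyMeasurable fun z => hD z.1
    rw [startLaw_apply_eq] at hi ⊢
    rw [Measure.integral_compProd hi]
    simp
  have hi : Integrable (fun z : S × A => V z.1) ((M.visit k θ).bind (M.chain k θ)) :=
    integrable_of_norm_le hf.stronglyMeasurable fun z => hD z.1
  have h1 := integral_bind_of_integrable hi
  rw [hE.bind_visit hρ0 hρ1, hE.visit_eq_startLaw hρ0 hρ1, hmarg] at h1
  rw [h1]
  simp_rw [chain_eq_startLaw, hmarg]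

section Smooth

variable {Cφ Cπ Lφ : ℝ} (hS : M.Smooth Cφ Cπ Lφ)
include hS

theorem UniformlyErgodic.hasGradientAt_J (k : Fin K) (θ : Vec p) :
    HasGradientAt (M.J k)
      ((1 - M.γ)⁻¹ • ∫ z, M.r k z • M.ψ θ z ∂(M.startLaw (M.ξ k) θ)) θ := by
  have h := hS.hasGradientAt_integral (M.ξ k) θ (M.r_meas k) (M.abs_r_le k)
  have e : M.J k = fun θ => (1 - M.γ)⁻¹ • ∫ y, M.r k y ∂(M.startLaw (M.ξ k) θ) :=
    funext fun θ => hE.J_eq hρ0 hρ1 k θ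
  rw [e, hasGradientAt_iff_hasFDerivAt, map_smul]
  exact h.hasFDerivAt.const_smul (1 - M.γ)⁻¹

/-- By the score identity this integral is the gradient of `θ ↦ ∫ P V`, which is constant by
`integral_integral_P`. -/
theorem UniformlyErgodic.integral_P_smul_ψ (k : Fin K) (θ : Vec p) {V : S → ℝ}
    (hV : Measurable V) {D : ℝ} (hD : ∀ s, |V s| ≤ D) :
    ∫ z, (∫ s, V s ∂(M.P k z)) • M.ψ θ z ∂(M.startLaw (M.ξ k) θ) = 0 := by
  have h := hS.hasGradientAt_integral (M.ξ k) θ (f := fun z => ∫ s, V s ∂(M.P k z))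
    hV.stronglyMeasurable.integral_kernel.measurable
    (fun z => abs_integral_kernel_le (κ := M.P k) hD z)
  simp_rw [hE.integral_integral_P hρ0 hρ1 k _ hV hD] at h
  exact h.unique (hasGradientAt_const θ _)

/-- The policy gradient theorem. -/
theorem UniformlyErgodic.integral_Q_smul_ψ (k : Fin K) (θ : Vec p) :
    ∫ z, M.Q k θ z • M.ψ θ z ∂(M.visit k θ) = (1 - M.γ) • gradient (M.J k) θ := by
  rw [(hE.hasGradientAt_J hρ0 hρ1 hS k θ).gradient, smul_inv_smul₀ M.one_sub_γ_pos.ne',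
    hE.visit_eq_startLaw hρ0 hρ1]
  -- `F t` is the `t`-th term of the series for `Q`, times the score. The geometric bound allows sum
  -- and integral to be exchanged.
  obtain ⟨F, hF⟩ : ∃ F : ℕ → S × A → Vec p, ∀ t z, F t z =
    (M.γ ^ t * ∫ y, M.r k y ∂(M.chainIter k θ t z)) • M.ψ θ z := ⟨_, fun _ _ => rfl⟩
  have hFm : ∀ t, Measurable (F t) := fun t => by
    rw [funext (hF t)]
    exact ((M.measurable_integral_chainIter k θ t (M.r_meas k)).const_mul _).smul
      (hS.measurable_ψ_right θ)
  have hFb : ∀ t z, ‖F t z‖ ≤ M.γ ^ t * Cφ := fun t z => by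
    rw [hF, norm_smul]
    exact mul_le_mul (M.abs_Q_summand_le k θ z t) (hS.score_le θ z) (norm_nonneg _)
      (pow_nonneg M.γ_nonneg t)
  have hsum := hasSum_integral_of_summable_integral_norm (μ := M.startLaw (M.ξ k) θ) (F := F)
    (fun t => integrable_of_norm_le (hFm t).stronglyMeasurable (hFb t))
    (Summable.of_nonneg_of_le (fun t => integral_nonneg fun z => norm_nonneg _)
      (fun t => (le_abs_self _).trans (abs_integral_le_of_prob (C := M.γ ^ t * Cφ) fun z => by
        rw [abs_norm]; exact hFb t z)) (M.summable_γ.mul_right Cφ))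
  have hQ : ∀ z, ∑' t, F t z = M.Q k θ z • M.ψ θ z := fun z => by
    have h : Summable fun t : ℕ => M.γ ^ t * ∫ y, M.r k y ∂(M.saIter k t (θ, z)) :=
      Summable.of_norm_bounded M.summable_γ fun t => M.abs_Q_summand_le k θ z t
    rw [Q, ← h.tsum_smul_const]
    exact tsum_congr fun t => hF t z
  rw [integral_congr_ae (Filter.Eventually.of_forall hQ)] at hsum
  refine hsum.unique ?_
  have h0 : ∫ z, M.r k z • M.ψ θ z ∂(M.startLaw (M.ξ k) θ)
      = ∫ z, F 0 z ∂(M.startLaw (M.ξ k) θ) := by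
    simp_rw [hF, chainIter_zero, Kernel.id_apply, integral_dirac' _ _
      (M.r_meas k).stronglyMeasurable, pow_zero, one_mul]
  rw [h0]
  -- For `t ≥ 1` the expected reward at time `t` has the form `P V`, as it depends on the pair only
  -- through the next state; such terms integrate to zero against the score. Only the immediate
  -- reward remains.
  refine hasSum_single 0 fun t ht => ?_
  obtain ⟨t, rfl⟩ := Nat.exists_eq_succ_of_ne_zero ht
  set g : S × A → ℝ := fun y => ∫ x, M.r k x ∂(M.chainIter k θ t y) with hg
  have hgm : Measurable g := M.measurable_integral_chainIter k θ t (M.r_meas k)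
  have hgb : ∀ y, |g y| ≤ 1 := abs_integral_kernel_le (M.abs_r_le k)
  have hVm : Measurable fun s => ∫ a, g (s, a) ∂(M.polKernel (θ, s)) :=
    (hgm.stronglyMeasurable.integral_kernel_prod_right'
      (κ := M.polKernel.comap (fun s => (θ, s)) (by fun_prop))).measurable
  have h := hE.integral_P_smul_ψ hρ0 hρ1 hS k θ hVm (D := 1)
    fun s => abs_integral_le_of_prob fun a => hgb (s, a)
  have e : ∀ z, F (t + 1) z = M.γ ^ (t + 1) •
      ((∫ s, ∫ a, g (s, a) ∂(M.polKernel (θ, s)) ∂(M.P k z)) • M.ψ θ z) := fun z => by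
    have hi1 : Integrable (M.r k) ((M.chainIter k θ t ∘ₖ M.chain k θ) z) :=
      integrable_of_norm_le (M.r_meas k).stronglyMeasurable (M.abs_r_le k)
    have hi2 : Integrable g (M.chain k θ z) :=
      integrable_of_norm_le hgm.stronglyMeasurable hgb
    rw [hF, chainIter_succ', Kernel.integral_comp hi1, smul_smul]
    change (_ * ∫ y, g y ∂(M.chain k θ z)) • _ = _
    rw [chain_eq_bind] at hi2 ⊢
    rw [Measure.integral_compProd hi2]
    rfl
  simp_rw [e]
  rw [integral_smul, h, smul_zero]

theorem UniformlyErgodic.norm_gradient_J_le (k : Fin K) (θ : Vec p) :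
    ‖gradient (M.J k) θ‖ ≤ (1 - M.γ)⁻¹ * Cφ := by
  have h := inv_pos.2 M.one_sub_γ_pos
  rw [(hE.hasGradientAt_J hρ0 hρ1 hS k θ).gradient, norm_smul, Real.norm_of_nonneg h.le]
  refine mul_le_mul_of_nonneg_left (norm_integral_le_of_prob fun z => ?_) h.le
  rw [norm_smul]
  exact (mul_le_of_le_one_left (norm_nonneg _) (M.abs_r_le k z)).trans (hS.score_le θ z)

/-- The set of common Lipschitz constants is closed and bounded below, so its infimum is attained
once the set is nonempty. -/
theorem UniformlyErgodic.norm_gradient_J_sub_le_lipJ (hL : 0 ≤ Lφ) (k : Fin K) (θ θ' : Vec p) :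
    ‖gradient (M.J k) θ - gradient (M.J k) θ'‖ ≤ M.lipJ * ‖θ - θ'‖ := by
  have h := inv_pos.2 M.one_sub_γ_pos
  set s : Set ℝ := {L : ℝ | 0 ≤ L ∧
    ∀ k θ θ', ‖gradient (M.J k) θ - gradient (M.J k) θ'‖ ≤ L * ‖θ - θ'‖} with hs
  have hcl : IsClosed s := by
    simp only [hs, Set.ofPred_and, Set.ofPred_forall]
    refine isClosed_Ici.inter (isClosed_iInter fun k => isClosed_iInter fun θ =>
      isClosed_iInter fun θ' => isClosed_le continuous_const (by fun_prop))
  -- Without a finite Lipschitz constant the real infimum would take the default value `0`; the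
  -- score representation of `∇J` provides one.
  have hne : s.Nonempty := by
    refine ⟨(1 - M.γ)⁻¹ * (Lφ + 2 * Cφ ^ 2), by positivity, fun k θ θ' => ?_⟩
    rw [(hE.hasGradientAt_J hρ0 hρ1 hS k θ).gradient,
      (hE.hasGradientAt_J hρ0 hρ1 hS k θ').gradient, ← smul_sub, norm_smul,
      Real.norm_of_nonneg h.le, mul_assoc]
    exact mul_le_mul_of_nonneg_left (hS.norm_integral_smul_ψ_sub_le _ θ θ' (M.r_meas k)
      (M.abs_r_le k)) h.le
  exact (hcl.csInf_mem hne ⟨0, fun L hL => hL.1⟩).2 k θ θ'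

end Smooth

end Ergodic

theorem lipJ_nonneg : 0 ≤ M.lipJ := Real.sInf_nonneg fun _ h => h.1

end MultiTaskMDP

/-- The angle at the projection between `v` and a point of the convex set is obtuse, so the cross
term in the expanded square has the right sign. -/
theorem norm_metricProj_sub_le {n : ℕ} {C : Set (Vec n)} (hcl : IsClosed C) (hcv : Convex ℝ C)
    (v : Vec n) {u : Vec n} (hu : u ∈ C) : ‖metricProj C v - u‖ ≤ ‖v - u‖ := by
  have h := metricProj_inner_le ⟨u, hu⟩ hcl hcv v u hu
  set q := metricProj C v
  have e : v - u = (v - q) + (q - u) := by abel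
  have h1 : inner ℝ (v - q) (q - u) = - inner ℝ (v - q) (u - q) := by
    rw [← inner_neg_right, neg_sub]
  have h2 : ‖v - u‖ ^ 2 = ‖v - q‖ ^ 2 + 2 * inner ℝ (v - q) (q - u) + ‖q - u‖ ^ 2 := by
    rw [e, norm_add_sq_real]
  exact (sq_le_sq₀ (norm_nonneg _) (norm_nonneg _)).1 (by nlinarith [sq_nonneg ‖v - q‖])

namespace MultiTaskMDP

variable {S A : Type*} [MeasurableSpace S] [MeasurableSpace A] {K p m : ℕ}
  (M : MultiTaskMDP S A K p m)

/-! ### The mean TD direction -/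

theorem dotProduct_eq_inner {n : ℕ} (x y : Vec n) : x.ofLp ⬝ᵥ y.ofLp = inner ℝ x y := by
  rw [EuclideanSpace.inner_eq_star_dotProduct, dotProduct_comm]
  simp

variable {M}

/-- A negative definite matrix has trivial kernel, so the matrix inverse in `wStar` is a genuine
inverse and not a default value. -/
theorem Solvable.tdMatrix_mulVec_wStar {lamA : ℝ} (hlam : 0 < lamA) (h : M.Solvable lamA)
    (k : Fin K) (θ : Vec p) :
    (M.tdMatrix k θ).mulVec (M.wStar k θ).ofLp = - M.tdVector k θ := by
  have hdet : IsUnit (M.tdMatrix k θ).det := by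
    rw [isUnit_iff_ne_zero]
    intro h0
    obtain ⟨v, hv, hv0⟩ := Matrix.exists_mulVec_eq_zero_iff.2 h0
    have h1 := h k θ v
    rw [hv0, dotProduct_zero] at h1
    have h2 : 0 < v ⬝ᵥ v := by
      refine lt_of_le_of_ne (Finset.sum_nonneg fun i _ => mul_self_nonneg _) fun h3 => hv ?_
      exact dotProduct_self_eq_zero.1 h3.symm
    nlinarith
  rw [wStar, Matrix.mulVec_neg, Matrix.mulVec_mulVec, Matrix.mul_nonsing_inv _ hdet,
    Matrix.one_mulVec]

variable (M) in
/-- The inner product of the TD direction `δ φ(z)` with `w - w^*`. -/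
def tdInner (k : Fin K) (v w : Vec m) (z z' : S × A) : ℝ :=
  (M.r k z + M.γ * inner ℝ (M.φ k z') w - inner ℝ (M.φ k z) w) * inner ℝ (M.φ k z) v

section Features

variable {Cφ : ℝ} (hφ : ∀ k z, ‖M.φ k z‖ ≤ Cφ)
include hφ

theorem abs_inner_φ_le (k : Fin K) (z : S × A) (w : Vec m) : |inner ℝ (M.φ k z) w| ≤ Cφ * ‖w‖ :=
  (abs_real_inner_le_norm _ _).trans (mul_le_mul_of_nonneg_right (hφ k z) (norm_nonneg _))

theorem integral_tdInner_pairLaw (k : Fin K) (θ : Vec p) (v w : Vec m) :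
    ∫ x, M.tdInner k v w x.1 x.2 ∂(M.pairLaw k θ)
      = v.ofLp ⬝ᵥ M.tdVector k θ + v.ofLp ⬝ᵥ (M.tdMatrix k θ).mulVec w.ofLp := by
  have hpr : IsProbabilityMeasure (M.pairLaw k θ) := by unfold pairLaw; infer_instance
  have hm := M.φ_meas k
  have hr := M.r_meas k
  have hc : ∀ z i, |M.φ k z i| ≤ Cφ := fun z i => (PiLp.norm_apply_le (M.φ k z) i).trans (hφ k z)
  have hcm : ∀ i, Measurable fun z => M.φ k z i := fun i => by fun_prop
  have h1 : ∀ x : (S × A) × (S × A), M.tdInner k v w x.1 x.2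
      = ∑ i, v i * (M.φ k x.1 i * M.r k x.1)
        + ∑ i, ∑ j, v i * w j * (M.φ k x.1 i * (M.γ * M.φ k x.2 j - M.φ k x.1 j)) := fun x => by
    have e1 : ∀ y, inner ℝ (M.φ k y) w = ∑ j, w j * M.φ k y j := fun y => by
      simp [PiLp.inner_apply]
    have e2 : inner ℝ (M.φ k x.1) v = ∑ j, v j * M.φ k x.1 j := by simp [PiLp.inner_apply]
    have e3 : M.γ * ∑ j, w j * M.φ k x.2 j - ∑ j, w j * M.φ k x.1 j
        = ∑ j, w j * (M.γ * M.φ k x.2 j - M.φ k x.1 j) := by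
      rw [Finset.mul_sum, ← Finset.sum_sub_distrib]
      exact Finset.sum_congr rfl fun j _ => by ring
    rw [tdInner, e1, e1, e2, add_sub_assoc, e3, add_mul, Finset.mul_sum]
    congr 1
    · exact Finset.sum_congr rfl fun i _ => by ring
    · rw [mul_comm, Finset.sum_mul_sum]
      exact Finset.sum_congr rfl fun i _ => Finset.sum_congr rfl fun j _ => by ring
  have hi1 : ∀ i, Integrable (fun x : (S × A) × (S × A) => M.φ k x.1 i * M.r k x.1)
      (M.pairLaw k θ) := fun i =>
    integrable_of_norm_le (C := Cφ * 1) (Measurable.stronglyMeasurable (by fun_prop)) fun x => by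
      rw [norm_mul]
      exact mul_le_mul (hc _ _) (M.abs_r_le k _) (norm_nonneg _) ((abs_nonneg _).trans (hc x.1 i))
  have hi2 : ∀ i j, Integrable (fun x : (S × A) × (S × A) =>
      M.φ k x.1 i * (M.γ * M.φ k x.2 j - M.φ k x.1 j)) (M.pairLaw k θ) := fun i j =>
    integrable_of_norm_le (C := Cφ * (Cφ + Cφ)) (Measurable.stronglyMeasurable (by fun_prop))
      fun x => by
      rw [norm_mul]
      refine mul_le_mul (hc _ _) ((norm_sub_le _ _).trans (add_le_add ?_ (hc _ _)))
        (norm_nonneg _) ((abs_nonneg _).trans (hc x.1 i))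
      rw [norm_mul, Real.norm_of_nonneg M.γ_nonneg]
      exact (mul_le_of_le_one_left (norm_nonneg _) M.γ_lt_one.le).trans (hc _ _)
  have hb : ∀ i, ∫ x, M.φ k x.1 i * M.r k x.1 ∂(M.pairLaw k θ) = M.tdVector k θ i := fun i => by
    have := hi1 i
    unfold pairLaw at this ⊢
    rw [Measure.integral_compProd this]
    simp [tdVector]
  simp_rw [h1]
  rw [integral_add (integrable_finsetSum _ fun i _ => (hi1 i).const_mul _)
    (integrable_finsetSum _ fun i _ => integrable_finsetSum _ fun j _ => (hi2 i j).const_mul _),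
    integral_finsetSum _ fun i _ => (hi1 i).const_mul _,
    integral_finsetSum _ fun i _ => integrable_finsetSum _ fun j _ => (hi2 i j).const_mul _]
  congr 1
  · simp_rw [integral_const_mul, hb]
    rfl
  · refine Finset.sum_congr rfl fun i _ => ?_
    rw [integral_finsetSum _ fun j _ => (hi2 i j).const_mul _, Matrix.mulVec, dotProduct,
      Finset.mul_sum]
    refine Finset.sum_congr rfl fun j _ => ?_
    rw [integral_const_mul, tdMatrix, Matrix.of_apply]
    ring

/-- Since `A wStar = -b`, the mean TD direction `b + A w` equals `A (w - wStar)`, and the quadratic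
form of `A` is at most `-lamA` times the squared norm. -/
theorem Solvable.integral_tdInner_le {lamA : ℝ} (hlam : 0 < lamA) (h : M.Solvable lamA)
    (k : Fin K) (θ : Vec p) (w : Vec m) :
    ∫ x, M.tdInner k (w - M.wStar k θ) w x.1 x.2 ∂(M.pairLaw k θ)
      ≤ -lamA * ‖w - M.wStar k θ‖ ^ 2 := by
  rw [integral_tdInner_pairLaw hφ]
  have h1 := h k θ (w - M.wStar k θ).ofLp
  rw [dotProduct_eq_inner (w - _) (w - _), real_inner_self_eq_norm_sq, WithLp.ofLp_sub, Matrix.mulVec_sub,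
    h.tdMatrix_mulVec_wStar hlam, sub_neg_eq_add, dotProduct_add] at h1
  rw [WithLp.ofLp_sub]
  linarith

theorem abs_td_error_le (k : Fin K) {w : Vec m} {B : ℝ} (hw : ‖w‖ ≤ B) (z z' : S × A) :
    |M.r k z + M.γ * inner ℝ (M.φ k z') w - inner ℝ (M.φ k z) w| ≤ 1 + 2 * Cφ * B := by
  have hC : 0 ≤ Cφ := (norm_nonneg _).trans (hφ k z)
  have h1 : ∀ z, |inner ℝ (M.φ k z) w| ≤ Cφ * B := fun z =>
    (abs_inner_φ_le hφ k z w).trans (mul_le_mul_of_nonneg_left hw hC)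
  refine (abs_sub _ _).trans ?_
  have h2 : |M.γ * inner ℝ (M.φ k z') w| ≤ Cφ * B := by
    rw [abs_mul, abs_of_nonneg M.γ_nonneg]
    exact (mul_le_of_le_one_left (abs_nonneg _) M.γ_lt_one.le).trans (h1 z')
  linarith [abs_add_le (M.r k z) (M.γ * inner ℝ (M.φ k z') w), M.abs_r_le k z, h1 z]

theorem abs_tdInner_le (k : Fin K) {v w : Vec m} {B D : ℝ} (hw : ‖w‖ ≤ B) (hv : ‖v‖ ≤ D)
    (z z' : S × A) : |M.tdInner k v w z z'| ≤ (1 + 2 * Cφ * B) * (Cφ * D) := by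
  have hC : 0 ≤ Cφ := (norm_nonneg _).trans (hφ k z)
  rw [tdInner, abs_mul]
  exact mul_le_mul (abs_td_error_le hφ k hw z z')
    ((abs_inner_φ_le hφ k z v).trans (mul_le_mul_of_nonneg_left hv hC)) (abs_nonneg _)
    ((abs_nonneg _).trans (abs_td_error_le hφ k hw z z'))

/-- The expression is a product of two affine functions of `w`. Varying the second factor costs `(1
+ 2 Cφ B) Cφ`, varying the TD error costs `2 Cφ · 2 Cφ B`. -/
theorem abs_tdInner_sub_le (k : Fin K) {u w w' : Vec m} {B : ℝ} (hu : ‖u‖ ≤ B) (hw : ‖w‖ ≤ B)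
    (hw' : ‖w'‖ ≤ B) (z z' : S × A) :
    |M.tdInner k (w - u) w z z' - M.tdInner k (w' - u) w' z z'|
      ≤ (1 + 6 * Cφ * B) * Cφ * ‖w - w'‖ := by
  have hC : 0 ≤ Cφ := (norm_nonneg _).trans (hφ k z)
  have e : M.tdInner k (w - u) w z z' - M.tdInner k (w' - u) w' z z'
      = M.tdInner k (w - w') w z z' + (M.γ * inner ℝ (M.φ k z') (w - w')
        - inner ℝ (M.φ k z) (w - w')) * inner ℝ (M.φ k z) (w' - u) := by
    simp only [tdInner, inner_sub_right]
    ring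
  rw [e]
  refine (abs_add_le _ _).trans ?_
  have h1 := abs_tdInner_le hφ k hw (le_refl ‖w - w'‖) z z'
  have h2 : |M.γ * inner ℝ (M.φ k z') (w - w') - inner ℝ (M.φ k z) (w - w')|
      ≤ 2 * (Cφ * ‖w - w'‖) := by
    refine (abs_sub _ _).trans ?_
    rw [abs_mul, abs_of_nonneg M.γ_nonneg, two_mul]
    exact add_le_add ((mul_le_of_le_one_left (abs_nonneg _) M.γ_lt_one.le).trans
      (abs_inner_φ_le hφ k z' _)) (abs_inner_φ_le hφ k z _)
  have h3 : |inner ℝ (M.φ k z) (w' - u)| ≤ Cφ * (B + B) :=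
    (abs_inner_φ_le hφ k z _).trans (mul_le_mul_of_nonneg_left
      ((norm_sub_le _ _).trans (add_le_add hw' hu)) hC)
  have h4 := mul_le_mul h2 h3 (abs_nonneg _) (by positivity)
  rw [abs_mul]
  nlinarith

end Features

/-! ### A truncated Poisson equation -/

variable (M) in
/-- The truncated solution `∑_{t < n} (𝔼[g(z_t) | z_0 = z] - 𝔼_{d^k_θ} g)` of the Poisson
equation for `g`. -/
def poisson (k : Fin K) (θ : Vec p) (n : ℕ) (g : S × A → ℝ) (z : S × A) : ℝ :=
  ∑ t ∈ Finset.range n, (∫ y, g y ∂(M.chainIter k θ t z) - ∫ y, g y ∂(M.visit k θ))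

theorem measurable_poisson (k : Fin K) (θ : Vec p) (n : ℕ) {g : S × A → ℝ} (hg : Measurable g) :
    Measurable (M.poisson k θ n g) :=
  Finset.measurable_sum _ fun t _ => (M.measurable_integral_chainIter k θ t hg).sub_const _

/-- One step of the chain shifts every summand from `t` to `t + 1`, so the sum telescopes.
Truncation avoids an infinite series and leaves one remainder, geometrically small in `n` under
uniform ergodicity. -/
theorem integral_chain_poisson (k : Fin K) (θ : Vec p) (n : ℕ) {g : S × A → ℝ} (hg : Measurable g)
    {D : ℝ} (hD : ∀ z, |g z| ≤ D) (z : S × A) :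
    ∫ y, M.poisson k θ n g y ∂(M.chain k θ z) = M.poisson k θ n g z
      - (g z - ∫ y, g y ∂(M.visit k θ))
      + (∫ y, g y ∂(M.chainIter k θ n z) - ∫ y, g y ∂(M.visit k θ)) := by
  have hi : ∀ t, Integrable (fun x => ∫ y, g y ∂(M.chainIter k θ t x)) (M.chain k θ z) := fun t =>
    integrable_of_norm_le (M.measurable_integral_chainIter k θ t hg).stronglyMeasurable
      (abs_integral_kernel_le hD)
  have h1 : ∀ t, ∫ x, ∫ y, g y ∂(M.chainIter k θ t x) ∂(M.chain k θ z)
      = ∫ y, g y ∂(M.chainIter k θ (t + 1) z) := fun t => by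
    rw [chainIter_succ', Kernel.integral_comp
      (integrable_of_norm_le hg.stronglyMeasurable hD)]
  unfold poisson
  have hi2 : ∀ t, Integrable (fun x => ∫ y, g y ∂(M.chainIter k θ t x)
      - ∫ y, g y ∂(M.visit k θ)) (M.chain k θ z) := fun t => (hi t).sub (integrable_const _)
  rw [integral_finsetSum _ fun t _ => hi2 t]
  have h2 : ∀ t, ∫ x, (∫ y, g y ∂(M.chainIter k θ t x) - ∫ y, g y ∂(M.visit k θ))
        ∂(M.chain k θ z)
      = ∫ y, g y ∂(M.chainIter k θ (t + 1) z) - ∫ y, g y ∂(M.visit k θ) := fun t => by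
    rw [integral_sub (hi t) (integrable_const _), h1]
    simp
  simp_rw [h2]
  have h3 := Finset.sum_range_succ (fun t => ∫ y, g y ∂(M.chainIter k θ t z)
    - ∫ y, g y ∂(M.visit k θ)) n
  rw [Finset.sum_range_succ'] at h3
  have h4 : ∫ y, g y ∂(M.chainIter k θ 0 z) = g z := by
    rw [chainIter_zero, Kernel.id_apply, integral_dirac' _ _ hg.stronglyMeasurable]
  rw [h4] at h3
  linarith

theorem poisson_sub (k : Fin K) (θ : Vec p) (n : ℕ) {g g' : S × A → ℝ} (hg : Measurable g)
    (hg' : Measurable g') {D : ℝ} (hD : ∀ z, |g z| ≤ D) (hD' : ∀ z, |g' z| ≤ D) (z : S × A) :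
    M.poisson k θ n (fun z => g z - g' z) z = M.poisson k θ n g z - M.poisson k θ n g' z := by
  have hi : ∀ (μ : Measure (S × A)) [IsProbabilityMeasure μ],
      ∫ y, (g y - g' y) ∂μ = ∫ y, g y ∂μ - ∫ y, g' y ∂μ := fun μ _ =>
    integral_sub (integrable_of_norm_le hg.stronglyMeasurable hD)
      (integrable_of_norm_le hg'.stronglyMeasurable hD')
  simp only [poisson, hi, ← Finset.sum_sub_distrib]
  exact Finset.sum_congr rfl fun t _ => by ring

/-- The summand at `t = 0`, where ergodicity says nothing about a start at a pair, is bounded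
trivially by `2 D`; the others are dominated by a geometric series. The bound is uniform in `n`. -/
theorem UniformlyErgodic.abs_poisson_le {κ ρ : ℝ} (hκ : 0 ≤ κ) (hρ0 : 0 ≤ ρ) (hρ1 : ρ < 1)
    (h : M.UniformlyErgodic κ ρ) (k : Fin K) (θ : Vec p) (n : ℕ) {g : S × A → ℝ}
    (hg : Measurable g) {D : ℝ} (hD : ∀ z, |g z| ≤ D) (z : S × A) :
    |M.poisson k θ n g z| ≤ (2 + 2 * κ / (1 - ρ)) * D := by
  have hD0 : 0 ≤ D := (abs_nonneg _).trans (hD z)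
  have hρ : 0 < 1 - ρ := sub_pos.2 hρ1
  refine (Finset.abs_sum_le_sum_abs _ _).trans ?_
  rcases n with _ | n
  · simp only [Finset.range_zero, Finset.sum_empty]; positivity
  rw [Finset.sum_range_succ', add_comm]
  have h0 : |∫ y, g y ∂(M.chainIter k θ 0 z) - ∫ y, g y ∂(M.visit k θ)| ≤ 2 * D := by
    refine (abs_sub _ _).trans ?_
    linarith [abs_integral_kernel_le (κ := M.chainIter k θ 0) hD z,
      abs_integral_kernel_le (κ := M.visit k) hD θ]
  have h1 : ∑ t ∈ Finset.range n,
      |∫ y, g y ∂(M.chainIter k θ (t + 1) z) - ∫ y, g y ∂(M.visit k θ)|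
      ≤ 2 * D * κ * (1 - ρ)⁻¹ := by
    rw [← tsum_geometric_of_lt_one hρ0 hρ1]
    refine (Finset.sum_le_sum fun t _ => h.abs_integral_chainIter_sub_le k θ t z hg hD).trans ?_
    simp_rw [← mul_assoc]
    rw [← Finset.mul_sum]
    exact mul_le_mul_of_nonneg_left ((summable_geometric_of_lt_one hρ0 hρ1).sum_le_tsum _
      fun t _ => pow_nonneg hρ0 t) (by positivity)
  refine (add_le_add h0 h1).trans_eq ?_
  field_simp

end MultiTaskMDP

/-- The harmonic increments are compared with `2 (√(j+1) - √j)`, which telescopes. A logarithm would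
be sharper, but the square root already fits `ε⁻²` critic steps. -/
theorem le_sqrt_of_recursion {a : ℕ → ℝ} {C η : ℝ} (hC : 0 ≤ C) (hη : 0 ≤ η)
    (h : ∀ j : ℕ, 1 ≤ j → a (j + 1) ≤ a j + C / (j + 1) + η) {j : ℕ} (hj : 1 ≤ j) :
    a j ≤ a 1 + 2 * C * √j + j * η := by
  induction j, hj using Nat.le_induction with
  | base =>
    simp only [Nat.cast_one, Real.sqrt_one, one_mul, mul_one]
    linarith
  | succ j hj ih =>
    have hj1 : (1 : ℝ) ≤ (j : ℝ) + 1 := by linarith [(Nat.cast_nonneg j : (0 : ℝ) ≤ j)]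
    have h1 : 1 / ((j : ℝ) + 1) ≤ 2 * (√((j : ℝ) + 1) - √j) := by
      have hs : 1 ≤ √((j : ℝ) + 1) := Real.one_le_sqrt.2 hj1
      have hs0 : 0 ≤ √(j : ℝ) := Real.sqrt_nonneg _
      have hle : √(j : ℝ) ≤ √((j : ℝ) + 1) := Real.sqrt_le_sqrt (by linarith)
      have e1 := Real.sq_sqrt (by linarith : (0 : ℝ) ≤ (j : ℝ) + 1)
      have e2 := Real.sq_sqrt (Nat.cast_nonneg j : (0 : ℝ) ≤ j)
      rw [div_le_iff₀ (by linarith)]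
      nlinarith [mul_nonneg (sub_nonneg.2 hs) (sub_nonneg.2 hle),
        mul_nonneg (sub_nonneg.2 hle) hs0]
    have h2 : C / ((j : ℝ) + 1) ≤ 2 * C * (√((j : ℝ) + 1) - √j) := by
      have := mul_le_mul_of_nonneg_left h1 hC
      calc C / ((j : ℝ) + 1) = C * (1 / ((j : ℝ) + 1)) := by ring
        _ ≤ _ := by linarith
    push_cast
    linarith [h j hj]

/-- Bound for the length of a TD direction over the ball of radius `B`. -/
def tdBound (Cφ B : ℝ) : ℝ := (1 + 2 * Cφ * B) * Cφ

/-- Constant of the drift of the critic's Lyapunov function. -/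
def driftConst (Cφ κ ρ lamA B : ℝ) : ℝ :=
  tdBound Cφ B ^ 2 / (4 * lamA ^ 2)
    + (2 + 2 * κ / (1 - ρ)) * ((1 + 6 * Cφ * B) * Cφ) * tdBound Cφ B / (2 * lamA ^ 2)

/-- Constant of the mean-square error of the critic. -/
def criticConst (Cφ κ ρ lamA B : ℝ) : ℝ :=
  4 * B ^ 2 + 2 * (lamA⁻¹ * ((2 + 2 * κ / (1 - ρ)) * (tdBound Cφ B * (2 * B))))
    + 2 * driftConst Cφ κ ρ lamA B + lamA⁻¹ * (2 * (tdBound Cφ B * (2 * B)) * κ)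

namespace MultiTaskMDP

variable {S A : Type*} [MeasurableSpace S] [MeasurableSpace A] {K p m : ℕ}
  (M : MultiTaskMDP S A K p m) (a : Params)

/-! ### The critic -/

/-- The conditional expectation of `tdInner` given the current state-action pair. -/
def tdMean (k : Fin K) (θ : Vec p) (w : Vec m) (z : S × A) : ℝ :=
  ∫ z', M.tdInner k (w - M.wStar k θ) w z z' ∂(M.chain k θ z)

/-- The Lyapunov function of the critic. -/
def criticLyapunov (lamA : ℝ) (k : Fin K) (θ : Vec p) (n j : ℕ) (x : Vec m × (S × A)) : ℝ :=
  j * ‖x.1 - M.wStar k θ‖ ^ 2 + lamA⁻¹ * M.poisson k θ n (M.tdMean k θ x.1) x.2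

theorem measurable_tdMean (k : Fin K) (θ : Vec p) :
    Measurable fun x : Vec m × (S × A) => M.tdMean k θ x.1 x.2 := by
  have hm := M.φ_meas k
  have hr := M.r_meas k
  have h : Measurable fun y : (Vec m × (S × A)) × (S × A) =>
      M.tdInner k (y.1.1 - M.wStar k θ) y.1.1 y.1.2 y.2 := by
    unfold tdInner
    fun_prop
  exact (h.stronglyMeasurable.integral_kernel_prod_right'
    (κ := (M.chain k θ).comap Prod.snd measurable_snd)).measurable

theorem measurable_tdMean_right (k : Fin K) (θ : Vec p) (w : Vec m) :
    Measurable (M.tdMean k θ w) :=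
  (M.measurable_tdMean k θ).comp measurable_prodMk_left

theorem measurable_criticLyapunov (lamA : ℝ) (k : Fin K) (θ : Vec p) (n j : ℕ) :
    Measurable (M.criticLyapunov lamA k θ n j) := by
  have h1 : ∀ t, Measurable fun x : Vec m × (S × A) =>
      ∫ y, M.tdMean k θ x.1 y ∂(M.chainIter k θ t x.2) := fun t =>
    (((M.measurable_tdMean k θ).comp (f := fun y : (Vec m × (S × A)) × (S × A) => (y.1.1, y.2))
      (by fun_prop)).stronglyMeasurable.integral_kernel_prod_right'
      (κ := (M.chainIter k θ t).comap Prod.snd measurable_snd)).measurable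
  have h2 : Measurable fun x : Vec m × (S × A) => ∫ y, M.tdMean k θ x.1 y ∂(M.visit k θ) :=
    (((M.measurable_tdMean k θ).comp (f := fun y : (Vec m × (S × A)) × (S × A) => (y.1.1, y.2))
      (by fun_prop)).stronglyMeasurable.integral_kernel_prod_right'
      (κ := Kernel.const _ (M.visit k θ))).measurable
  have h3 : Measurable fun x : Vec m × (S × A) => M.poisson k θ n (M.tdMean k θ x.1) x.2 :=
    Finset.measurable_sum _ fun t _ => (h1 t).sub h2
  unfold criticLyapunov
  fun_prop

theorem criticStep_apply (k : Fin K) (j : ℕ) (θ : Vec p) (w₀ : Vec m) (x : Vec m × (S × A)) :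
    M.criticStep a k j ((θ, w₀), x)
      = (M.chain k θ x.2).map fun z' => (M.tdUpdate a k j x.1 x.2 z', z') := by
  have hm := M.measurable_tdUpdate a k j
  have h2 : Measurable fun y : (Vec m × (S × A)) × (S × A) =>
      (M.tdUpdate a k j y.1.1 y.1.2 y.2, y.2) := hm.prodMk measurable_snd
  rw [criticStep, Kernel.map_apply _ h2, Kernel.prod_apply, Kernel.deterministic_apply,
    Measure.dirac_prod, Measure.map_map h2 measurable_prodMk_left]
  rfl

theorem criticLaw_succ_apply (k : Fin K) (j : ℕ) (y : Vec p × Vec m) :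
    M.criticLaw a k (j + 1) y = (M.criticLaw a k j y).bind
      ((M.criticStep a k j).comap (fun x => (y, x)) (by fun_prop)) := by
  ext s hs
  rw [criticLaw, Kernel.comp_apply' _ _ _ hs, Kernel.lintegral_id_prod
    (Kernel.measurable_coe _ hs), Measure.bind_apply hs (Kernel.aemeasurable _)]
  rfl

theorem tdUpdate_mem {k : Fin K} {j : ℕ} (hB : 0 ≤ a.B) (w : Vec m) (z z' : S × A) :
    ‖M.tdUpdate a k j w z z'‖ ≤ a.B := by
  have := (metricProj_spec (C := Metric.closedBall (0 : Vec m) a.B) ⟨0, by simpa using hB⟩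
    Metric.isClosed_closedBall (w + (1 / (2 * a.lamA * (j + 1)) *
      (M.r k z + M.γ * inner ℝ (M.φ k z') w - inner ℝ (M.φ k z) w)) • M.φ k z)).1
  simpa [tdUpdate] using this

/-- The critic starts at an arbitrary point and is in the ball only after its first projection. For
this reason the Lyapunov recursion starts at `j = 1`. -/
theorem ae_criticLaw_norm_le (k : Fin K) (hB : 0 ≤ a.B) {j : ℕ} (hj : 1 ≤ j)
    (y : Vec p × Vec m) : ∀ᵐ x ∂(M.criticLaw a k j y), ‖x.1‖ ≤ a.B := by
  obtain ⟨j, rfl⟩ := Nat.exists_eq_add_of_le' hj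
  have hs : MeasurableSet {x : Vec m × (S × A) | ‖x.1‖ ≤ a.B} :=
    measurableSet_le (by fun_prop) measurable_const
  rw [criticLaw_succ_apply]
  refine Measure.ae_comp_of_ae_ae hs (Filter.Eventually.of_forall fun x => ?_)
  rw [Kernel.comap_apply, criticStep_apply, ae_map_iff _ hs]
  · exact Filter.Eventually.of_forall fun z' => M.tdUpdate_mem a hB _ _ _
  · exact (((M.measurable_tdUpdate a k j).comp measurable_prodMk_left).prodMk
      measurable_id).aemeasurable

theorem integral_criticLaw_succ (k : Fin K) (j : ℕ) (θ : Vec p) (w₀ : Vec m)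
    {F : Vec m × (S × A) → ℝ} (hF : Measurable F)
    (hi : Integrable F (M.criticLaw a k (j + 1) (θ, w₀))) :
    ∫ x, F x ∂(M.criticLaw a k (j + 1) (θ, w₀))
      = ∫ x, ∫ z', F (M.tdUpdate a k j x.1 x.2 z', z') ∂(M.chain k θ x.2)
        ∂(M.criticLaw a k j (θ, w₀)) := by
  rw [criticLaw_succ_apply] at hi ⊢
  rw [integral_bind_of_integrable hi]
  refine integral_congr_ae (Filter.Eventually.of_forall fun x => ?_)
  simp only
  have hm : Measurable fun z' => (M.tdUpdate a k j x.1 x.2 z', z') :=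
    ((M.measurable_tdUpdate a k j).comp (measurable_prodMk_left (x := x))).prodMk measurable_id
  rw [Kernel.comap_apply, criticStep_apply, integral_map hm.aemeasurable hF.aestronglyMeasurable]

/-! ### Drift of the critic's Lyapunov function -/

section Convergence

variable {M a}
variable {Cφ κ ρ : ℝ} (hC : 0 ≤ Cφ) (hφ : ∀ k z, ‖M.φ k z‖ ≤ Cφ) (hκ : 0 ≤ κ) (hρ0 : 0 ≤ ρ)
  (hρ1 : ρ < 1) (hE : M.UniformlyErgodic κ ρ) (hlam : 0 < a.lamA) (hsol : M.Solvable a.lamA)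
  (hB : 0 ≤ a.B) {k : Fin K} {θ : Vec p} (hw : ‖M.wStar k θ‖ ≤ a.B)

include hφ hw in
theorem abs_tdMean_le {w : Vec m} (hwB : ‖w‖ ≤ a.B) (z : S × A) :
    |M.tdMean k θ w z| ≤ tdBound Cφ a.B * (2 * a.B) := by
  refine (abs_integral_le_of_prob fun z' => abs_tdInner_le hφ k hwB (D := 2 * a.B) ?_ z z').trans_eq
    (by rw [tdBound]; ring)
  linarith [norm_sub_le w (M.wStar k θ)]

include hφ in
theorem integrable_tdInner {w v : Vec m} (z : S × A) :
    Integrable (fun z' => M.tdInner k v w z z') (M.chain k θ z) := by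
  have hm := M.φ_meas k
  refine integrable_of_norm_le (Measurable.stronglyMeasurable ?_)
    (abs_tdInner_le hφ k (le_refl ‖w‖) (le_refl ‖v‖) z)
  unfold tdInner
  fun_prop

include hφ hw in
theorem abs_tdMean_sub_le {w w' : Vec m} (hwB : ‖w‖ ≤ a.B) (hwB' : ‖w'‖ ≤ a.B) (z : S × A) :
    |M.tdMean k θ w z - M.tdMean k θ w' z| ≤ (1 + 6 * Cφ * a.B) * Cφ * ‖w - w'‖ := by
  rw [tdMean, tdMean, ← integral_sub (integrable_tdInner hφ z) (integrable_tdInner hφ z)]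
  exact abs_integral_le_of_prob fun z' => abs_tdInner_sub_le hφ k hw hwB hwB' z z'

include hφ hlam hsol in
theorem integral_tdMean_le (w : Vec m) :
    ∫ z, M.tdMean k θ w z ∂(M.visit k θ) ≤ -a.lamA * ‖w - M.wStar k θ‖ ^ 2 := by
  refine le_of_eq_of_le ?_ (hsol.integral_tdInner_le hφ hlam k θ w)
  have hm := M.φ_meas k
  have hr := M.r_meas k
  have hpr : IsProbabilityMeasure (M.pairLaw k θ) := by unfold pairLaw; infer_instance
  have hi : Integrable (fun x : (S × A) × (S × A) =>
      M.tdInner k (w - M.wStar k θ) w x.1 x.2) (M.pairLaw k θ) := by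
    refine integrable_of_norm_le (Measurable.stronglyMeasurable ?_)
      fun x => abs_tdInner_le hφ k (le_refl _) (le_refl _) x.1 x.2
    unfold tdInner
    fun_prop
  unfold pairLaw at hi ⊢
  rw [Measure.integral_compProd hi]
  rfl

include hφ hκ hρ0 hρ1 hE hlam hw in
theorem abs_criticLyapunov_sub_le {w : Vec m} (hwB : ‖w‖ ≤ a.B) (n j : ℕ) (z : S × A) :
    |M.criticLyapunov a.lamA k θ n j (w, z) - j * ‖w - M.wStar k θ‖ ^ 2|
      ≤ a.lamA⁻¹ * ((2 + 2 * κ / (1 - ρ)) * (tdBound Cφ a.B * (2 * a.B))) := by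
  rw [criticLyapunov, add_sub_cancel_left, abs_mul, abs_of_pos (inv_pos.2 hlam)]
  exact mul_le_mul_of_nonneg_left (hE.abs_poisson_le hκ hρ0 hρ1 k θ n
    (M.measurable_tdMean_right k θ w) (abs_tdMean_le hφ hw hwB) z) (inv_pos.2 hlam).le

include hφ hκ hρ0 hρ1 hE hlam hw in
theorem abs_criticLyapunov_le {w : Vec m} (hwB : ‖w‖ ≤ a.B) (n j : ℕ) (z : S × A) :
    |M.criticLyapunov a.lamA k θ n j (w, z)|
      ≤ j * (4 * a.B ^ 2)
        + a.lamA⁻¹ * ((2 + 2 * κ / (1 - ρ)) * (tdBound Cφ a.B * (2 * a.B))) := by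
  have h1 := abs_criticLyapunov_sub_le hφ hκ hρ0 hρ1 hE hlam hw hwB n j z
  have h2 : ‖w - M.wStar k θ‖ ≤ 2 * a.B := by linarith [norm_sub_le w (M.wStar k θ)]
  have h3 : ‖w - M.wStar k θ‖ ^ 2 ≤ 4 * a.B ^ 2 := by nlinarith [norm_nonneg (w - M.wStar k θ)]
  have h4 : (j : ℝ) * ‖w - M.wStar k θ‖ ^ 2 ≤ j * (4 * a.B ^ 2) :=
    mul_le_mul_of_nonneg_left h3 (Nat.cast_nonneg j)
  have h5 : 0 ≤ (j : ℝ) * ‖w - M.wStar k θ‖ ^ 2 := by positivity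
  rw [abs_le] at h1 ⊢
  constructor <;> linarith [h1.1, h1.2]

include hC hφ hκ hρ0 hρ1 hE hlam hB hw in
-- Pathwise drift: the projection only decreases the distance to `wStar`, and the Poisson term is
-- Lipschitz in `w`, which moves by at most the step size times `tdBound`.
theorem criticLyapunov_tdUpdate_le {w : Vec m} (hwB : ‖w‖ ≤ a.B) (n j : ℕ) (z z' : S × A) :
    M.criticLyapunov a.lamA k θ n (j + 1) (M.tdUpdate a k j w z z', z')
      ≤ (j + 1) * ‖w - M.wStar k θ‖ ^ 2 + driftConst Cφ κ ρ a.lamA a.B / (j + 1)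
        + a.lamA⁻¹ * (M.tdInner k (w - M.wStar k θ) w z z'
          + M.poisson k θ n (M.tdMean k θ w) z') := by
  have hj : (0 : ℝ) < (j : ℝ) + 1 := by positivity
  have hρ : 0 < 1 - ρ := sub_pos.2 hρ1
  have hwB' := M.tdUpdate_mem a hB w z z' (k := k) (j := j)
  obtain ⟨δ, hδ⟩ : ∃ δ, δ = M.r k z + M.γ * inner ℝ (M.φ k z') w - inner ℝ (M.φ k z) w :=
    ⟨_, rfl⟩
  obtain ⟨α, hα⟩ : ∃ α, α = 1 / (2 * a.lamA * ((j : ℝ) + 1)) := ⟨_, rfl⟩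
  have hα0 : 0 < α := by rw [hα]; positivity
  have hg : ‖δ • M.φ k z‖ ≤ tdBound Cφ a.B := by
    rw [norm_smul, hδ, tdBound]
    exact mul_le_mul (abs_td_error_le hφ k hwB z z') (hφ k z) (norm_nonneg _) (by positivity)
  have hproj : ∀ u : Vec m, ‖u‖ ≤ a.B →
      ‖M.tdUpdate a k j w z z' - u‖ ≤ ‖(w - u) + α • (δ • M.φ k z)‖ := fun u hu => by
    have := norm_metricProj_sub_le (C := Metric.closedBall (0 : Vec m) a.B)
      Metric.isClosed_closedBall (convex_closedBall _ _)
      (w + (α * δ) • M.φ k z) (u := u) (by simpa using hu)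
    rw [tdUpdate, ← hδ, ← hα, smul_smul]
    refine this.trans_eq (congrArg _ ?_)
    abel
  have h1 : ‖M.tdUpdate a k j w z z' - M.wStar k θ‖ ^ 2 ≤ ‖w - M.wStar k θ‖ ^ 2
      + 2 * α * M.tdInner k (w - M.wStar k θ) w z z' + α ^ 2 * tdBound Cφ a.B ^ 2 := by
    have e : ‖(w - M.wStar k θ) + α • (δ • M.φ k z)‖ ^ 2 = ‖w - M.wStar k θ‖ ^ 2
        + 2 * α * M.tdInner k (w - M.wStar k θ) w z z' + α ^ 2 * ‖δ • M.φ k z‖ ^ 2 := by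
      rw [norm_add_sq_real, norm_smul α, Real.norm_of_nonneg hα0.le, inner_smul_right,
        inner_smul_right, real_inner_comm, tdInner, ← hδ]
      ring
    have h2 := pow_le_pow_left₀ (norm_nonneg _) (hproj _ hw) 2
    have h3 := pow_le_pow_left₀ (norm_nonneg _) hg 2
    rw [e] at h2
    linarith [mul_le_mul_of_nonneg_left h3 (sq_nonneg α)]
  have h2 : ‖M.tdUpdate a k j w z z' - w‖ ≤ α * tdBound Cφ a.B := by
    refine (hproj w hwB).trans ?_
    rw [sub_self, zero_add, norm_smul, Real.norm_of_nonneg hα0.le]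
    exact mul_le_mul_of_nonneg_left hg hα0.le
  have h3 : M.poisson k θ n (M.tdMean k θ (M.tdUpdate a k j w z z')) z'
      ≤ M.poisson k θ n (M.tdMean k θ w) z'
        + (2 + 2 * κ / (1 - ρ)) * ((1 + 6 * Cφ * a.B) * Cφ * (α * tdBound Cφ a.B)) := by
    have hm := M.measurable_tdMean_right k θ (M.tdUpdate a k j w z z')
    have hm' := M.measurable_tdMean_right k θ w
    have h4 := hE.abs_poisson_le hκ hρ0 hρ1 k θ n (hm.sub hm')
      (D := (1 + 6 * Cφ * a.B) * Cφ * (α * tdBound Cφ a.B)) (fun z =>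
      (abs_tdMean_sub_le hφ hw hwB' hwB z).trans
        (mul_le_mul_of_nonneg_left h2 (by positivity))) z'
    have h5 := poisson_sub (M := M) k θ n hm hm' (abs_tdMean_le hφ hw hwB') (abs_tdMean_le hφ hw hwB) z'
    have h6 := (abs_le.1 h4).2
    change M.poisson k θ n (fun z => _ - _) z' ≤ _ at h6
    linarith
  rw [criticLyapunov]
  push_cast
  -- With `α = 1 / (2 lamA (j+1))` the factor `j + 1` turns `2α` into `1 / lamA` and `α²` into `1 /
  -- (4 lamA² (j+1))`. The shift of the Poisson term carries `α / lamA`, again of order `1 / (j+1)`.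
  have h4 := mul_le_mul_of_nonneg_left h1 hj.le
  have h5 := mul_le_mul_of_nonneg_left h3 (inv_pos.2 hlam).le
  refine (add_le_add h4 h5).trans_eq ?_
  rw [driftConst, hα]
  field_simp
  ring

include hC hφ hκ hρ0 hρ1 hE hlam hsol hB hw in
-- Averaging over the next pair turns `tdInner` into `tdMean`, and the Poisson equation replaces
-- `tdMean` by its stationary mean, at most `-lamA ‖w - wStar‖²`. Divided by `lamA`, this lowers the
-- factor `j + 1` to `j`.
theorem integral_criticLyapunov_tdUpdate_le {w : Vec m} (hwB : ‖w‖ ≤ a.B) (n j : ℕ) (z : S × A) :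
    ∫ z', M.criticLyapunov a.lamA k θ (n + 1) (j + 1) (M.tdUpdate a k j w z z', z')
        ∂(M.chain k θ z)
      ≤ M.criticLyapunov a.lamA k θ (n + 1) j (w, z) + driftConst Cφ κ ρ a.lamA a.B / (j + 1)
        + a.lamA⁻¹ * (2 * (tdBound Cφ a.B * (2 * a.B)) * (κ * ρ ^ n)) := by
  have hmean := M.measurable_tdMean_right k θ w
  have hib : Integrable (M.poisson k θ (n + 1) (M.tdMean k θ w)) (M.chain k θ z) :=
    integrable_of_norm_le (measurable_poisson k θ _ hmean).stronglyMeasurable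
      (hE.abs_poisson_le hκ hρ0 hρ1 k θ _ hmean (abs_tdMean_le hφ hw hwB))
  have hit := integrable_tdInner hφ z (k := k) (θ := θ) (w := w) (v := w - M.wStar k θ)
  have hil : Integrable (fun z' => M.criticLyapunov a.lamA k θ (n + 1) (j + 1)
      (M.tdUpdate a k j w z z', z')) (M.chain k θ z) :=
    integrable_of_norm_le (((M.measurable_criticLyapunov a.lamA k θ (n + 1) (j + 1)).comp
      (((M.measurable_tdUpdate a k j).comp (measurable_prodMk_left (x := (w, z)))).prodMk
        measurable_id)).stronglyMeasurable) fun z' =>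
      abs_criticLyapunov_le hφ hκ hρ0 hρ1 hE hlam hw (M.tdUpdate_mem a hB w z z') _ _ z'
  have hir := (hit.add hib).const_mul a.lamA⁻¹
  refine (integral_mono hil ((integrable_const ((j + 1) * ‖w - M.wStar k θ‖ ^ 2
    + driftConst Cφ κ ρ a.lamA a.B / (j + 1))).add hir) fun z' =>
    criticLyapunov_tdUpdate_le hC hφ hκ hρ0 hρ1 hE hlam hB hw hwB (n + 1) j z z').trans ?_
  rw [integral_add' (integrable_const _) hir, integral_const_mul, integral_add' hit hib,
    integral_chain_poisson k θ _ hmean (abs_tdMean_le hφ hw hwB)]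
  have h1 := (abs_le.1 (hE.abs_integral_chainIter_sub_le k θ n z hmean
    (abs_tdMean_le hφ hw hwB))).2
  have h2 := integral_tdMean_le hφ hlam hsol w (k := k) (θ := θ)
  have h3 : ∫ z', M.tdInner k (w - M.wStar k θ) w z z' ∂(M.chain k θ z) = M.tdMean k θ w z := rfl
  rw [h3, criticLyapunov]
  simp only [integral_const, probReal_univ, smul_eq_mul, one_mul]
  have hl : a.lamA⁻¹ * (a.lamA * ‖w - M.wStar k θ‖ ^ 2) = ‖w - M.wStar k θ‖ ^ 2 :=
    inv_mul_cancel_left₀ hlam.ne' _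
  have h4 := mul_le_mul_of_nonneg_left (add_le_add h1 h2) (inv_pos.2 hlam).le
  linarith

include hC hφ hκ hρ0 hρ1 hE hlam hsol hB hw in
/-- Mean-square error of projected TD(0) with Markovian samples. -/
theorem integral_critic_error_le (w₀ : Vec m) {N : ℕ} (hN : 1 ≤ N) :
    ∫ x, ‖x.1 - M.wStar k θ‖ ^ 2 ∂(M.criticLaw a k N (θ, w₀))
      ≤ criticConst Cφ κ ρ a.lamA a.B / √N := by
  have hρ : 0 < 1 - ρ := sub_pos.2 hρ1
  have hN0 : (0 : ℝ) < N := by exact_mod_cast hN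
  have hb0 : 0 ≤ tdBound Cφ a.B := by rw [tdBound]; positivity
  have hd0 : 0 ≤ driftConst Cφ κ ρ a.lamA a.B := by rw [driftConst]; positivity
  -- The truncation level is chosen with `ρ ^ n < 1 / N`, so that `N` truncation errors add up to no
  -- more than a constant.
  obtain ⟨n, hn⟩ := exists_pow_lt_of_lt_one (inv_pos.2 hN0) hρ1
  set U := a.lamA⁻¹ * ((2 + 2 * κ / (1 - ρ)) * (tdBound Cφ a.B * (2 * a.B))) with hU
  set η := a.lamA⁻¹ * (2 * (tdBound Cφ a.B * (2 * a.B)) * (κ * ρ ^ n)) with hη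
  have hU0 : 0 ≤ U := by positivity
  have hη0 : 0 ≤ η := by positivity
  have hint : ∀ (j j' : ℕ), 1 ≤ j → Integrable (M.criticLyapunov a.lamA k θ (n + 1) j')
      (M.criticLaw a k j (θ, w₀)) := fun j j' hj =>
    Integrable.of_bound (M.measurable_criticLyapunov _ _ _ _ _).aestronglyMeasurable
      (j' * (4 * a.B ^ 2) + U) <| by
      filter_upwards [M.ae_criticLaw_norm_le a k hB hj (θ, w₀)] with x hx
      exact abs_criticLyapunov_le hφ hκ hρ0 hρ1 hE hlam hw hx (n + 1) j' x.2
  have hrec : ∀ j : ℕ, 1 ≤ j →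
      ∫ x, M.criticLyapunov a.lamA k θ (n + 1) (j + 1) x ∂(M.criticLaw a k (j + 1) (θ, w₀))
        ≤ ∫ x, M.criticLyapunov a.lamA k θ (n + 1) j x ∂(M.criticLaw a k j (θ, w₀))
          + driftConst Cφ κ ρ a.lamA a.B / (j + 1) + η := fun j hj => by
    have hi := hint (j + 1) (j + 1) (by omega)
    rw [integral_criticLaw_succ M a k j θ w₀ (M.measurable_criticLyapunov _ _ _ _ _) hi]
    have hmeas : Measurable fun x : Vec m × (S × A) =>
        ∫ z', M.criticLyapunov a.lamA k θ (n + 1) (j + 1) (M.tdUpdate a k j x.1 x.2 z', z')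
          ∂(M.chain k θ x.2) :=
      (((M.measurable_criticLyapunov a.lamA k θ (n + 1) (j + 1)).comp
        ((M.measurable_tdUpdate a k j).prodMk
          measurable_snd)).stronglyMeasurable.integral_kernel_prod_right'
        (κ := (M.chain k θ).comap Prod.snd measurable_snd)).measurable
    have hiL : Integrable (fun x : Vec m × (S × A) =>
        ∫ z', M.criticLyapunov a.lamA k θ (n + 1) (j + 1) (M.tdUpdate a k j x.1 x.2 z', z')
          ∂(M.chain k θ x.2)) (M.criticLaw a k j (θ, w₀)) :=
      integrable_of_norm_le hmeas.stronglyMeasurable fun x =>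
        norm_integral_le_of_prob fun z' => abs_criticLyapunov_le hφ hκ hρ0 hρ1 hE hlam hw
          (M.tdUpdate_mem a hB x.1 x.2 z') (n + 1) (j + 1) z'
    refine (integral_mono_ae hiL (((hint j j hj).add (integrable_const
      (driftConst Cφ κ ρ a.lamA a.B / (j + 1)))).add (integrable_const η)) ?_).trans_eq ?_
    · filter_upwards [M.ae_criticLaw_norm_le a k hB hj (θ, w₀)] with x hx
      exact integral_criticLyapunov_tdUpdate_le hC hφ hκ hρ0 hρ1 hE hlam hsol hB hw hx n j x.2
    · rw [integral_add' ((hint j j hj).add (integrable_const _)) (integrable_const _),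
        integral_add' (hint j j hj) (integrable_const _)]
      simp
  have h1 := le_sqrt_of_recursion (a := fun j => ∫ x, M.criticLyapunov a.lamA k θ (n + 1) j x
    ∂(M.criticLaw a k j (θ, w₀))) hd0 hη0 hrec hN
  have h2 : ∫ x, M.criticLyapunov a.lamA k θ (n + 1) 1 x ∂(M.criticLaw a k 1 (θ, w₀))
      ≤ 4 * a.B ^ 2 + U := by
    refine (integral_mono_ae (hint 1 1 le_rfl) (integrable_const (4 * a.B ^ 2 + U)) ?_).trans_eq
      (by simp)
    filter_upwards [M.ae_criticLaw_norm_le a k hB le_rfl (θ, w₀)] with x hx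
    have := (abs_le.1 (abs_criticLyapunov_le hφ hκ hρ0 hρ1 hE hlam hw hx (n + 1) 1 x.2)).2
    rw [Nat.cast_one, one_mul] at this
    exact this
  have hsq : Integrable (fun x : Vec m × (S × A) => ‖x.1 - M.wStar k θ‖ ^ 2)
      (M.criticLaw a k N (θ, w₀)) :=
    Integrable.of_bound (Measurable.aestronglyMeasurable (by fun_prop)) ((2 * a.B) ^ 2) <| by
      filter_upwards [M.ae_criticLaw_norm_le a k hB hN (θ, w₀)] with x hx
      rw [norm_pow, norm_norm]
      exact pow_le_pow_left₀ (norm_nonneg _) (by linarith [norm_sub_le x.1 (M.wStar k θ)]) 2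
  have h3 : N * ∫ x, ‖x.1 - M.wStar k θ‖ ^ 2 ∂(M.criticLaw a k N (θ, w₀)) - U
      ≤ ∫ x, M.criticLyapunov a.lamA k θ (n + 1) N x ∂(M.criticLaw a k N (θ, w₀)) := by
    have : ∫ x, (N * ‖x.1 - M.wStar k θ‖ ^ 2 - U) ∂(M.criticLaw a k N (θ, w₀))
        = N * ∫ x, ‖x.1 - M.wStar k θ‖ ^ 2 ∂(M.criticLaw a k N (θ, w₀)) - U := by
      rw [integral_sub (hsq.const_mul _) (integrable_const _), integral_const_mul]
      simp
    rw [← this]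
    refine integral_mono_ae ((hsq.const_mul _).sub (integrable_const _)) (hint N N hN) ?_
    filter_upwards [M.ae_criticLaw_norm_le a k hB hN (θ, w₀)] with x hx
    have := (abs_le.1 (abs_criticLyapunov_sub_le hφ hκ hρ0 hρ1 hE hlam hw hx (n + 1) N x.2)).1
    change _ ≤ M.criticLyapunov a.lamA k θ (n + 1) N (x.1, x.2)
    linarith
  have h4 : N * η ≤ a.lamA⁻¹ * (2 * (tdBound Cφ a.B * (2 * a.B)) * κ) := by
    have h5 : N * ρ ^ n ≤ 1 := by
      have := mul_le_mul_of_nonneg_left hn.le hN0.le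
      rwa [mul_inv_cancel₀ hN0.ne'] at this
    calc N * η = a.lamA⁻¹ * (2 * (tdBound Cφ a.B * (2 * a.B)) * κ) * (N * ρ ^ n) := by
          rw [hη]; ring
      _ ≤ _ := mul_le_of_le_one_right (by positivity) h5
  have hs1 : 1 ≤ √(N : ℝ) := Real.one_le_sqrt.2 (by exact_mod_cast hN)
  have hs2 : √(N : ℝ) * √N = N := Real.mul_self_sqrt hN0.le
  rw [le_div_iff₀ (by linarith)]
  set I := ∫ x, ‖x.1 - M.wStar k θ‖ ^ 2 ∂(M.criticLaw a k N (θ, w₀))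
  -- The recursion bounds `N * I` by a constant plus a multiple of `√N`; as `√N ≥ 1`, the constant
  -- is absorbed into the multiple.
  have h6 : √(N : ℝ) * (I * √N) ≤ √N * criticConst Cφ κ ρ a.lamA a.B := by
    have e : √(N : ℝ) * (I * √N) = N * I := by linear_combination I * hs2
    rw [e, criticConst, ← hU]
    have h7 : 0 ≤ (√(N : ℝ) - 1) * (4 * a.B ^ 2 + 2 * U
        + a.lamA⁻¹ * (2 * (tdBound Cφ a.B * (2 * a.B)) * κ)) :=
      mul_nonneg (by linarith) (by positivity)
    linarith
  exact le_of_mul_le_mul_left h6 (by linarith)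

end Convergence

end MultiTaskMDP

/-! ### Averages of independent samples -/

section Averages

theorem integral_pi_eval {ι Z E : Type*} [Fintype ι] [MeasurableSpace Z] [NormedAddCommGroup E]
    [NormedSpace ℝ E] {μ : ι → Measure Z} [∀ i, IsProbabilityMeasure (μ i)] (i : ι) {f : Z → E}
    (hf : StronglyMeasurable f) : ∫ z, f (z i) ∂(Measure.pi μ) = ∫ y, f y ∂(μ i) := by
  rw [← (measurePreserving_eval μ i).map_eq,
    integral_map (measurable_pi_apply i).aemeasurable hf.aestronglyMeasurable]

variable {Z : Type*} [MeasurableSpace Z] {p : ℕ} {μ : Measure Z} {X : Z → Vec p}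

theorem integral_coord (hX : Integrable X μ) (c : Fin p) : (∫ z, X z ∂μ) c = ∫ z, X z c ∂μ :=
  ((EuclideanSpace.proj (𝕜 := ℝ) c).integral_comp_comm hX).symm

theorem measurable_average (hX : Measurable X) (N : ℕ) :
    Measurable fun z : Fin N → Z => (N : ℝ)⁻¹ • ∑ i, X (z i) := by
  fun_prop

variable [IsProbabilityMeasure μ] (hX : Measurable X) {V : ℝ} (hV : ∀ z, ‖X z‖ ≤ V)

include hX hV

theorem integral_average {N : ℕ} (hN : 1 ≤ N) :
    ∫ z, (N : ℝ)⁻¹ • ∑ i, X (z i) ∂(Measure.pi fun _ : Fin N => μ) = ∫ z, X z ∂μ := by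
  have hi : ∀ i : Fin N, Integrable (fun z : Fin N → Z => X (z i))
      (Measure.pi fun _ : Fin N => μ) := fun i =>
    integrable_of_norm_le (hX.comp (measurable_pi_apply i)).stronglyMeasurable fun z => hV _
  have hN0 : (N : ℝ) ≠ 0 := by exact_mod_cast (by omega : N ≠ 0)
  rw [integral_smul, integral_finsetSum _ fun i _ => hi i]
  simp_rw [integral_pi_eval (μ := fun _ : Fin N => μ) _ hX.stronglyMeasurable]
  rw [Finset.sum_const, Finset.card_univ, Fintype.card_fin, ← Nat.cast_smul_eq_nsmul ℝ,
    inv_smul_smul₀ hN0]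

/-- Variances of independent samples add, coordinate by coordinate. Bounding them by second moments
before summing over the coordinates gives `V²` without a factor of the dimension. -/
theorem integral_norm_average_sub_sq_le {N : ℕ} (hN : 1 ≤ N) :
    ∫ z, ‖(N : ℝ)⁻¹ • ∑ i, X (z i) - ∫ y, X y ∂μ‖ ^ 2 ∂(Measure.pi fun _ : Fin N => μ)
      ≤ V ^ 2 / N := by
  have hN0 : (N : ℝ) ≠ 0 := by exact_mod_cast (by omega : N ≠ 0)
  have hXi : Integrable X μ := integrable_of_norm_le hX.stronglyMeasurable hV
  have hXc : ∀ c, Measurable fun z => X z c := fun c => by fun_prop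
  have hVc : ∀ c z, ‖X z c‖ ≤ V := fun c z => (PiLp.norm_apply_le (X z) c).trans (hV z)
  have hLp : ∀ c, MemLp (fun z => X z c) 2 μ := fun c =>
    MemLp.of_bound (hXc c).aestronglyMeasurable V (Filter.Eventually.of_forall (hVc c))
  have hS : ∀ c, Measurable fun z : Fin N → Z => (N : ℝ)⁻¹ * ∑ i, X (z i) c := fun c => by
    refine (Finset.measurable_sum _ fun i _ => ?_).const_mul _
    exact (hXc c).comp (measurable_pi_apply i)
  have hV0 : 0 ≤ V := by
    have := nonempty_of_isProbabilityMeasure μ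
    exact (norm_nonneg _).trans (hV this.some)
  have hSb : ∀ c (z : Fin N → Z), ‖(N : ℝ)⁻¹ * ∑ i : Fin N, X (z i) c‖ ≤ V := fun c z => by
    rw [norm_mul, norm_inv, Real.norm_natCast, inv_mul_le_iff₀ (by positivity)]
    refine (norm_sum_le _ _).trans ((Finset.sum_le_sum fun i _ => hVc c (z i)).trans_eq ?_)
    simp
  have hmean : ∀ c, ∫ z, (N : ℝ)⁻¹ * ∑ i : Fin N, X (z i) c ∂(Measure.pi fun _ : Fin N => μ)
      = ∫ y, X y c ∂μ := fun c => by
    have h := congrArg (fun v : Vec p => v c) (integral_average hX hV (μ := μ) hN)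
    simp only at h
    rw [integral_coord hXi, integral_coord] at h
    · rw [← h]
      refine integral_congr_ae (Filter.Eventually.of_forall fun z => ?_)
      simp
    · refine integrable_of_norm_le (C := V) (measurable_average hX N).stronglyMeasurable
        fun z => ?_
      · rw [norm_smul, norm_inv, Real.norm_natCast, inv_mul_le_iff₀ (by positivity)]
        refine (norm_sum_le _ _).trans ((Finset.sum_le_sum fun i _ => hV (z i)).trans_eq ?_)
        simp
  have hvar : ∀ c, ∫ z, ((N : ℝ)⁻¹ * ∑ i : Fin N, X (z i) c - ∫ y, X y c ∂μ) ^ 2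
      ∂(Measure.pi fun _ : Fin N => μ) ≤ (N : ℝ)⁻¹ * ∫ y, X y c ^ 2 ∂μ := fun c => by
    have h1 := variance_sum_pi (μ := fun _ : Fin N => μ) (X := fun _ z => X z c) fun _ => hLp c
    have h2 : Var[fun z : Fin N → Z => (N : ℝ)⁻¹ * ∑ i, X (z i) c; Measure.pi fun _ => μ]
        = (N : ℝ)⁻¹ * Var[fun z => X z c; μ] := by
      have e : (fun z : Fin N → Z => ∑ i, X (z i) c) = ∑ i, fun ω : Fin N → Z => X (ω i) c := by
        ext z; simp
      rw [variance_const_mul, e, h1, Finset.sum_const, Finset.card_univ, Fintype.card_fin,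
        nsmul_eq_mul]
      field_simp
    rw [variance_eq_integral (hS c).aemeasurable, hmean] at h2
    rw [h2]
    refine mul_le_mul_of_nonneg_left ?_ (by positivity)
    exact variance_le_expectation_sq (hXc c).aestronglyMeasurable
  have hsq : ∀ c, Integrable (fun z => X z c ^ 2) μ := fun c =>
    integrable_of_norm_le (C := V ^ 2) ((hXc c).pow_const 2).stronglyMeasurable fun z => by
      rw [norm_pow]; exact pow_le_pow_left₀ (norm_nonneg _) (hVc c z) 2
  have hexp : ∀ z : Fin N → Z, ‖(N : ℝ)⁻¹ • ∑ i, X (z i) - ∫ y, X y ∂μ‖ ^ 2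
      = ∑ c, ((N : ℝ)⁻¹ * ∑ i : Fin N, X (z i) c - ∫ y, X y c ∂μ) ^ 2 := fun z => by
    rw [EuclideanSpace.real_norm_sq_eq]
    refine Finset.sum_congr rfl fun c _ => ?_
    rw [PiLp.sub_apply, integral_coord hXi]
    simp
  simp_rw [hexp]
  rw [integral_finsetSum _ fun c _ => ?_]
  · refine (Finset.sum_le_sum fun c _ => hvar c).trans ?_
    rw [← Finset.mul_sum, ← integral_finsetSum _ fun c _ => hsq c, div_eq_inv_mul]
    refine mul_le_mul_of_nonneg_left ?_ (by positivity)
    simp_rw [← EuclideanSpace.real_norm_sq_eq]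
    refine (le_abs_self _).trans (abs_integral_le_of_prob fun z => ?_)
    rw [abs_pow, abs_norm]
    exact pow_le_pow_left₀ (norm_nonneg _) (hV z) 2
  · refine integrable_of_norm_le (C := (V + V) ^ 2)
      (((hS c).sub_const _).pow_const 2).stronglyMeasurable fun z => ?_
    rw [norm_pow]
    refine pow_le_pow_left₀ (norm_nonneg _) ((norm_sub_le _ _).trans (add_le_add (hSb c z) ?_)) 2
    exact norm_integral_le_of_prob (hVc c)

end Averages

/-! ### Convex combinations -/

section Simplex

variable {K p : ℕ} {l : Vec K}

theorem norm_sum_smul_le_of_mem_simplex (hl : l ∈ simplex K) {x : Fin K → Vec p} {V : ℝ}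
    (hx : ∀ k, ‖x k‖ ≤ V) : ‖∑ k, l k • x k‖ ≤ V := by
  refine (norm_sum_le _ _).trans ?_
  calc ∑ k, ‖l k • x k‖ ≤ ∑ k, l k * V := Finset.sum_le_sum fun k _ => by
        rw [norm_smul, Real.norm_of_nonneg (hl.1 k)]
        exact mul_le_mul_of_nonneg_left (hx k) (hl.1 k)
    _ = V := by rw [← Finset.sum_mul, hl.2, one_mul]

theorem norm_sum_smul_sq_le_of_mem_simplex (hl : l ∈ simplex K) (x : Fin K → Vec p) :
    ‖∑ k, l k • x k‖ ^ 2 ≤ ∑ k, l k * ‖x k‖ ^ 2 := by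
  have hc : ConvexOn ℝ Set.univ fun v : Vec p => ‖v‖ ^ 2 :=
    (convexOn_norm convex_univ).pow (fun _ _ => norm_nonneg _) 2
  exact hc.map_sum_le (fun k _ => hl.1 k) hl.2 fun _ _ => Set.mem_univ _

theorem isClosed_simplex : IsClosed (simplex K) := by
  have h : simplex K = (⋂ k, {l : Vec K | 0 ≤ l k}) ∩ {l : Vec K | ∑ k, l k = 1} := by
    ext l; simp [simplex]
  rw [h]
  exact (isClosed_iInter fun k => isClosed_le continuous_const (by fun_prop)).inter
    (isClosed_eq (by fun_prop) continuous_const)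

theorem convex_simplex : Convex ℝ (simplex K) := by
  intro x hx y hy s t hs ht hst
  refine ⟨fun k => ?_, ?_⟩
  · have := hx.1 k
    have := hy.1 k
    simp only [PiLp.add_apply, PiLp.smul_apply, smul_eq_mul]
    positivity
  · simp only [PiLp.add_apply, PiLp.smul_apply, smul_eq_mul, Finset.sum_add_distrib,
      ← Finset.mul_sum, hx.2, hy.2, mul_one, hst]

theorem norm_le_one_of_mem_simplex (hl : l ∈ simplex K) : ‖l‖ ≤ 1 := by
  have h1 : ‖l‖ ^ 2 ≤ 1 := by
    rw [EuclideanSpace.real_norm_sq_eq, ← hl.2]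
    refine Finset.sum_le_sum fun k _ => ?_
    have : l k ≤ 1 := hl.2 ▸ Finset.single_le_sum (fun i _ => hl.1 i) (Finset.mem_univ k)
    nlinarith [hl.1 k]
  nlinarith [norm_nonneg l]

end Simplex

namespace MultiTaskMDP

variable {S A : Type*} [MeasurableSpace S] [MeasurableSpace A] {K p m : ℕ}
  (M : MultiTaskMDP S A K p m)

/-! ### Statistics of the gradient estimates -/

/-- The gradient estimate of task `k` from one sample. -/
def sampleGrad (θ : Vec p) (w : Fin K → Vec m) (k : Fin K) (z : S × A) : Vec p :=
  inner ℝ (M.φ k z) (w k) • M.ψ θ z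

/-- The mean of the gradient estimate of task `k`. -/
def meanGrad (θ : Vec p) (w : Fin K → Vec m) (k : Fin K) : Vec p :=
  ∫ z, M.sampleGrad θ w k z ∂(M.visit k θ)

variable {M} {Cφ Cπ Lφ : ℝ} (hS : M.Smooth Cφ Cπ Lφ)
include hS

theorem Smooth.norm_sampleGrad_le {θ : Vec p} {w : Fin K → Vec m} {B : ℝ} {k : Fin K}
    (hw : ‖w k‖ ≤ B) (z : S × A) : ‖M.sampleGrad θ w k z‖ ≤ Cφ ^ 2 * B := by
  have hC : 0 ≤ Cφ := (norm_nonneg _).trans (hS.score_le θ z)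
  rw [sampleGrad, norm_smul]
  refine (mul_le_mul ((abs_inner_φ_le hS.feature_le k z (w k)).trans
    (mul_le_mul_of_nonneg_left hw hC)) (hS.score_le θ z) (norm_nonneg _) ?_).trans_eq (by ring)
  exact mul_nonneg hC ((norm_nonneg _).trans hw)

theorem Smooth.measurable_sampleGrad (k : Fin K) :
    Measurable fun x : (Vec p × (Fin K → Vec m)) × (S × A) =>
      M.sampleGrad x.1.1 x.1.2 k x.2 := by
  have hm := M.φ_meas k
  have hψ : Measurable fun x : (Vec p × (Fin K → Vec m)) × (S × A) => M.ψ x.1.1 x.2 :=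
    hS.measurable_ψ.comp (f := fun x : (Vec p × (Fin K → Vec m)) × (S × A) => (x.1.1, x.2))
      (by fun_prop)
  have hi : Measurable fun x : (Vec p × (Fin K → Vec m)) × (S × A) =>
      (inner ℝ (M.φ k x.2) (x.1.2 k) : ℝ) := by fun_prop
  exact hi.smul hψ

theorem Smooth.measurable_sampleGrad_right (k : Fin K) (θ : Vec p) (w : Fin K → Vec m) :
    Measurable (M.sampleGrad θ w k) := by
  have hm := M.φ_meas k
  have hi : Measurable fun z => (inner ℝ (M.φ k z) (w k) : ℝ) := by fun_prop
  exact hi.smul (hS.measurable_ψ_right θ)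

theorem Smooth.measurable_gradEst {N : ℕ} (k : Fin K) :
    Measurable fun x : (Vec p × (Fin K → Vec m)) × (Fin K → Fin N → S × A) =>
      M.gradEst x.1.1 x.1.2 x.2 k := by
  have h : ∀ i : Fin N, Measurable fun x : (Vec p × (Fin K → Vec m)) × (Fin K → Fin N → S × A) =>
      M.sampleGrad x.1.1 x.1.2 k (x.2 k i) := fun i =>
    (hS.measurable_sampleGrad k).comp
      (f := fun x : (Vec p × (Fin K → Vec m)) × (Fin K → Fin N → S × A) => (x.1, x.2 k i))
      (by fun_prop)
  unfold gradEst
  exact (Finset.measurable_sum Finset.univ fun i _ => h i).const_smul (N : ℝ)⁻¹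

theorem Smooth.norm_gradEst_le {N : ℕ} {θ : Vec p} {w : Fin K → Vec m} {B : ℝ} {k : Fin K}
    (hw : ‖w k‖ ≤ B) (z : Fin K → Fin N → S × A) :
    ‖M.gradEst θ w z k‖ ≤ Cφ ^ 2 * B := by
  rcases Nat.eq_zero_or_pos N with rfl | hN
  · simp only [gradEst, Finset.univ_eq_empty, Finset.sum_empty, smul_zero, norm_zero]
    exact mul_nonneg (sq_nonneg _) ((norm_nonneg _).trans hw)
  · rw [gradEst, norm_smul, norm_inv, Real.norm_natCast, inv_mul_le_iff₀ (by positivity)]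
    refine (norm_sum_le _ _).trans
      ((Finset.sum_le_sum fun i _ => hS.norm_sampleGrad_le hw (z k i)).trans_eq ?_)
    simp

omit hS in
theorem batch_apply (N : ℕ) (x : State K p m) :
    M.batch N x = Measure.pi fun k => Measure.pi fun _ : Fin N => M.visit k x.1 := rfl

omit hS in
theorem integral_batch {E : Type*} [NormedAddCommGroup E] [NormedSpace ℝ E] (N : ℕ)
    (x : State K p m) (k : Fin K) {f : (Fin N → S × A) → E} (hf : StronglyMeasurable f) :
    ∫ z, f (z k) ∂(M.batch N x) = ∫ y, f y ∂(Measure.pi fun _ : Fin N => M.visit k x.1) := by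
  rw [batch_apply]
  exact integral_pi_eval (μ := fun k => Measure.pi fun _ : Fin N => M.visit k x.1) k hf

theorem Smooth.integral_gradEst {N : ℕ} (hN : 1 ≤ N) {x : State K p m} {w : Fin K → Vec m} {B : ℝ}
    (k : Fin K) (hw : ‖w k‖ ≤ B) :
    ∫ z, M.gradEst x.1 w z k ∂(M.batch N x) = M.meanGrad x.1 w k := by
  have hm : Measurable (M.sampleGrad x.1 w k) :=
    hS.measurable_sampleGrad_right k x.1 w
  have hm' : Measurable fun y : Fin N → S × A =>
      (N : ℝ)⁻¹ • ∑ i, M.sampleGrad x.1 w k (y i) := measurable_average hm N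
  have h1 := integral_batch (M := M) N x k hm'.stronglyMeasurable
  have h2 := integral_average (μ := M.visit k x.1) hm (hS.norm_sampleGrad_le hw) hN
  rw [h2] at h1
  exact h1

theorem Smooth.integral_norm_gradEst_sub_sq_le {N : ℕ} (hN : 1 ≤ N) {x : State K p m}
    {w : Fin K → Vec m} {B : ℝ} (k : Fin K) (hw : ‖w k‖ ≤ B) :
    ∫ z, ‖M.gradEst x.1 w z k - M.meanGrad x.1 w k‖ ^ 2 ∂(M.batch N x)
      ≤ (Cφ ^ 2 * B) ^ 2 / N := by
  have hm : Measurable (M.sampleGrad x.1 w k) :=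
    hS.measurable_sampleGrad_right k x.1 w
  have hm' : Measurable fun y : Fin N → S × A =>
      ‖(N : ℝ)⁻¹ • ∑ i, M.sampleGrad x.1 w k (y i) - M.meanGrad x.1 w k‖ ^ 2 :=
    ((measurable_average hm N).sub_const _).norm.pow_const 2
  have h1 := integral_batch (M := M) N x k hm'.stronglyMeasurable
  have h2 := integral_norm_average_sub_sq_le (μ := M.visit k x.1) hm
    (hS.norm_sampleGrad_le hw) hN
  exact h1.trans_le h2

end MultiTaskMDP

/-! ### Inner products of convex combinations of estimates -/

section Estimates

variable {Ω : Type*} [MeasurableSpace Ω] {μ : Measure Ω} [IsProbabilityMeasure μ] {K p : ℕ}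

/-- The covariance decomposition is needed because the weight update may use one batch in both
factors, which are then not independent. -/
theorem integral_inner_eq_add {u v : Ω → Vec p} (hu : Measurable u) (hv : Measurable v) {V : ℝ}
    (hu' : ∀ x, ‖u x‖ ≤ V) (hv' : ∀ x, ‖v x‖ ≤ V) :
    ∫ x, (inner ℝ (u x) (v x) : ℝ) ∂μ = inner ℝ (∫ x, u x ∂μ) (∫ x, v x ∂μ)
      + ∫ x, (inner ℝ (u x - ∫ x, u x ∂μ) (v x - ∫ x, v x ∂μ) : ℝ) ∂μ := by
  have hiu : Integrable u μ := integrable_of_norm_le hu.stronglyMeasurable hu'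
  have hiv : Integrable v μ := integrable_of_norm_le hv.stronglyMeasurable hv'
  have hiuv : Integrable (fun x => (inner ℝ (u x) (v x) : ℝ)) μ :=
    integrable_of_norm_le (hu.inner hv).stronglyMeasurable (C := V * V) fun x =>
      (norm_inner_le_norm _ _).trans (mul_le_mul (hu' x) (hv' x) (norm_nonneg _)
        ((norm_nonneg _).trans (hu' x)))
  set a := ∫ x, u x ∂μ with ha
  set b := ∫ x, v x ∂μ with hb
  have h1 : ∀ x, (inner ℝ (u x - a) (v x - b) : ℝ)
      = inner ℝ (u x) (v x) - inner ℝ b (u x) - inner ℝ a (v x) + inner ℝ a b := fun x => by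
    rw [inner_sub_left, inner_sub_right, inner_sub_right, real_inner_comm b (u x)]
    ring
  have hi1 : Integrable (fun x => (inner ℝ b (u x) : ℝ)) μ := hiu.const_inner b
  have hi2 : Integrable (fun x => (inner ℝ a (v x) : ℝ)) μ := hiv.const_inner a
  have hi3 : Integrable (fun x => (inner ℝ (u x) (v x) : ℝ) - inner ℝ b (u x)) μ := hiuv.sub hi1
  have hi4 : Integrable (fun x => (inner ℝ (u x) (v x) : ℝ) - inner ℝ b (u x)
    - inner ℝ a (v x)) μ := hi3.sub hi2
  simp_rw [h1]
  rw [integral_add hi4 (integrable_const _), integral_sub hi3 hi2, integral_sub hiuv hi1,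
    integral_inner hiu, integral_inner hiv, ← ha, ← hb, real_inner_comm a b]
  simp

variable {X : Fin K → Ω → Vec p} (hX : ∀ k, Measurable (X k)) {V : ℝ} (hV : ∀ k x, ‖X k x‖ ≤ V)
  {g : Fin K → Vec p} (hg : ∀ k, ∫ x, X k x ∂μ = g k)

include hX in
theorem measurable_sum_smul (l : Vec K) : Measurable fun x => ∑ k, l k • X k x :=
  Finset.measurable_sum _ fun k _ => (hX k).const_smul (l k)

include hX hV hg in
theorem integral_sum_smul (l : Vec K) : ∫ x, ∑ k, l k • X k x ∂μ = ∑ k, l k • g k := by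
  have hi : ∀ k, Integrable (fun x => l k • X k x) μ := fun k =>
    (integrable_of_norm_le (hX k).stronglyMeasurable (hV k)).smul (l k)
  rw [integral_finsetSum _ fun k _ => hi k]
  exact Finset.sum_congr rfl fun k _ => by rw [integral_smul, hg]

variable {σ : ℝ} (hσ : ∀ k, ∫ x, ‖X k x - g k‖ ^ 2 ∂μ ≤ σ)

include hX hV hσ in
theorem integral_norm_sum_smul_sub_sq_le (hgV : ∀ k, ‖g k‖ ≤ V) {l : Vec K}
    (hl : l ∈ simplex K) :
    Integrable (fun x => ‖∑ k, l k • X k x - ∑ k, l k • g k‖ ^ 2) μ ∧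
      ∫ x, ‖∑ k, l k • X k x - ∑ k, l k • g k‖ ^ 2 ∂μ ≤ σ := by
  have hi : ∀ k, Integrable (fun x => ‖X k x - g k‖ ^ 2) μ := fun k =>
    integrable_of_norm_le (C := (V + V) ^ 2)
      (((hX k).sub_const _).norm.pow_const 2).stronglyMeasurable fun x => by
      rw [norm_pow, norm_norm]
      exact pow_le_pow_left₀ (norm_nonneg _)
        ((norm_sub_le _ _).trans (add_le_add (hV k x) (hgV k))) 2
  have h1 : ∀ x, ‖∑ k, l k • X k x - ∑ k, l k • g k‖ ^ 2 ≤ ∑ k, l k * ‖X k x - g k‖ ^ 2 :=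
    fun x => by
      rw [← Finset.sum_sub_distrib]
      simp_rw [← smul_sub]
      exact norm_sum_smul_sq_le_of_mem_simplex hl _
  have hi' : Integrable (fun x => ∑ k, l k * ‖X k x - g k‖ ^ 2) μ :=
    integrable_finsetSum _ fun k _ => (hi k).const_mul _
  have hi0 : Integrable (fun x => ‖∑ k, l k • X k x - ∑ k, l k • g k‖ ^ 2) μ :=
    hi'.mono' ((((measurable_sum_smul hX l).sub_const _).norm.pow_const 2).aestronglyMeasurable)
      (Filter.Eventually.of_forall fun x => by
        rw [norm_pow, norm_norm]; exact h1 x)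
  refine ⟨hi0, (integral_mono hi0 hi' h1).trans ?_⟩
  rw [integral_finsetSum _ fun k _ => (hi k).const_mul _]
  simp_rw [integral_const_mul]
  calc ∑ k, l k * ∫ x, ‖X k x - g k‖ ^ 2 ∂μ ≤ ∑ k, l k * σ :=
        Finset.sum_le_sum fun k _ => mul_le_mul_of_nonneg_left (hσ k) (hl.1 k)
    _ = σ := by rw [← Finset.sum_mul, hl.2, one_mul]

include hX hV hg hσ in
-- The error is a covariance, at most the mean of the two variances; each is at most `σ` by
-- convexity of the squared norm.
theorem abs_integral_inner_sum_smul_sub_le {l l' : Vec K} (hl : l ∈ simplex K)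
    (hl' : l' ∈ simplex K) :
    |∫ x, (inner ℝ (∑ k, l k • X k x) (∑ k, l' k • X k x) : ℝ) ∂μ
      - inner ℝ (∑ k, l k • g k) (∑ k, l' k • g k)| ≤ σ := by
  have hgV : ∀ k, ‖g k‖ ≤ V := fun k => hg k ▸ norm_integral_le_of_prob (hV k)
  have h := integral_inner_eq_add (μ := μ) (measurable_sum_smul hX l) (measurable_sum_smul hX l')
    (fun x => norm_sum_smul_le_of_mem_simplex hl fun k => hV k x)
    (fun x => norm_sum_smul_le_of_mem_simplex hl' fun k => hV k x)
  rw [integral_sum_smul hX hV hg, integral_sum_smul hX hV hg] at h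
  rw [h, add_sub_cancel_left]
  obtain ⟨h1, h2⟩ := integral_norm_sum_smul_sub_sq_le hX hV hσ hgV hl
  obtain ⟨h3, h4⟩ := integral_norm_sum_smul_sub_sq_le hX hV hσ hgV hl'
  have hi := (h1.add h3).const_mul (1 / 2)
  have h5 := norm_integral_le_of_norm_le (μ := μ) hi (f := fun x =>
    (inner ℝ (∑ k, l k • X k x - ∑ k, l k • g k) (∑ k, l' k • X k x - ∑ k, l' k • g k) : ℝ))
    (Filter.Eventually.of_forall fun x => by
      refine (norm_inner_le_norm _ _).trans ?_
      simp only [Pi.add_apply]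
      nlinarith [sq_nonneg (‖∑ k, l k • X k x - ∑ k, l k • g k‖
        - ‖∑ k, l' k • X k x - ∑ k, l' k • g k‖)])
  rw [integral_const_mul, integral_add' h1 h3] at h5
  rw [← Real.norm_eq_abs]
  linarith

include hX hV hg in
theorem integral_inner_sum_smul (u : Vec p) (l : Vec K) :
    ∫ x, (inner ℝ u (∑ k, l k • X k x) : ℝ) ∂μ = inner ℝ u (∑ k, l k • g k) := by
  have hi : Integrable (fun x => ∑ k, l k • X k x) μ := integrable_finsetSum _ fun k _ =>
    (integrable_of_norm_le (hX k).stronglyMeasurable (hV k)).smul (l k)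
  rw [integral_inner hi, integral_sum_smul hX hV hg]

end Estimates

/-! ### The two deterministic one-step inequalities -/

/-- One projected step of the weight update, compared with a fixed weight `l₁`. -/
theorem norm_weight_step_sub_sq_le {K p : ℕ} {l l₁ : Vec K} (hl₁ : l₁ ∈ simplex K) (c : ℝ)
    (u : Vec p) {y : Fin K → Vec p} {V : ℝ} (hy : ∀ k, ‖y k‖ ≤ V) :
    ‖metricProj (simplex K) (l - c • WithLp.toLp 2 fun k => inner ℝ u (y k)) - l₁‖ ^ 2
      ≤ ‖l - l₁‖ ^ 2
        - 2 * c * (inner ℝ u (∑ k, l k • y k) - inner ℝ u (∑ k, l₁ k • y k))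
        + c ^ 2 * (K * V ^ 2) * ‖u‖ ^ 2 := by
  set v : Vec K := WithLp.toLp 2 fun k => inner ℝ u (y k) with hv
  have h1 := pow_le_pow_left₀ (norm_nonneg _)
    (norm_metricProj_sub_le isClosed_simplex convex_simplex (l - c • v) hl₁) 2
  have h2 : ∀ l : Vec K, inner ℝ l v = inner ℝ u (∑ k, l k • y k) := fun l => by
    simp [hv, PiLp.inner_apply, inner_sum, inner_smul_right, mul_comm]
  have h3 : ‖v‖ ^ 2 ≤ K * V ^ 2 * ‖u‖ ^ 2 := by
    rw [EuclideanSpace.real_norm_sq_eq]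
    calc ∑ k, v k ^ 2 ≤ ∑ _k : Fin K, V ^ 2 * ‖u‖ ^ 2 := Finset.sum_le_sum fun k _ => by
          have h4 : |v k| ≤ ‖u‖ * V := (abs_real_inner_le_norm u (y k)).trans
            (mul_le_mul_of_nonneg_left (hy k) (norm_nonneg _))
          have h5 := pow_le_pow_left₀ (abs_nonneg _) h4 2
          rw [sq_abs] at h5
          linarith
      _ = _ := by simp; ring
  have h4 : ‖l - c • v - l₁‖ ^ 2 = ‖l - l₁‖ ^ 2
      - 2 * c * (inner ℝ u (∑ k, l k • y k) - inner ℝ u (∑ k, l₁ k • y k))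
      + c ^ 2 * ‖v‖ ^ 2 := by
    have e : l - c • v - l₁ = (l - l₁) - c • v := by abel
    rw [e, norm_sub_sq_real, inner_smul_right, inner_sub_left, h2, h2, norm_smul, mul_pow,
      Real.norm_eq_abs, sq_abs]
    ring
  rw [h4] at h1
  nlinarith [mul_le_mul_of_nonneg_left h3 (sq_nonneg c)]

theorem le_of_lipschitz_gradient {p : ℕ} {f : Vec p → ℝ} {f' : Vec p → Vec p}
    (hf : ∀ θ, HasGradientAt f (f' θ) θ) {L : ℝ}
    (hL : ∀ θ θ', ‖f' θ - f' θ'‖ ≤ L * ‖θ - θ'‖) (θ v : Vec p) :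
    f θ + inner ℝ (f' θ) v - L / 2 * ‖v‖ ^ 2 ≤ f (θ + v) := by
  -- The quadratic term offsets the largest possible decrease of `⟨f' (θ + t v), v⟩`, so `q` is
  -- monotone on `[0, 1]`; comparing `q 0` with `q 1` gives the descent inequality.
  set q : ℝ → ℝ := fun t => f (θ + t • v) - t * inner ℝ (f' θ) v + L / 2 * ‖v‖ ^ 2 * t ^ 2 with hq
  have hd : ∀ t, HasDerivAt q
      (inner ℝ (f' (θ + t • v)) v - inner ℝ (f' θ) v + L / 2 * ‖v‖ ^ 2 * (2 * t)) t := fun t => by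
    have h1 : HasDerivAt (fun t : ℝ => θ + t • v) v t := by
      simpa using ((hasDerivAt_id t).smul_const v).const_add θ
    have h2 := (hf (θ + t • v)).hasFDerivAt.comp_hasDerivAt t h1
    rw [InnerProductSpace.toDual_apply_apply] at h2
    have h3 := (h2.sub ((hasDerivAt_id t).mul_const (inner ℝ (f' θ) v))).add
      (((hasDerivAt_id t).pow 2).const_mul (L / 2 * ‖v‖ ^ 2))
    refine h3.congr_deriv ?_
    simp
  have hmono : MonotoneOn q (Set.Icc 0 1) := by
    refine monotoneOn_of_deriv_nonneg (convex_Icc 0 1)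
      (fun t _ => (hd t).continuousAt.continuousWithinAt)
      (fun t _ => (hd t).differentiableAt.differentiableWithinAt) fun t ht => ?_
    rw [interior_Icc] at ht
    rw [(hd t).deriv, ← inner_sub_left]
    have h1 := (abs_le.1 (abs_real_inner_le_norm (f' (θ + t • v) - f' θ) v)).1
    have h2 := hL (θ + t • v) θ
    rw [add_sub_cancel_left, norm_smul, Real.norm_of_nonneg ht.1.le] at h2
    nlinarith [mul_le_mul_of_nonneg_right h2 (norm_nonneg v)]
  have h := hmono (Set.left_mem_Icc.2 zero_le_one) (Set.right_mem_Icc.2 zero_le_one) zero_le_one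
  simp only [hq, zero_smul, add_zero, one_smul] at h
  linarith

section Estimates

theorem integral_neg_add_const_mul {Ω : Type*} [MeasurableSpace Ω] {μ : Measure Ω} {f g : Ω → ℝ}
    (hf : Integrable f μ) (hg : Integrable g μ) (c : ℝ) :
    ∫ x, (-f x + c * g x) ∂μ = -∫ x, f x ∂μ + c * ∫ x, g x ∂μ := by
  have hf' : Integrable (fun x => -f x) μ := hf.neg
  rw [integral_add hf' (hg.const_mul c), integral_neg, integral_const_mul]

theorem integral_neg_sub_add_const_mul {Ω : Type*} [MeasurableSpace Ω] {μ : Measure Ω}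
    {f f' g : Ω → ℝ} (hf : Integrable f μ) (hf' : Integrable f' μ) (hg : Integrable g μ) (c : ℝ) :
    ∫ x, (-(f x - f' x) + c * g x) ∂μ = -(∫ x, f x ∂μ - ∫ x, f' x ∂μ) + c * ∫ x, g x ∂μ := by
  have h : Integrable (fun x => f x - f' x) μ := hf.sub hf'
  rw [integral_neg_add_const_mul h hg, integral_sub hf hf']

variable {Ω : Type*} [MeasurableSpace Ω] {μ : Measure Ω} [IsProbabilityMeasure μ] {K p : ℕ}
  {X : Fin K → Ω → Vec p} (hX : ∀ k, Measurable (X k)) {V : ℝ} (hV : ∀ k x, ‖X k x‖ ≤ V)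
  {g : Fin K → Vec p} (hg : ∀ k, ∫ x, X k x ∂μ = g k)
  {σ : ℝ} (hσ : ∀ k, ∫ x, ‖X k x - g k‖ ^ 2 ∂μ ≤ σ) {l l₁ : Vec K} (hl : l ∈ simplex K)
  (hl₁ : l₁ ∈ simplex K)

include hX hV in
theorem integrable_inner_sum_smul {l l' : Vec K} (hl : l ∈ simplex K) (hl' : l' ∈ simplex K) :
    Integrable (fun x => (inner ℝ (∑ k, l k • X k x) (∑ k, l' k • X k x) : ℝ)) μ :=
  integrable_of_norm_le ((measurable_sum_smul hX l).inner
    (measurable_sum_smul hX l')).stronglyMeasurable (C := V * V) fun x =>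
    (norm_inner_le_norm _ _).trans (mul_le_mul
      (norm_sum_smul_le_of_mem_simplex hl fun k => hV k x)
      (norm_sum_smul_le_of_mem_simplex hl' fun k => hV k x) (norm_nonneg _)
      ((norm_nonneg _).trans (norm_sum_smul_le_of_mem_simplex hl fun k => hV k x)))

include hX hV in
theorem integrable_inner_const_sum_smul (u : Vec p) (l : Vec K) :
    Integrable (fun x => (inner ℝ u (∑ k, l k • X k x) : ℝ)) μ := by
  have hi : Integrable (fun x => ∑ k, l k • X k x) μ := integrable_finsetSum _ fun k _ =>
    (integrable_of_norm_le (hX k).stronglyMeasurable (hV k)).smul (l k)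
  exact hi.const_inner u

/-- Bound for the change in a weight step of the squared distance to `l₁`, divided by `2c`. -/
def weightGain (u y y₁ : Vec p) : ℝ := -(inner ℝ u y - inner ℝ u y₁) + 1 / 8 * ‖u‖ ^ 2

/-- Bound for the change of the negative objective in an actor step, divided by `β`. -/
def actorGain (u y : Vec p) : ℝ := -inner ℝ u y + 1 / 2 * ‖y‖ ^ 2

include hX hV hg hσ hl hl₁ in
-- The one-batch case: each of the two inner products costs a covariance `σ`, and the squared norm
-- costs `σ / 8`.
theorem integral_weightGain_le :
    ∫ x, weightGain (∑ k, l k • X k x) (∑ k, l k • X k x) (∑ k, l₁ k • X k x) ∂μ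
      ≤ weightGain (∑ k, l k • g k) (∑ k, l k • g k) (∑ k, l₁ k • g k) + 17 / 8 * σ := by
  have h1 := abs_le.1 (abs_integral_inner_sum_smul_sub_le hX hV hg hσ hl hl)
  have h2 := abs_le.1 (abs_integral_inner_sum_smul_sub_le hX hV hg hσ hl hl₁)
  have i1 := integrable_inner_sum_smul (μ := μ) hX hV hl hl
  have i2 := integrable_inner_sum_smul (μ := μ) hX hV hl hl₁
  simp only [weightGain, ← real_inner_self_eq_norm_sq]
  rw [integral_neg_sub_add_const_mul i1 i2 i1]
  linarith [h1.1, h1.2, h2.2]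

include hX hV hg hσ hl in
-- The two-batch case: integrating over the independent second batch replaces it exactly by its
-- mean, so only the squared norm costs `σ / 8`. The larger constant is kept for agreement with the
-- one-batch case.
theorem integral_integral_weightGain_le :
    ∫ x, ∫ y, weightGain (∑ k, l k • X k x) (∑ k, l k • X k y) (∑ k, l₁ k • X k y) ∂μ ∂μ
      ≤ weightGain (∑ k, l k • g k) (∑ k, l k • g k) (∑ k, l₁ k • g k) + 17 / 8 * σ := by
  have hσ0 : 0 ≤ σ := (abs_nonneg _).trans (abs_integral_inner_sum_smul_sub_le hX hV hg hσ hl hl)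
  have h1 := abs_le.1 (abs_integral_inner_sum_smul_sub_le hX hV hg hσ hl hl)
  have i0 := integrable_inner_sum_smul (μ := μ) hX hV hl hl
  have h3 : ∀ x, ∫ y, weightGain (∑ k, l k • X k x) (∑ k, l k • X k y) (∑ k, l₁ k • X k y) ∂μ
      = weightGain (∑ k, l k • X k x) (∑ k, l k • g k) (∑ k, l₁ k • g k) := fun x => by
    have i1 := integrable_inner_const_sum_smul (μ := μ) hX hV (∑ k, l k • X k x) l
    have i2 := integrable_inner_const_sum_smul (μ := μ) hX hV (∑ k, l k • X k x) l₁
    simp only [weightGain]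
    rw [integral_neg_sub_add_const_mul i1 i2 (integrable_const _),
      integral_inner_sum_smul hX hV hg, integral_inner_sum_smul hX hV hg]
    simp
  have i1 := integrable_inner_const_sum_smul (μ := μ) hX hV (∑ k, l k • g k) l
  have i2 := integrable_inner_const_sum_smul (μ := μ) hX hV (∑ k, l₁ k • g k) l
  simp_rw [h3]
  simp only [weightGain, ← real_inner_self_eq_norm_sq]
  simp_rw [real_inner_comm (∑ k, l k • g k) (∑ k, l k • X k _),
    real_inner_comm (∑ k, l₁ k • g k) (∑ k, l k • X k _)]
  rw [integral_neg_sub_add_const_mul i1 i2 i0, integral_inner_sum_smul hX hV hg, integral_inner_sum_smul hX hV hg,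
    real_inner_comm (∑ k, l k • g k) (∑ k, l₁ k • g k)]
  linarith [h1.2]

include hX hV hg hσ hl in
theorem integral_actorGain_le (u : Vec p) :
    ∫ x, actorGain u (∑ k, l k • X k x) ∂μ ≤ actorGain u (∑ k, l k • g k) + 1 / 2 * σ := by
  have h1 := abs_le.1 (abs_integral_inner_sum_smul_sub_le hX hV hg hσ hl hl)
  have i1 := integrable_inner_sum_smul (μ := μ) hX hV hl hl
  have i2 := integrable_inner_const_sum_smul (μ := μ) hX hV u l
  simp only [actorGain, ← real_inner_self_eq_norm_sq]
  rw [integral_neg_add_const_mul i2 i1, integral_inner_sum_smul hX hV hg]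
  linarith [h1.2]

/-- The left side is `-(3/8) ‖b‖² + ⟨b, b₁ - d₁⟩`: the unknown comparison direction enters only
through its bias. Young's inequality spends `‖b‖²/8` on that term, and `‖d‖² ≤ 2 ‖b‖² + 2 ‖b - d‖²`
converts the remaining `-‖b‖²/4`. -/
theorem weightGain_add_actorGain_le (b b₁ d d₁ : Vec p) :
    weightGain b b b₁ + actorGain d₁ b
      ≤ -(1 / 8) * ‖d‖ ^ 2 + 2 * ‖b₁ - d₁‖ ^ 2 + 1 / 4 * ‖b - d‖ ^ 2 := by
  have h1 : (inner ℝ b b : ℝ) = ‖b‖ ^ 2 := real_inner_self_eq_norm_sq b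
  have h2 : (inner ℝ b b₁ : ℝ) - inner ℝ d₁ b = inner ℝ b (b₁ - d₁) := by
    rw [inner_sub_right, real_inner_comm d₁ b]
  have h3 := real_inner_le_norm b (b₁ - d₁)
  have h4 : ‖d‖ ≤ ‖b‖ + ‖b - d‖ := by
    rw [norm_sub_rev]
    calc ‖d‖ = ‖b + (d - b)‖ := by congr 1; abel
      _ ≤ _ := norm_add_le _ _
  have h5 := pow_le_pow_left₀ (norm_nonneg d) h4 2
  rw [weightGain, actorGain, h1]
  nlinarith [sq_nonneg (‖b‖ - 4 * ‖b₁ - d₁‖), sq_nonneg (‖b‖ - ‖b - d‖)]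

end Estimates

theorem integral_prod_prod_add {Z₁ Z₂ Z₃ : Type*} [MeasurableSpace Z₁] [MeasurableSpace Z₂]
    [MeasurableSpace Z₃] {μ₁ : Measure Z₁} {μ₂ : Measure Z₂} {μ₃ : Measure Z₃}
    [IsProbabilityMeasure μ₁] [IsProbabilityMeasure μ₂] [IsProbabilityMeasure μ₃]
    {f : Z₁ × Z₂ → ℝ} (hf : Measurable f) {C : ℝ} (hC : ∀ x, |f x| ≤ C)
    {h : Z₃ → ℝ} (hh : Measurable h) {D : ℝ} (hD : ∀ x, |h x| ≤ D) :
    ∫ q, (f (q.1, q.2.1) + h q.2.2) ∂(μ₁.prod (μ₂.prod μ₃))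
      = ∫ x, ∫ y, f (x, y) ∂μ₂ ∂μ₁ + ∫ z, h z ∂μ₃ := by
  have i1 : Integrable (fun q : Z₁ × (Z₂ × Z₃) => f (q.1, q.2.1)) (μ₁.prod (μ₂.prod μ₃)) :=
    integrable_of_norm_le (hf.comp (f := fun q : Z₁ × (Z₂ × Z₃) => (q.1, q.2.1))
      (by fun_prop)).stronglyMeasurable fun q => hC _
  have i2 : Integrable (fun q : Z₁ × (Z₂ × Z₃) => h q.2.2) (μ₁.prod (μ₂.prod μ₃)) :=
    integrable_of_norm_le (hh.comp (f := fun q : Z₁ × (Z₂ × Z₃) => q.2.2)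
      (by fun_prop)).stronglyMeasurable fun q => hD _
  rw [integral_add i1 i2, integral_prod _ i1]
  congr 1
  · refine integral_congr_ae (Filter.Eventually.of_forall fun x => ?_)
    have := integral_fun_fst (μ := μ₂) (ν := μ₃) fun y => f (x, y)
    simpa using this
  · have h1 := integral_fun_snd (μ := μ₁) (ν := μ₂.prod μ₃) fun y => h y.2
    have h2 := integral_fun_snd (μ := μ₂) (ν := μ₃) h
    simp only [probReal_univ, one_smul] at h1 h2
    rw [h1, h2]

namespace MultiTaskMDP

variable {S A : Type*} [MeasurableSpace S] [MeasurableSpace A] {K p m : ℕ}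
  {M : MultiTaskMDP S A K p m}

/-! ### The bias of the gradient estimates -/

theorem εapp_nonneg : 0 ≤ M.εapp := Real.iSup_nonneg fun _ => Real.sqrt_nonneg _

variable {Cφ B : ℝ} (hφ : ∀ k z, ‖M.φ k z‖ ≤ Cφ) (hw : ∀ k θ, ‖M.wStar k θ‖ ≤ B)
include hφ hw

theorem abs_inner_wStar_sub_Q_le (k : Fin K) (θ : Vec p) (z : S × A) :
    |inner ℝ (M.φ k z) (M.wStar k θ) - M.Q k θ z| ≤ Cφ * B + (1 - M.γ)⁻¹ := by
  have hC : 0 ≤ Cφ := (norm_nonneg _).trans (hφ k z)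
  refine (abs_sub _ _).trans (add_le_add ?_ (M.abs_Q_le k θ z))
  exact (abs_inner_φ_le hφ k z _).trans (mul_le_mul_of_nonneg_left (hw k θ) hC)

theorem sqrt_integral_sq_le (k : Fin K) (θ : Vec p) :
    √(∫ z, (inner ℝ (M.φ k z) (M.wStar k θ) - M.Q k θ z) ^ 2 ∂(M.visit k θ))
      ≤ Cφ * B + (1 - M.γ)⁻¹ := by
  have hne := nonempty_of_isProbabilityMeasure (M.visit k θ)
  refine Real.sqrt_le_iff.2 ⟨(abs_nonneg _).trans
    (abs_inner_wStar_sub_Q_le hφ hw k θ hne.some), ?_⟩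
  refine (le_abs_self _).trans (abs_integral_le_of_prob fun z => ?_)
  rw [abs_pow]
  exact pow_le_pow_left₀ (abs_nonneg _) (abs_inner_wStar_sub_Q_le hφ hw k θ z) 2

theorem εapp_le (hC : 0 ≤ Cφ) (hB : 0 ≤ B) : M.εapp ≤ Cφ * B + (1 - M.γ)⁻¹ :=
  Real.iSup_le (fun x => sqrt_integral_sq_le hφ hw x.2 x.1)
    (add_nonneg (mul_nonneg hC hB) (inv_pos.2 M.one_sub_γ_pos).le)

theorem integral_abs_le_εapp (k : Fin K) (θ : Vec p) :
    ∫ z, |inner ℝ (M.φ k z) (M.wStar k θ) - M.Q k θ z| ∂(M.visit k θ) ≤ M.εapp := by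
  have hm := M.φ_meas k
  have hQ := M.measurable_Q k θ
  have hf : Measurable fun z =>
      |(inner ℝ (M.φ k z) (M.wStar k θ) : ℝ) - M.Q k θ z| := by fun_prop
  have hLp : MemLp (fun z => |(inner ℝ (M.φ k z) (M.wStar k θ) : ℝ) - M.Q k θ z|) 2
      (M.visit k θ) := MemLp.of_bound hf.aestronglyMeasurable (Cφ * B + (1 - M.γ)⁻¹)
    (Filter.Eventually.of_forall fun z => by
      rw [Real.norm_eq_abs, abs_abs]; exact abs_inner_wStar_sub_Q_le hφ hw k θ z)
  have h1 := variance_nonneg (fun z => |(inner ℝ (M.φ k z) (M.wStar k θ) : ℝ) - M.Q k θ z|)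
    (M.visit k θ)
  rw [variance_eq_sub hLp] at h1
  -- A real supremum dominates the family only if the family is bounded, which `sqrt_integral_sq_le`
  -- ensures.
  have h2 : √(∫ z, (inner ℝ (M.φ k z) (M.wStar k θ) - M.Q k θ z) ^ 2 ∂(M.visit k θ)) ≤ M.εapp :=
    le_ciSup (f := fun x : Vec p × Fin K => √(∫ z, (inner ℝ (M.φ x.2 z) (M.wStar x.2 x.1)
      - M.Q x.2 x.1 z) ^ 2 ∂(M.visit x.2 x.1)))
      ⟨Cφ * B + (1 - M.γ)⁻¹, by rintro _ ⟨x, rfl⟩; exact sqrt_integral_sq_le hφ hw x.2 x.1⟩ (θ, k)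
  refine le_trans (Real.le_sqrt_of_sq_le ?_) h2
  simp only [Pi.pow_apply, sq_abs] at h1
  linarith

omit hφ in
-- By the policy gradient theorem the bias is the integral of `(φᵀw - Q) ψ`, and `φᵀw - Q` splits
-- into the critic error `φᵀ(w - wStar)` and the approximation error `φᵀwStar - Q`.
theorem Smooth.norm_meanGrad_sub_sq_le {κ ρ Cπ Lφ : ℝ} (hρ0 : 0 ≤ ρ) (hρ1 : ρ < 1)
    (hE : M.UniformlyErgodic κ ρ) (hS : M.Smooth Cφ Cπ Lφ) (θ : Vec p) (w : Fin K → Vec m)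
    (k : Fin K) :
    ‖M.meanGrad θ w k - (1 - M.γ) • gradient (M.J k) θ‖ ^ 2
      ≤ 2 * Cφ ^ 4 * ‖w k - M.wStar k θ‖ ^ 2 + 2 * Cφ ^ 2 * M.εapp ^ 2 := by
  have hne := nonempty_of_isProbabilityMeasure (M.visit k θ)
  have hC : 0 ≤ Cφ := (norm_nonneg _).trans (hS.feature_le k hne.some)
  have hQ := M.measurable_Q k θ
  have hm := M.φ_meas k
  rw [← hE.integral_Q_smul_ψ hρ0 hρ1 hS, meanGrad, ← integral_sub]
  rotate_left
  · exact integrable_of_norm_le (hS.measurable_sampleGrad_right k θ w).stronglyMeasurable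
      (hS.norm_sampleGrad_le le_rfl)
  · refine integrable_of_norm_le (C := (1 - M.γ)⁻¹ * Cφ)
      (hQ.smul (hS.measurable_ψ_right θ)).stronglyMeasurable fun z => ?_
    rw [norm_smul]
    exact mul_le_mul (M.abs_Q_le k θ z) (hS.score_le θ z) (norm_nonneg _)
      (inv_pos.2 M.one_sub_γ_pos).le
  have hi : Integrable (fun z => |inner ℝ (M.φ k z) (M.wStar k θ) - M.Q k θ z|) (M.visit k θ) :=
    integrable_of_norm_le (Measurable.stronglyMeasurable (by fun_prop)) fun z => by
      rw [Real.norm_eq_abs, abs_abs]; exact abs_inner_wStar_sub_Q_le hS.feature_le hw k θ z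
  have h1 : ‖∫ z, (M.sampleGrad θ w k z - M.Q k θ z • M.ψ θ z) ∂(M.visit k θ)‖
      ≤ Cφ ^ 2 * ‖w k - M.wStar k θ‖ + Cφ * M.εapp := by
    refine (norm_integral_le_of_norm_le (((integrable_const (Cφ * ‖w k - M.wStar k θ‖)).add
      hi).const_mul Cφ) (Filter.Eventually.of_forall fun z => ?_)).trans ?_
    · rw [sampleGrad, ← sub_smul, norm_smul, mul_comm]
      refine mul_le_mul (hS.score_le θ z) ?_ (norm_nonneg _) hC
      have e : inner ℝ (M.φ k z) (w k) - M.Q k θ z = inner ℝ (M.φ k z) (w k - M.wStar k θ)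
          + (inner ℝ (M.φ k z) (M.wStar k θ) - M.Q k θ z) := by
        rw [inner_sub_right]; ring
      rw [e]
      exact (norm_add_le _ _).trans (add_le_add_left (abs_inner_φ_le hS.feature_le k z _) _)
    · rw [integral_const_mul, integral_add' (integrable_const _) hi]
      have := mul_le_mul_of_nonneg_left (integral_abs_le_εapp hS.feature_le hw k θ) hC
      simp only [integral_const, probReal_univ, smul_eq_mul, one_mul]
      linarith
  refine (pow_le_pow_left₀ (norm_nonneg _) h1 2).trans ?_
  nlinarith [sq_nonneg (Cφ ^ 2 * ‖w k - M.wStar k θ‖ - Cφ * M.εapp)]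

end MultiTaskMDP

namespace MultiTaskMDP

variable {S A : Type*} [MeasurableSpace S] [MeasurableSpace A] {K p m : ℕ}
  (M : MultiTaskMDP S A K p m) (a : Params)

/-! ### One iteration of the algorithm -/

/-- The standing assumptions of the analysis of MTAC-FC. -/
structure Analysis (Cφ Cπ Lφ κ ρ : ℝ) : Prop where
  Cφ_nonneg : 0 ≤ Cφ
  Lφ_nonneg : 0 ≤ Lφ
  κ_nonneg : 0 ≤ κ
  ρ_nonneg : 0 ≤ ρ
  ρ_lt_one : ρ < 1
  lamA_pos : 0 < a.lamA
  B_nonneg : 0 ≤ a.B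
  β_pos : 0 < a.β
  c_pos : 0 < a.c
  c_le : a.c * (K * (Cφ ^ 2 * a.B) ^ 2) ≤ 1 / 4
  smooth : M.Smooth Cφ Cπ Lφ
  ergodic : M.UniformlyErgodic κ ρ
  solvable : M.Solvable a.lamA
  wStar_le : ∀ k θ, ‖M.wStar k θ‖ ≤ a.B
  lip : a.β * M.lipJ ≤ 1
  one_le_Ncritic : 1 ≤ a.Ncritic
  one_le_NFC : 1 ≤ a.NFC
  one_le_Nactor : 1 ≤ a.Nactor

/-- The new critics and the three batches drawn in one iteration. -/
abbrev Draw (S A : Type*) (K m : ℕ) (a : Params) : Type _ :=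
  (Fin K → Vec m) × ((Fin K → Fin a.NFC → S × A) ×
    ((Fin K → Fin a.NFC → S × A) × (Fin K → Fin a.Nactor → S × A)))

/-- The state after one iteration with given draws. -/
def outcome (x : State K p m) (q : Draw S A K m a) : State K p m :=
  (M.actorUpdate a x.1 x.2.2 q.1 q.2.2.2, q.1, M.fcUpdate a x.1 x.2.2 q.1 q.2.1 q.2.2.1)

/-- The law of the draws of one iteration. -/
def drawLaw (x : State K p m) : Measure (Draw S A K m a) :=
  (M.criticPhase a x).prod ((M.batch a.NFC x).prod ((M.batch a.NFC x).prod (M.batch a.Nactor x)))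

instance : IsMarkovKernel (M.criticPhase a) := by
  unfold criticPhase; infer_instance

instance (N : ℕ) : IsMarkovKernel (M.batch N) := by
  unfold batch; infer_instance

instance (x : State K p m) : IsProbabilityMeasure (M.drawLaw a x) := by
  unfold drawLaw; infer_instance

/-- The Lyapunov function of MTAC-FC with respect to a fixed weight `l₁`. -/
def potential (l₁ : Vec K) (x : State K p m) : ℝ :=
  1 / (2 * a.c) * ‖x.2.2 - l₁‖ ^ 2 - (1 - M.γ) / a.β * ∑ k, l₁ k * M.J k x.1

variable {M a}

theorem Smooth.measurable_outcome {Cφ Cπ Lφ : ℝ} (hS : M.Smooth Cφ Cπ Lφ)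
    (hne : (simplex K).Nonempty) :
    Measurable fun y : State K p m × Draw S A K m a => M.outcome a y.1 y.2 := by
  have h1 : ∀ k, Measurable fun y : State K p m × Draw S A K m a =>
      M.gradEst y.1.1 y.2.1 y.2.2.2.2 k := fun k =>
    (hS.measurable_gradEst k).comp (f := fun y : State K p m × Draw S A K m a =>
      ((y.1.1, y.2.1), y.2.2.2.2)) (by fun_prop)
  have h2 : ∀ k, Measurable fun y : State K p m × Draw S A K m a =>
      M.gradEst y.1.1 y.2.1 y.2.2.1 k := fun k =>
    (hS.measurable_gradEst k).comp (f := fun y : State K p m × Draw S A K m a =>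
      ((y.1.1, y.2.1), y.2.2.1)) (by fun_prop)
  have h4 : ∀ k, Measurable fun y : State K p m × Draw S A K m a =>
      M.gradEst y.1.1 y.2.1 y.2.2.2.1 k := fun k =>
    (hS.measurable_gradEst k).comp (f := fun y : State K p m × Draw S A K m a =>
      ((y.1.1, y.2.1), y.2.2.2.1)) (by fun_prop)
  have h3 : ∀ k, Measurable fun y : State K p m × Draw S A K m a =>
      M.gradEst y.1.1 y.2.1 (if a.twoBatches then y.2.2.2.1 else y.2.2.1) k := fun k => by
    cases a.twoBatches
    · simpa using h2 k
    · simpa using h4 k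
  have hl : ∀ k, Measurable fun y : State K p m × Draw S A K m a => y.1.2.2 k := fun k => by
    fun_prop
  have hact : Measurable fun y : State K p m × Draw S A K m a =>
      M.actorUpdate a y.1.1 y.1.2.2 y.2.1 y.2.2.2.2 := by
    have h := Finset.measurable_sum Finset.univ fun k _ => (hl k).smul (h1 k)
    have h0 : Measurable fun y : State K p m × Draw S A K m a => y.1.1 := by fun_prop
    exact h0.add (h.const_smul a.β)
  have hfc : Measurable fun y : State K p m × Draw S A K m a =>
      M.fcUpdate a y.1.1 y.1.2.2 y.2.1 y.2.2.1 y.2.2.2.1 := by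
    have h := Finset.measurable_sum Finset.univ fun k _ => (hl k).smul (h2 k)
    have h0 : Measurable fun y : State K p m × Draw S A K m a => y.1.2.2 := by fun_prop
    have hi : ∀ k, Measurable fun y : State K p m × Draw S A K m a =>
        (inner ℝ (∑ i, y.1.2.2 i • M.gradEst y.1.1 y.2.1 y.2.2.1 i)
          (M.gradEst y.1.1 y.2.1 (if a.twoBatches then y.2.2.2.1 else y.2.2.1) k) : ℝ) :=
      fun k => h.inner (h3 k)
    have hv := (WithLp.measurable_toLp 2 _).comp (measurable_pi_lambda _ hi)
    exact (continuous_metricProj hne isClosed_simplex convex_simplex).measurable.comp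
      (h0.sub (hv.const_smul a.c))
  exact hact.prodMk (Measurable.prodMk (by fun_prop) hfc)

theorem Smooth.iteration_apply {Cφ Cπ Lφ : ℝ} (hS : M.Smooth Cφ Cπ Lφ)
    (hne : (simplex K).Nonempty) (x : State K p m) :
    M.iteration a x = (M.drawLaw a x).map (M.outcome a x) := by
  have hm := hS.measurable_outcome (a := a) hne
  have h1 : M.iteration a = (Kernel.id ×ₖ (M.criticPhase a ×ₖ (M.batch a.NFC ×ₖ
      (M.batch a.NFC ×ₖ M.batch a.Nactor)))).map fun y => M.outcome a y.1 y.2 := rfl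
  rw [h1, Kernel.map_apply _ hm, Kernel.prod_apply, Kernel.prod_apply, Kernel.prod_apply,
    Kernel.prod_apply, Kernel.id_apply, Measure.dirac_prod,
    Measure.map_map hm measurable_prodMk_left]
  rfl

theorem fcUpdate_mem_simplex (hne : (simplex K).Nonempty) (x : State K p m)
    (q : Draw S A K m a) : (M.outcome a x q).2.2 ∈ simplex K :=
  (metricProj_spec hne isClosed_simplex _).1

theorem criticPhase_apply (x : State K p m) :
    M.criticPhase a x
      = Measure.pi fun k => (M.criticLaw a k a.Ncritic (x.1, x.2.1 k)).map Prod.fst := by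
  change Measure.pi (fun k => (M.criticLaw a k a.Ncritic).fst (x.1, x.2.1 k)) = _
  simp_rw [Kernel.fst_apply]

theorem measurable_potential (hJ : ∀ k, Measurable (M.J k)) (l₁ : Vec K) :
    Measurable (M.potential a l₁) := by
  have h : Measurable fun x : State K p m => ∑ k, l₁ k * M.J k x.1 :=
    Finset.measurable_sum _ fun k _ => ((hJ k).comp measurable_fst).const_mul _
  unfold potential
  fun_prop

variable {Cφ Cπ Lφ κ ρ : ℝ} (h : M.Analysis a Cφ Cπ Lφ κ ρ)
include h

theorem Analysis.hasGradientAt_J (k : Fin K) (θ : Vec p) :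
    HasGradientAt (M.J k) (gradient (M.J k) θ) θ :=
  (h.ergodic.hasGradientAt_J h.ρ_nonneg h.ρ_lt_one h.smooth k θ).differentiableAt.hasGradientAt

theorem Analysis.measurable_J (k : Fin K) : Measurable (M.J k) :=
  (continuous_iff_continuousAt.2 fun θ => (h.hasGradientAt_J k θ).continuousAt).measurable

theorem Analysis.abs_potential_le {l₁ : Vec K} (hl₁ : l₁ ∈ simplex K) {x : State K p m}
    (hx : x.2.2 ∈ simplex K) : |M.potential a l₁ x| ≤ 2 / a.c + 1 / a.β := by
  have h1 : ‖x.2.2 - l₁‖ ^ 2 ≤ 4 := by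
    have := (norm_sub_le x.2.2 l₁).trans
      (add_le_add (norm_le_one_of_mem_simplex hx) (norm_le_one_of_mem_simplex hl₁))
    nlinarith [norm_nonneg (x.2.2 - l₁)]
  have h2 : 0 ≤ ∑ k, l₁ k * M.J k x.1 := Finset.sum_nonneg fun k _ =>
    mul_nonneg (hl₁.1 k) (h.ergodic.J_mem h.ρ_nonneg h.ρ_lt_one k x.1).1
  have h3 : ∑ k, l₁ k * M.J k x.1 ≤ (1 - M.γ)⁻¹ := by
    calc ∑ k, l₁ k * M.J k x.1 ≤ ∑ k, l₁ k * (1 - M.γ)⁻¹ := Finset.sum_le_sum fun k _ =>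
          mul_le_mul_of_nonneg_left (h.ergodic.J_mem h.ρ_nonneg h.ρ_lt_one k x.1).2 (hl₁.1 k)
      _ = (1 - M.γ)⁻¹ := by rw [← Finset.sum_mul, hl₁.2, one_mul]
  have hγ := M.one_sub_γ_pos
  have h4 : (1 - M.γ) / a.β * ∑ k, l₁ k * M.J k x.1 ≤ 1 / a.β := by
    have := mul_le_mul_of_nonneg_left h3 (div_pos hγ h.β_pos).le
    refine this.trans_eq ?_
    field_simp
  have h5 : 0 ≤ (1 - M.γ) / a.β * ∑ k, l₁ k * M.J k x.1 :=
    mul_nonneg (div_pos hγ h.β_pos).le h2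
  have h6 : 1 / (2 * a.c) * ‖x.2.2 - l₁‖ ^ 2 ≤ 2 / a.c := by
    have := mul_le_mul_of_nonneg_left h1 (one_div_pos.2 (mul_pos two_pos h.c_pos)).le
    refine this.trans_eq ?_
    have := h.c_pos.ne'
    field_simp
    norm_num
  have h7 : 0 ≤ 1 / (2 * a.c) * ‖x.2.2 - l₁‖ ^ 2 := by have := h.c_pos; positivity
  have h8 : 0 < 1 / a.β := one_div_pos.2 h.β_pos
  have h9 : 0 < 2 / a.c := div_pos two_pos h.c_pos
  rw [potential, abs_le]
  constructor <;> linarith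

/-- The weight step acts on the distance term and the actor step on the objective term; both start
from the same old `λ`, so the two changes simply add. -/
theorem Analysis.potential_outcome_le {l₁ : Vec K} (hl₁ : l₁ ∈ simplex K) (x : State K p m)
    (q : Draw S A K m a) (hq : ∀ k, ‖q.1 k‖ ≤ a.B) :
    M.potential a l₁ (M.outcome a x q) ≤ M.potential a l₁ x
      + (weightGain (∑ k, x.2.2 k • M.gradEst x.1 q.1 q.2.1 k)
          (∑ k, x.2.2 k • M.gradEst x.1 q.1 (if a.twoBatches then q.2.2.1 else q.2.1) k)
          (∑ k, l₁ k • M.gradEst x.1 q.1 (if a.twoBatches then q.2.2.1 else q.2.1) k)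
        + actorGain (∑ k, l₁ k • ((1 - M.γ) • gradient (M.J k) x.1))
          (∑ k, x.2.2 k • M.gradEst x.1 q.1 q.2.2.2 k)) := by
  obtain ⟨u, hu⟩ : ∃ u, u = ∑ k, x.2.2 k • M.gradEst x.1 q.1 q.2.1 k := ⟨_, rfl⟩
  obtain ⟨v, hv⟩ : ∃ v, v = ∑ k, x.2.2 k • M.gradEst x.1 q.1 q.2.2.2 k := ⟨_, rfl⟩
  obtain ⟨y, hy⟩ : ∃ y, y = M.gradEst x.1 q.1 (if a.twoBatches then q.2.2.1 else q.2.1) :=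
    ⟨_, rfl⟩
  have hyV : ∀ k, ‖y k‖ ≤ Cφ ^ 2 * a.B := fun k => hy ▸ h.smooth.norm_gradEst_le (hq k) _
  have hc := h.c_pos
  have hβ := h.β_pos
  have hγ := M.one_sub_γ_pos
  have hwt := norm_weight_step_sub_sq_le hl₁ a.c u hyV (l := x.2.2)
  have hwt' : (M.outcome a x q).2.2 = metricProj (simplex K)
      (x.2.2 - a.c • WithLp.toLp 2 fun k => inner ℝ u (y k)) := by
    rw [hu, hy]; rfl
  rw [← hwt'] at hwt
  have h1 : 1 / (2 * a.c) * ‖(M.outcome a x q).2.2 - l₁‖ ^ 2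
      ≤ 1 / (2 * a.c) * ‖x.2.2 - l₁‖ ^ 2
        + weightGain u (∑ k, x.2.2 k • y k) (∑ k, l₁ k • y k) := by
    have h2 := mul_le_mul_of_nonneg_left hwt (one_div_pos.2 (mul_pos two_pos hc)).le
    -- After division by `2c` the quadratic term is half of `c K V² ‖u‖²` with `V = Cφ² B`; the
    -- bound `1/4` on `c K V²` produces the `1/8` of `weightGain`.
    have h3 := mul_le_mul_of_nonneg_right h.c_le (sq_nonneg ‖u‖)
    rw [weightGain]
    refine h2.trans ?_
    have e : 1 / (2 * a.c) * (‖x.2.2 - l₁‖ ^ 2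
        - 2 * a.c * (inner ℝ u (∑ k, x.2.2 k • y k) - inner ℝ u (∑ k, l₁ k • y k))
        + a.c ^ 2 * (K * (Cφ ^ 2 * a.B) ^ 2) * ‖u‖ ^ 2)
        = 1 / (2 * a.c) * ‖x.2.2 - l₁‖ ^ 2
        - (inner ℝ u (∑ k, x.2.2 k • y k) - inner ℝ u (∑ k, l₁ k • y k))
        + 1 / 2 * (a.c * (K * (Cφ ^ 2 * a.B) ^ 2) * ‖u‖ ^ 2) := by
      field_simp
    rw [e]
    linarith
  have h2 : ∑ k, l₁ k * M.J k x.1 + a.β * inner ℝ (∑ k, l₁ k • gradient (M.J k) x.1) v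
      - M.lipJ / 2 * (a.β ^ 2 * ‖v‖ ^ 2) ≤ ∑ k, l₁ k * M.J k (M.outcome a x q).1 := by
    have e : (M.outcome a x q).1 = x.1 + a.β • v := by rw [hv]; rfl
    have h3 : ∀ k, M.J k x.1 + inner ℝ (gradient (M.J k) x.1) (a.β • v)
        - M.lipJ / 2 * ‖a.β • v‖ ^ 2 ≤ M.J k (x.1 + a.β • v) := fun k =>
      le_of_lipschitz_gradient (h.hasGradientAt_J k)
        (h.ergodic.norm_gradient_J_sub_le_lipJ h.ρ_nonneg h.ρ_lt_one h.smooth h.Lφ_nonneg k)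
        x.1 (a.β • v)
    have h4 := Finset.sum_le_sum fun k (_ : k ∈ Finset.univ) =>
      mul_le_mul_of_nonneg_left (h3 k) (hl₁.1 k)
    rw [e]
    refine le_of_eq_of_le ?_ h4
    simp_rw [mul_sub, mul_add]
    rw [Finset.sum_sub_distrib, Finset.sum_add_distrib, ← Finset.sum_mul, hl₁.2, one_mul,
      sum_inner, norm_smul, mul_pow, Real.norm_eq_abs, sq_abs, Finset.mul_sum]
    congr 2
    refine Finset.sum_congr rfl fun k _ => ?_
    rw [inner_smul_right, real_inner_smul_left]
    ring
  have h3 : -((1 - M.γ) / a.β * ∑ k, l₁ k * M.J k (M.outcome a x q).1)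
      ≤ -((1 - M.γ) / a.β * ∑ k, l₁ k * M.J k x.1)
        + actorGain (∑ k, l₁ k • ((1 - M.γ) • gradient (M.J k) x.1)) v := by
    have h4 := mul_le_mul_of_nonneg_left h2 (div_pos hγ hβ).le
    have e1 : (inner ℝ (∑ k, l₁ k • ((1 - M.γ) • gradient (M.J k) x.1)) v : ℝ)
        = (1 - M.γ) * inner ℝ (∑ k, l₁ k • gradient (M.J k) x.1) v := by
      simp_rw [smul_comm (l₁ _) (1 - M.γ)]
      rw [← Finset.smul_sum, real_inner_smul_left]
    have e2 : (1 - M.γ) / a.β * (∑ k, l₁ k * M.J k x.1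
        + a.β * inner ℝ (∑ k, l₁ k • gradient (M.J k) x.1) v
        - M.lipJ / 2 * (a.β ^ 2 * ‖v‖ ^ 2))
        = (1 - M.γ) / a.β * ∑ k, l₁ k * M.J k x.1
          + (1 - M.γ) * inner ℝ (∑ k, l₁ k • gradient (M.J k) x.1) v
          - (1 - M.γ) * (a.β * M.lipJ) * (1 / 2 * ‖v‖ ^ 2) := by
      field_simp
    -- This is where `β L_J ≤ 1` enters: it makes the second-order term of the actor step at most
    -- `‖v‖²/2`.
    have h5 : (1 - M.γ) * (a.β * M.lipJ) ≤ 1 := by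
      have h6 : 0 ≤ a.β * M.lipJ := mul_nonneg hβ.le lipJ_nonneg
      have h7 : 1 - M.γ ≤ 1 := by linarith [M.γ_nonneg]
      nlinarith [h.lip]
    have h6 := mul_le_mul_of_nonneg_right h5 (by positivity : 0 ≤ 1 / 2 * ‖v‖ ^ 2)
    rw [e2] at h4
    rw [actorGain, e1]
    linarith
  rw [← hu, ← hv, ← hy, potential, potential]
  linarith

end MultiTaskMDP

theorem abs_weightGain_le {p : ℕ} {u y y₁ : Vec p} {V : ℝ} (hu : ‖u‖ ≤ V) (hy : ‖y‖ ≤ V)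
    (hy₁ : ‖y₁‖ ≤ V) : |weightGain u y y₁| ≤ 3 * V ^ 2 := by
  have hV : 0 ≤ V := (norm_nonneg _).trans hu
  have h1 := abs_le.1 ((abs_real_inner_le_norm u y).trans (mul_le_mul hu hy (norm_nonneg _) hV))
  have h2 := abs_le.1 ((abs_real_inner_le_norm u y₁).trans (mul_le_mul hu hy₁ (norm_nonneg _) hV))
  have h3 := pow_le_pow_left₀ (norm_nonneg _) hu 2
  have h4 := sq_nonneg ‖u‖
  rw [weightGain, abs_le]
  constructor <;> nlinarith [h1.1, h1.2, h2.1, h2.2]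

theorem abs_actorGain_le {p : ℕ} {u y : Vec p} {V : ℝ} (hy : ‖y‖ ≤ V) :
    |actorGain u y| ≤ ‖u‖ * V + V ^ 2 := by
  have h1 := abs_le.1 ((abs_real_inner_le_norm u y).trans
    (mul_le_mul_of_nonneg_left hy (norm_nonneg u)))
  have h3 := pow_le_pow_left₀ (norm_nonneg _) hy 2
  have h4 := sq_nonneg ‖y‖
  rw [actorGain, abs_le]
  constructor <;> nlinarith [h1.1, h1.2]

namespace MultiTaskMDP

variable {S A : Type*} [MeasurableSpace S] [MeasurableSpace A] {K p m : ℕ}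
  {M : MultiTaskMDP S A K p m} {a : Params}
  {Cφ Cπ Lφ κ ρ : ℝ} (h : M.Analysis a Cφ Cπ Lφ κ ρ)

/-- The common descent direction with weights `l`, up to the factor `1 - γ`. -/
def direction (M : MultiTaskMDP S A K p m) (l : Vec K) (θ : Vec p) : Vec p :=
  ∑ k, l k • ((1 - M.γ) • gradient (M.J k) θ)

theorem Smooth.measurable_gradEst_right {Cφ Cπ Lφ : ℝ} (hS : M.Smooth Cφ Cπ Lφ) {N : ℕ}
    (θ : Vec p) (w : Fin K → Vec m) (k : Fin K) :
    Measurable fun z : Fin K → Fin N → S × A => M.gradEst θ w z k :=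
  (hS.measurable_gradEst k).comp
    (f := fun z : Fin K → Fin N → S × A => ((θ, w), z)) (by fun_prop)

/-- A bound for the squared bias of the gradient estimate of task `k` with critics `w`. -/
def gradErr (M : MultiTaskMDP S A K p m) (Cφ : ℝ) (θ : Vec p) (w : Fin K → Vec m) (k : Fin K) :
    ℝ :=
  2 * Cφ ^ 4 * ‖w k - M.wStar k θ‖ ^ 2 + 2 * Cφ ^ 2 * M.εapp ^ 2

include h

theorem Analysis.norm_meanGrad_sub_direction_sq_le {l : Vec K} (hl : l ∈ simplex K) (θ : Vec p)
    (w : Fin K → Vec m) :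
    ‖∑ k, l k • M.meanGrad θ w k - M.direction l θ‖ ^ 2
      ≤ ∑ k, l k * M.gradErr Cφ θ w k := by
  rw [direction, ← Finset.sum_sub_distrib]
  simp_rw [← smul_sub]
  refine (norm_sum_smul_sq_le_of_mem_simplex hl _).trans
    (Finset.sum_le_sum fun k _ => mul_le_mul_of_nonneg_left ?_ (hl.1 k))
  exact Smooth.norm_meanGrad_sub_sq_le h.wStar_le h.ρ_nonneg h.ρ_lt_one
    h.ergodic h.smooth θ w k

theorem Analysis.integral_batches_le {l₁ : Vec K} (hl₁ : l₁ ∈ simplex K) {x : State K p m}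
    (hx : x.2.2 ∈ simplex K) {w : Fin K → Vec m} (hw : ∀ k, ‖w k‖ ≤ a.B) :
    ∫ q, M.potential a l₁ (M.outcome a x (w, q))
        ∂((M.batch a.NFC x).prod ((M.batch a.NFC x).prod (M.batch a.Nactor x)))
      ≤ M.potential a l₁ x - 1 / 8 * ‖M.direction x.2.2 x.1‖ ^ 2
        + ∑ k, (2 * l₁ k + 1 / 4 * x.2.2 k) * M.gradErr Cφ x.1 w k
        + 17 / 8 * ((Cφ ^ 2 * a.B) ^ 2 / a.NFC) + 1 / 2 * ((Cφ ^ 2 * a.B) ^ 2 / a.Nactor) := by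
  have hne : (simplex K).Nonempty := ⟨_, hl₁⟩
  have hS := h.smooth
  have hmf : ∀ k, Measurable fun z : Fin K → Fin a.NFC → S × A => M.gradEst x.1 w z k :=
    hS.measurable_gradEst_right x.1 w
  have hma : ∀ k, Measurable fun z : Fin K → Fin a.Nactor → S × A => M.gradEst x.1 w z k :=
    hS.measurable_gradEst_right x.1 w
  have hV : ∀ {N : ℕ} (k : Fin K) (z : Fin K → Fin N → S × A),
      ‖M.gradEst x.1 w z k‖ ≤ Cφ ^ 2 * a.B := fun k z => hS.norm_gradEst_le (hw k) z
  have hVl : ∀ {N : ℕ} {l : Vec K} (_ : l ∈ simplex K) (z : Fin K → Fin N → S × A),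
      ‖∑ k, l k • M.gradEst x.1 w z k‖ ≤ Cφ ^ 2 * a.B := fun hl z =>
    norm_sum_smul_le_of_mem_simplex hl fun k => hV k z
  -- The bound on the change of the potential separates into `f`, depending on the two weight
  -- batches, and `g`, depending on the actor batch, so the triple integral splits.
  obtain ⟨f, hf⟩ : ∃ f : (Fin K → Fin a.NFC → S × A) × (Fin K → Fin a.NFC → S × A) → ℝ,
      f = fun r => weightGain (∑ k, x.2.2 k • M.gradEst x.1 w r.1 k)
          (∑ k, x.2.2 k • M.gradEst x.1 w (if a.twoBatches then r.2 else r.1) k)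
          (∑ k, l₁ k • M.gradEst x.1 w (if a.twoBatches then r.2 else r.1) k) := ⟨_, rfl⟩
  obtain ⟨g, hg⟩ : ∃ g : (Fin K → Fin a.Nactor → S × A) → ℝ,
      g = fun z => actorGain (M.direction l₁ x.1) (∑ k, x.2.2 k • M.gradEst x.1 w z k) :=
    ⟨_, rfl⟩
  have hfm : Measurable f := by
    have h1 : ∀ l : Vec K, Measurable fun r : (Fin K → Fin a.NFC → S × A) ×
        (Fin K → Fin a.NFC → S × A) => ∑ k, l k • M.gradEst x.1 w r.1 k := fun l =>
      (measurable_sum_smul hmf l).comp measurable_fst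
    have h2 : ∀ l : Vec K, Measurable fun r : (Fin K → Fin a.NFC → S × A) ×
        (Fin K → Fin a.NFC → S × A) => ∑ k, l k • M.gradEst x.1 w r.2 k := fun l =>
      (measurable_sum_smul hmf l).comp measurable_snd
    have h3 : ∀ l : Vec K, Measurable fun r : (Fin K → Fin a.NFC → S × A) ×
        (Fin K → Fin a.NFC → S × A) =>
          ∑ k, l k • M.gradEst x.1 w (if a.twoBatches then r.2 else r.1) k := fun l => by
      cases a.twoBatches
      · simpa using h1 l
      · simpa using h2 l
    rw [hf]
    unfold weightGain
    exact (((h1 _).inner (h3 _)).sub ((h1 _).inner (h3 _))).neg.add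
      (((h1 _).norm.pow_const 2).const_mul _)
  have hgm : Measurable g := by
    have h1 := measurable_sum_smul hma x.2.2
    rw [hg]
    unfold actorGain
    exact (measurable_const.inner h1).neg.add ((h1.norm.pow_const 2).const_mul _)
  have hfb : ∀ r, |f r| ≤ 3 * (Cφ ^ 2 * a.B) ^ 2 := fun r => by
    rw [hf]; exact abs_weightGain_le (hVl hx _) (hVl hx _) (hVl hl₁ _)
  have hgb : ∀ z, |g z| ≤ ‖M.direction l₁ x.1‖ * (Cφ ^ 2 * a.B) + (Cφ ^ 2 * a.B) ^ 2 :=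
    fun z => by rw [hg]; exact abs_actorGain_le (hVl hx _)
  have hint : Integrable (fun q : (Fin K → Fin a.NFC → S × A) × ((Fin K → Fin a.NFC → S × A) ×
      (Fin K → Fin a.Nactor → S × A)) => f (q.1, q.2.1) + g q.2.2)
      ((M.batch a.NFC x).prod ((M.batch a.NFC x).prod (M.batch a.Nactor x))) :=
    integrable_of_norm_le ((hfm.comp (f := fun q : (Fin K → Fin a.NFC → S × A) ×
      ((Fin K → Fin a.NFC → S × A) × (Fin K → Fin a.Nactor → S × A)) => (q.1, q.2.1))
      (by fun_prop)).add (hgm.comp (by fun_prop))).stronglyMeasurable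
      fun q => (norm_add_le _ _).trans (add_le_add (hfb _) (hgb _))
  have hout : Measurable fun q : (Fin K → Fin a.NFC → S × A) × ((Fin K → Fin a.NFC → S × A) ×
      (Fin K → Fin a.Nactor → S × A)) => M.potential a l₁ (M.outcome a x (w, q)) :=
    (measurable_potential h.measurable_J l₁).comp ((hS.measurable_outcome hne).comp
      (f := fun q : (Fin K → Fin a.NFC → S × A) × ((Fin K → Fin a.NFC → S × A) ×
        (Fin K → Fin a.Nactor → S × A)) => (x, (w, q))) (by fun_prop))
  have hpot : ∫ q, M.potential a l₁ (M.outcome a x (w, q))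
        ∂((M.batch a.NFC x).prod ((M.batch a.NFC x).prod (M.batch a.Nactor x)))
      ≤ M.potential a l₁ x + ∫ q, (f (q.1, q.2.1) + g q.2.2)
        ∂((M.batch a.NFC x).prod ((M.batch a.NFC x).prod (M.batch a.Nactor x))) := by
    have e : M.potential a l₁ x + ∫ q, (f (q.1, q.2.1) + g q.2.2)
        ∂((M.batch a.NFC x).prod ((M.batch a.NFC x).prod (M.batch a.Nactor x)))
        = ∫ q, (M.potential a l₁ x + (f (q.1, q.2.1) + g q.2.2))
        ∂((M.batch a.NFC x).prod ((M.batch a.NFC x).prod (M.batch a.Nactor x))) := by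
      rw [integral_add (integrable_const _) hint]; simp
    rw [e]
    refine integral_mono (integrable_of_norm_le hout.stronglyMeasurable fun q =>
      h.abs_potential_le hl₁ (fcUpdate_mem_simplex hne x (w, q)))
      ((integrable_const _).add hint) fun q => ?_
    rw [hf, hg]
    exact h.potential_outcome_le hl₁ x (w, q) hw
  rw [integral_prod_prod_add hfm hfb hgm hgb] at hpot
  have hmean : ∀ {N : ℕ} (_ : 1 ≤ N) (k : Fin K),
      ∫ z, M.gradEst x.1 w z k ∂(M.batch N x) = M.meanGrad x.1 w k := fun hN k =>
    hS.integral_gradEst hN k (hw k)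
  have hvar : ∀ {N : ℕ} (_ : 1 ≤ N) (k : Fin K),
      ∫ z, ‖M.gradEst x.1 w z k - M.meanGrad x.1 w k‖ ^ 2 ∂(M.batch N x)
        ≤ (Cφ ^ 2 * a.B) ^ 2 / N := fun hN k => hS.integral_norm_gradEst_sub_sq_le hN k (hw k)
  have hfi : ∫ y, ∫ z, f (y, z) ∂(M.batch a.NFC x) ∂(M.batch a.NFC x)
      ≤ weightGain (∑ k, x.2.2 k • M.meanGrad x.1 w k) (∑ k, x.2.2 k • M.meanGrad x.1 w k)
        (∑ k, l₁ k • M.meanGrad x.1 w k) + 17 / 8 * ((Cφ ^ 2 * a.B) ^ 2 / a.NFC) := by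
    rw [hf]
    cases a.twoBatches
    · simpa using integral_weightGain_le (μ := M.batch a.NFC x) hmf hV (hmean h.one_le_NFC)
        (hvar h.one_le_NFC) hx hl₁
    · simpa using integral_integral_weightGain_le (μ := M.batch a.NFC x) (l₁ := l₁) hmf hV
        (hmean h.one_le_NFC) (hvar h.one_le_NFC) hx
  have hgi : ∫ z, g z ∂(M.batch a.Nactor x)
      ≤ actorGain (M.direction l₁ x.1) (∑ k, x.2.2 k • M.meanGrad x.1 w k)
        + 1 / 2 * ((Cφ ^ 2 * a.B) ^ 2 / a.Nactor) := by
    rw [hg]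
    exact integral_actorGain_le (μ := M.batch a.Nactor x) hma hV (hmean h.one_le_Nactor)
      (hvar h.one_le_Nactor) hx _
  have hgain := weightGain_add_actorGain_le (∑ k, x.2.2 k • M.meanGrad x.1 w k)
    (∑ k, l₁ k • M.meanGrad x.1 w k) (M.direction x.2.2 x.1) (M.direction l₁ x.1)
  have e1 := h.norm_meanGrad_sub_direction_sq_le hl₁ x.1 w
  have e2 := h.norm_meanGrad_sub_direction_sq_le hx x.1 w
  have e3 : ∑ k, (2 * l₁ k + 1 / 4 * x.2.2 k) * M.gradErr Cφ x.1 w k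
      = 2 * ∑ k, l₁ k * M.gradErr Cφ x.1 w k
        + 1 / 4 * ∑ k, x.2.2 k * M.gradErr Cφ x.1 w k := by
    rw [Finset.mul_sum, Finset.mul_sum, ← Finset.sum_add_distrib]
    exact Finset.sum_congr rfl fun k _ => by ring
  rw [e3]
  linarith

theorem Analysis.ae_criticPhase_norm_le (x : State K p m) :
    ∀ᵐ w ∂(M.criticPhase a x), ∀ k, ‖w k‖ ≤ a.B := by
  rw [criticPhase_apply]
  have hp : ∀ k, IsProbabilityMeasure
      ((M.criticLaw a k a.Ncritic (x.1, x.2.1 k)).map Prod.fst) := fun k =>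
    Measure.isProbabilityMeasure_map measurable_fst.aemeasurable
  refine ae_all_iff.2 fun k => ?_
  refine (measurePreserving_eval (fun k => (M.criticLaw a k a.Ncritic (x.1, x.2.1 k)).map
    Prod.fst) k).quasiMeasurePreserving.ae (p := fun y => ‖y‖ ≤ a.B) ?_
  rw [ae_map_iff measurable_fst.aemeasurable
    (measurableSet_le (by fun_prop) (by fun_prop))]
  exact ae_criticLaw_norm_le M a k h.B_nonneg h.one_le_Ncritic _

theorem Analysis.integral_criticPhase_error_le (x : State K p m) (k : Fin K) :
    ∫ w, ‖w k - M.wStar k x.1‖ ^ 2 ∂(M.criticPhase a x)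
      ≤ criticConst Cφ κ ρ a.lamA a.B / √a.Ncritic := by
  rw [criticPhase_apply]
  have hp : ∀ k, IsProbabilityMeasure
      ((M.criticLaw a k a.Ncritic (x.1, x.2.1 k)).map Prod.fst) := fun k =>
    Measure.isProbabilityMeasure_map measurable_fst.aemeasurable
  have hm : Measurable fun y : Vec m => ‖y - M.wStar k x.1‖ ^ 2 := by fun_prop
  have h1 := integral_pi_eval (μ := fun k => (M.criticLaw a k a.Ncritic (x.1, x.2.1 k)).map
    Prod.fst) k hm.stronglyMeasurable
  refine h1.trans_le ?_
  rw [integral_map measurable_fst.aemeasurable hm.aestronglyMeasurable]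
  exact integral_critic_error_le h.Cφ_nonneg h.smooth.feature_le h.κ_nonneg h.ρ_nonneg
    h.ρ_lt_one h.ergodic h.lamA_pos h.solvable h.B_nonneg (h.wStar_le _ _) _ h.one_le_Ncritic

omit h in
/-- The error of one iteration. -/
def stepErr (M : MultiTaskMDP S A K p m) (a : Params) (Cφ κ ρ : ℝ) : ℝ :=
  9 / 4 * (2 * Cφ ^ 4 * (criticConst Cφ κ ρ a.lamA a.B / √a.Ncritic)
      + 2 * Cφ ^ 2 * M.εapp ^ 2)
    + 17 / 8 * ((Cφ ^ 2 * a.B) ^ 2 / a.NFC) + 1 / 2 * ((Cφ ^ 2 * a.B) ^ 2 / a.Nactor)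

theorem Analysis.integral_gradErr (x : State K p m) (k : Fin K) :
    Integrable (fun w => M.gradErr Cφ x.1 w k) (M.criticPhase a x) ∧
    ∫ w, M.gradErr Cφ x.1 w k ∂(M.criticPhase a x)
      ≤ 2 * Cφ ^ 4 * (criticConst Cφ κ ρ a.lamA a.B / √a.Ncritic)
        + 2 * Cφ ^ 2 * M.εapp ^ 2 := by
  have hi : Integrable (fun w : Fin K → Vec m => ‖w k - M.wStar k x.1‖ ^ 2)
      (M.criticPhase a x) := by
    refine Integrable.of_bound (C := (a.B + a.B) ^ 2)
      (by fun_prop : Measurable fun w : Fin K → Vec m =>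
        ‖w k - M.wStar k x.1‖ ^ 2).aestronglyMeasurable ?_
    filter_upwards [h.ae_criticPhase_norm_le x] with w hw
    rw [norm_pow, norm_norm]
    exact pow_le_pow_left₀ (norm_nonneg _)
      ((norm_sub_le _ _).trans (add_le_add (hw k) (h.wStar_le k x.1))) 2
  have hi' := hi.const_mul (2 * Cφ ^ 4)
  refine ⟨hi'.add (integrable_const _), ?_⟩
  simp only [gradErr]
  rw [integral_add hi' (integrable_const _), integral_const_mul, integral_const, probReal_univ,
    one_smul]
  have := mul_le_mul_of_nonneg_left (h.integral_criticPhase_error_le x k)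
    (by positivity : 0 ≤ 2 * Cφ ^ 4)
  linarith

/-- The expected decrease of the potential in one iteration. -/
theorem Analysis.integral_iteration_potential_le {l₁ : Vec K} (hl₁ : l₁ ∈ simplex K)
    {x : State K p m} (hx : x.2.2 ∈ simplex K) :
    ∫ y, M.potential a l₁ y ∂(M.iteration a x)
      ≤ M.potential a l₁ x - 1 / 8 * ‖M.direction x.2.2 x.1‖ ^ 2 + M.stepErr a Cφ κ ρ := by
  have hne : (simplex K).Nonempty := ⟨_, hl₁⟩
  have hm := measurable_potential (a := a) h.measurable_J l₁
  have hout : Measurable (M.outcome a x) := (h.smooth.measurable_outcome hne).comp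
    (f := fun q => (x, q)) (by fun_prop)
  have hint : Integrable (fun q => M.potential a l₁ (M.outcome a x q)) (M.drawLaw a x) :=
    integrable_of_norm_le (hm.comp hout).stronglyMeasurable fun q =>
      h.abs_potential_le hl₁ (fcUpdate_mem_simplex hne x q)
  rw [h.smooth.iteration_apply hne, integral_map hout.aemeasurable hm.aestronglyMeasurable]
  rw [drawLaw] at hint ⊢
  rw [integral_prod _ hint]
  have hI := fun k => h.integral_gradErr x k
  have hs : Integrable (fun w => ∑ k, (2 * l₁ k + 1 / 4 * x.2.2 k) * M.gradErr Cφ x.1 w k)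
      (M.criticPhase a x) := integrable_finsetSum _ fun k _ => (hI k).1.const_mul _
  obtain ⟨c, hc⟩ : ∃ c, c = M.potential a l₁ x - 1 / 8 * ‖M.direction x.2.2 x.1‖ ^ 2
      + 17 / 8 * ((Cφ ^ 2 * a.B) ^ 2 / a.NFC) + 1 / 2 * ((Cφ ^ 2 * a.B) ^ 2 / a.Nactor) :=
    ⟨_, rfl⟩
  have h1 : ∫ w, ∫ q, M.potential a l₁ (M.outcome a x (w, q))
        ∂((M.batch a.NFC x).prod ((M.batch a.NFC x).prod (M.batch a.Nactor x)))
        ∂(M.criticPhase a x)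
      ≤ ∫ w, (c + ∑ k, (2 * l₁ k + 1 / 4 * x.2.2 k) * M.gradErr Cφ x.1 w k)
        ∂(M.criticPhase a x) := by
    refine integral_mono_ae hint.integral_prod_left ((integrable_const c).add hs) ?_
    filter_upwards [h.ae_criticPhase_norm_le x] with w hw
    have := h.integral_batches_le hl₁ hx hw
    rw [hc]
    linarith
  refine h1.trans ?_
  rw [integral_add (integrable_const c) hs, integral_const, probReal_univ, one_smul,
    integral_finsetSum _ fun k _ => (hI k).1.const_mul _]
  simp_rw [integral_const_mul]
  have h2 : ∑ k, (2 * l₁ k + 1 / 4 * x.2.2 k) * ∫ w, M.gradErr Cφ x.1 w k ∂(M.criticPhase a x)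
      ≤ ∑ k, (2 * l₁ k + 1 / 4 * x.2.2 k)
        * (2 * Cφ ^ 4 * (criticConst Cφ κ ρ a.lamA a.B / √a.Ncritic)
          + 2 * Cφ ^ 2 * M.εapp ^ 2) := Finset.sum_le_sum fun k _ => by
    have h3 := hl₁.1 k
    have h4 := hx.1 k
    exact mul_le_mul_of_nonneg_left (hI k).2 (by positivity)
  -- The coefficients `2` and `1/4` come from `weightGain_add_actorGain_le`; each weight vector sums
  -- to one.
  have h3 : ∑ k, (2 * l₁ k + 1 / 4 * x.2.2 k) = 9 / 4 := by
    rw [Finset.sum_add_distrib, ← Finset.mul_sum, ← Finset.mul_sum, hl₁.2, hx.2]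
    norm_num
  rw [← Finset.sum_mul, h3] at h2
  rw [hc, stepErr]
  linarith

end MultiTaskMDP

namespace MultiTaskMDP

/-! ### The run of the algorithm -/

variable {S A : Type*} [MeasurableSpace S] [MeasurableSpace A] {K p m : ℕ}
  {M : MultiTaskMDP S A K p m} {a : Params}

theorem direction_eq (l : Vec K) (θ : Vec p) :
    M.direction l θ = (1 - M.γ) • ∑ k, l k • gradient (M.J k) θ := by
  simp_rw [direction, smul_comm (l _) (1 - M.γ), Finset.smul_sum]

theorem paretoGap_nonneg (θ : Vec p) : 0 ≤ M.paretoGap θ :=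
  Real.iInf_nonneg fun _ => sq_nonneg _

theorem paretoGap_le {l : Vec K} (hl : l ∈ simplex K) (θ : Vec p) :
    M.paretoGap θ ≤ ‖∑ k, l k • gradient (M.J k) θ‖ ^ 2 :=
  ciInf_le (f := fun l : simplex K => ‖∑ k, (l : Vec K) k • gradient (M.J k) θ‖ ^ 2)
    ⟨0, by rintro _ ⟨l, rfl⟩; exact sq_nonneg _⟩ ⟨l, hl⟩

theorem mul_paretoGap_le_norm_direction_sq {l : Vec K} (hl : l ∈ simplex K) (θ : Vec p) :
    (1 - M.γ) ^ 2 * M.paretoGap θ ≤ ‖M.direction l θ‖ ^ 2 := by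
  rw [direction_eq, norm_smul, mul_pow, Real.norm_eq_abs, sq_abs]
  exact mul_le_mul_of_nonneg_left (paretoGap_le hl θ) (sq_nonneg _)

variable {Cφ Cπ Lφ κ ρ : ℝ} (h : M.Analysis a Cφ Cπ Lφ κ ρ) {x₀ : State K p m}
  (hx₀ : x₀.2.2 ∈ simplex K)
include h hx₀

/-- The infimum runs over an uncountable simplex, but an infimum of continuous functions is upper
semicontinuous and hence measurable. -/
theorem Analysis.measurable_paretoGap : Measurable M.paretoGap := by
  have hc : ∀ k, Continuous (gradient (M.J k)) := fun k => by
    have hl : LipschitzWith (Real.toNNReal M.lipJ) (gradient (M.J k)) :=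
      LipschitzWith.of_dist_le_mul fun θ θ' => by
        rw [dist_eq_norm, dist_eq_norm, Real.coe_toNNReal _ lipJ_nonneg]
        exact h.ergodic.norm_gradient_J_sub_le_lipJ h.ρ_nonneg h.ρ_lt_one h.smooth h.Lφ_nonneg
          k θ θ'
    exact hl.continuous
  have hne : Nonempty (simplex K) := ⟨⟨_, hx₀⟩⟩
  have hl : ∀ l : simplex K, Continuous fun θ =>
      ‖∑ k, (l : Vec K) k • gradient (M.J k) θ‖ ^ 2 := fun l => by
    have h1 : Continuous fun θ => ∑ k, (l : Vec K) k • gradient (M.J k) θ :=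
      continuous_finsetSum Finset.univ fun k _ => (hc k).const_smul ((l : Vec K) k)
    exact h1.norm.pow 2
  have hu : UpperSemicontinuous fun θ =>
      ⨅ l : simplex K, ‖∑ k, (l : Vec K) k • gradient (M.J k) θ‖ ^ 2 :=
    upperSemicontinuous_ciInf (fun θ => ⟨0, by rintro _ ⟨l, rfl⟩; exact sq_nonneg _⟩)
      fun l => (hl l).upperSemicontinuous
  exact hu.measurable

theorem Analysis.norm_paretoGap_le (θ : Vec p) : ‖M.paretoGap θ‖ ≤ ((1 - M.γ)⁻¹ * Cφ) ^ 2 := by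
  rw [Real.norm_of_nonneg (paretoGap_nonneg θ)]
  refine (paretoGap_le hx₀ θ).trans (pow_le_pow_left₀ (norm_nonneg _) ?_ 2)
  exact norm_sum_smul_le_of_mem_simplex hx₀ fun k =>
    h.ergodic.norm_gradient_J_le h.ρ_nonneg h.ρ_lt_one h.smooth k θ

theorem Analysis.isMarkovKernel_iteration : IsMarkovKernel (M.iteration a) :=
  ⟨fun x => by
    have hout : Measurable (M.outcome a x) := (h.smooth.measurable_outcome ⟨_, hx₀⟩).comp
      (f := fun q => (x, q)) (by fun_prop)
    rw [h.smooth.iteration_apply ⟨_, hx₀⟩]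
    exact Measure.isProbabilityMeasure_map hout.aemeasurable⟩

theorem Analysis.isProbabilityMeasure_runLaw (t : ℕ) : IsProbabilityMeasure (M.runLaw a x₀ t) := by
  have hK := h.isMarkovKernel_iteration hx₀
  induction t with
  | zero => rw [runLaw]; infer_instance
  | succ t ih => rw [runLaw]; infer_instance

theorem Analysis.ae_iteration_mem_simplex (x : State K p m) :
    ∀ᵐ y ∂(M.iteration a x), y.2.2 ∈ simplex K := by
  have hout : Measurable (M.outcome a x) := (h.smooth.measurable_outcome ⟨_, hx₀⟩).comp
    (f := fun q => (x, q)) (by fun_prop)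
  have hs : MeasurableSet {y : State K p m | y.2.2 ∈ simplex K} :=
    (by fun_prop : Measurable fun y : State K p m => y.2.2) isClosed_simplex.measurableSet
  rw [h.smooth.iteration_apply ⟨_, hx₀⟩, ae_map_iff hout.aemeasurable hs]
  exact Filter.Eventually.of_forall fun q => fcUpdate_mem_simplex ⟨_, hx₀⟩ x q

theorem Analysis.ae_runLaw_mem_simplex (t : ℕ) :
    ∀ᵐ x ∂(M.runLaw a x₀ t), x.2.2 ∈ simplex K := by
  have hs : MeasurableSet {y : State K p m | y.2.2 ∈ simplex K} :=
    (by fun_prop : Measurable fun y : State K p m => y.2.2) isClosed_simplex.measurableSet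
  cases t with
  | zero => rw [runLaw]; exact (ae_dirac_iff hs).2 hx₀
  | succ t =>
    rw [runLaw, ae_iff]
    change ((M.runLaw a x₀ t).bind (M.iteration a)) {y : State K p m | y.2.2 ∈ simplex K}ᶜ = 0
    rw [Measure.bind_apply hs.compl (M.iteration a).measurable.aemeasurable]
    have h0 : ∀ x, (M.iteration a x) {y : State K p m | y.2.2 ∈ simplex K}ᶜ = 0 := fun x =>
      h.ae_iteration_mem_simplex hx₀ x
    simp [h0]

theorem Analysis.integrable_potential_runLaw (t : ℕ) :
    Integrable (M.potential a x₀.2.2) (M.runLaw a x₀ t) := by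
  have := h.isProbabilityMeasure_runLaw hx₀ t
  refine Integrable.of_bound (C := 2 / a.c + 1 / a.β)
    (measurable_potential h.measurable_J _).aestronglyMeasurable ?_
  filter_upwards [h.ae_runLaw_mem_simplex hx₀ t] with x hx
  exact h.abs_potential_le hx₀ hx

theorem Analysis.abs_integral_potential_runLaw_le (t : ℕ) :
    |∫ x, M.potential a x₀.2.2 x ∂(M.runLaw a x₀ t)| ≤ 2 / a.c + 1 / a.β := by
  have := h.isProbabilityMeasure_runLaw hx₀ t
  have h1 := norm_integral_le_of_norm_le_const (μ := M.runLaw a x₀ t)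
    (f := M.potential a x₀.2.2) (C := 2 / a.c + 1 / a.β) (by
      filter_upwards [h.ae_runLaw_mem_simplex hx₀ t] with x hx
      exact h.abs_potential_le hx₀ hx)
  simpa using h1

theorem Analysis.integrable_paretoGap_runLaw (t : ℕ) :
    Integrable (fun x : State K p m => M.paretoGap x.1) (M.runLaw a x₀ t) := by
  have := h.isProbabilityMeasure_runLaw hx₀ t
  exact integrable_of_norm_le ((h.measurable_paretoGap hx₀).comp measurable_fst).stronglyMeasurable
    fun x => h.norm_paretoGap_le hx₀ x.1

/-- The Pareto gap is at most the value at the current weight `λ_t`, which the potential controls.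
The comparison weight is `λ₀`; any fixed point of the simplex would serve. -/
theorem Analysis.integral_paretoGap_runLaw_le (t : ℕ) :
    (1 - M.γ) ^ 2 / 8 * ∫ x, M.paretoGap x.1 ∂(M.runLaw a x₀ t)
      ≤ ∫ x, M.potential a x₀.2.2 x ∂(M.runLaw a x₀ t)
        - ∫ x, M.potential a x₀.2.2 x ∂(M.runLaw a x₀ (t + 1)) + M.stepErr a Cφ κ ρ := by
  have hP := h.isProbabilityMeasure_runLaw hx₀ t
  have hK := h.isMarkovKernel_iteration hx₀
  have hi := h.integrable_potential_runLaw hx₀ t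
  have hi' := h.integrable_potential_runLaw hx₀ (t + 1)
  have hg := (h.integrable_paretoGap_runLaw hx₀ t).const_mul ((1 - M.γ) ^ 2 / 8)
  have hm := measurable_potential (a := a) h.measurable_J x₀.2.2
  have hb : ∀ x, ‖∫ y, M.potential a x₀.2.2 y ∂(M.iteration a x)‖ ≤ 2 / a.c + 1 / a.β :=
    fun x => by
      have h1 := norm_integral_le_of_norm_le_const (μ := M.iteration a x)
        (f := M.potential a x₀.2.2) (C := 2 / a.c + 1 / a.β) (by
          filter_upwards [h.ae_iteration_mem_simplex hx₀ x] with y hy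
          exact h.abs_potential_le hx₀ hy)
      simpa using h1
  have hii : Integrable (fun x => ∫ y, M.potential a x₀.2.2 y ∂(M.iteration a x))
      (M.runLaw a x₀ t) :=
    integrable_of_norm_le (hm.stronglyMeasurable.integral_kernel (κ := M.iteration a)) hb
  have e : ∫ x, M.potential a x₀.2.2 x ∂(M.runLaw a x₀ (t + 1))
      = ∫ x, ∫ y, M.potential a x₀.2.2 y ∂(M.iteration a x) ∂(M.runLaw a x₀ t) := by
    rw [runLaw] at hi' ⊢
    exact integral_bind_of_integrable hi'
  have hgi : Integrable (fun x : State K p m => (1 - M.γ) ^ 2 / 8 * M.paretoGap x.1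
      + ∫ y, M.potential a x₀.2.2 y ∂(M.iteration a x)) (M.runLaw a x₀ t) := hg.add hii
  have h1 : ∫ x, ((1 - M.γ) ^ 2 / 8 * M.paretoGap x.1
      + ∫ y, M.potential a x₀.2.2 y ∂(M.iteration a x)) ∂(M.runLaw a x₀ t)
      ≤ ∫ x, (M.potential a x₀.2.2 x + M.stepErr a Cφ κ ρ) ∂(M.runLaw a x₀ t) := by
    refine integral_mono_ae hgi (hi.add (integrable_const _)) ?_
    filter_upwards [h.ae_runLaw_mem_simplex hx₀ t] with x hx
    have h2 := h.integral_iteration_potential_le hx₀ hx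
    have h3 := mul_paretoGap_le_norm_direction_sq (M := M) hx x.1
    linarith
  rw [integral_add hg hii, integral_add hi (integrable_const _), integral_const_mul,
    integral_const, probReal_univ, one_smul] at h1
  rw [e]
  linarith

/-- The potential differences telescope, and the potential at either end is at most `2/c + 1/β` in
absolute value. -/
theorem Analysis.sum_integral_paretoGap_le (T : ℕ) :
    (1 - M.γ) ^ 2 / 8 * ∑ t ∈ Finset.range T, ∫ x, M.paretoGap x.1 ∂(M.runLaw a x₀ t)
      ≤ 2 * (2 / a.c + 1 / a.β) + T * M.stepErr a Cφ κ ρ := by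
  have h1 := Finset.sum_le_sum fun t (_ : t ∈ Finset.range T) =>
    h.integral_paretoGap_runLaw_le hx₀ t
  rw [← Finset.mul_sum, Finset.sum_add_distrib, Finset.sum_range_sub', Finset.sum_const,
    Finset.card_range, nsmul_eq_mul] at h1
  have h2 := abs_le.1 (h.abs_integral_potential_runLaw_le hx₀ 0)
  have h3 := abs_le.1 (h.abs_integral_potential_runLaw_le hx₀ T)
  linarith [h2.2, h3.1]

theorem Analysis.isParetoStationary {T : ℕ} (hT : 1 ≤ T) :
    M.IsParetoStationary (M.outputLaw a x₀ T)
      (8 / (1 - M.γ) ^ 2 * (2 * (2 / a.c + 1 / a.β) / T + M.stepErr a Cφ κ ρ)) := by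
  have hP := h.isProbabilityMeasure_runLaw hx₀
  have hP' : ∀ t, IsProbabilityMeasure ((M.runLaw a x₀ t).map Prod.fst) := fun t =>
    Measure.isProbabilityMeasure_map measurable_fst.aemeasurable
  have hT0 : (0 : ℝ) < T := by exact_mod_cast hT
  have hm := h.measurable_paretoGap hx₀
  have hprob : IsProbabilityMeasure (M.outputLaw a x₀ T) := ⟨by
    rw [outputLaw, Measure.smul_apply, Measure.finsetSum_apply]
    simp only [measure_univ, Finset.sum_const, Finset.card_range, nsmul_eq_mul, mul_one,
      smul_eq_mul]
    exact ENNReal.inv_mul_cancel (by exact_mod_cast (by omega : T ≠ 0))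
      (ENNReal.natCast_ne_top T)⟩
  refine ⟨hprob, integrable_of_norm_le hm.stronglyMeasurable (h.norm_paretoGap_le hx₀), ?_⟩
  rw [outputLaw, integral_smul_measure, integral_finsetSum_measure fun t _ =>
    integrable_of_norm_le hm.stronglyMeasurable (h.norm_paretoGap_le hx₀)]
  simp_rw [integral_map measurable_fst.aemeasurable hm.aestronglyMeasurable]
  have h1 := h.sum_integral_paretoGap_le hx₀ T
  have hγ := pow_pos M.one_sub_γ_pos 2
  have hγ' := M.one_sub_γ_pos.ne'
  rw [ENNReal.toReal_inv, ENNReal.toReal_natCast, smul_eq_mul]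
  have h2 := mul_le_mul_of_nonneg_left h1 (by positivity : 0 ≤ 8 / (1 - M.γ) ^ 2 * (T : ℝ)⁻¹)
  have e1 : 8 / (1 - M.γ) ^ 2 * (T : ℝ)⁻¹ * ((1 - M.γ) ^ 2 / 8
      * ∑ t ∈ Finset.range T, ∫ x, M.paretoGap x.1 ∂(M.runLaw a x₀ t))
      = (T : ℝ)⁻¹ * ∑ t ∈ Finset.range T, ∫ x, M.paretoGap x.1 ∂(M.runLaw a x₀ t) := by
    field_simp
  have e2 : 8 / (1 - M.γ) ^ 2 * (T : ℝ)⁻¹ * (2 * (2 / a.c + 1 / a.β) + T * M.stepErr a Cφ κ ρ)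
      = 8 / (1 - M.γ) ^ 2 * (2 * (2 / a.c + 1 / a.β) / T + M.stepErr a Cφ κ ρ) := by
    field_simp
  rw [e1, e2] at h2
  exact h2

end MultiTaskMDP

/-! ### Sample counts and error constants -/

theorem div_le_of_mul_inv_le {b ε X N : ℝ} (hb : 0 < b) (hε : 0 < ε) (hX : 0 ≤ X)
    (hN : b * ε⁻¹ ≤ N) : X / N ≤ X * (ε / b) := by
  have h1 : 0 < b * ε⁻¹ := by positivity
  refine (div_le_div_of_nonneg_left hX h1 hN).trans_eq ?_
  field_simp

/-- With `y = ε⁻¹`, an iteration costs order `y²` because the critic dominates. The four multiples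
of `b` are the critic, two weight batches and the actor batch; the extra `1` is the initial sample
of the critic. -/
theorem samplesPerTask_le {a : Params} {T : ℕ} {b y : ℝ} (hb : 0 ≤ b) (hy : 1 ≤ y)
    (hT : (T : ℝ) ≤ b * y) (hc : (a.Ncritic : ℝ) ≤ b * y ^ 2) (hf : (a.NFC : ℝ) ≤ b * y)
    (ha : (a.Nactor : ℝ) ≤ b * y) :
    (a.samplesPerTask T : ℝ) ≤ b * (4 * b + 1) * y ^ 3 := by
  have hy2 : y ≤ y ^ 2 := by nlinarith
  have hby := mul_le_mul_of_nonneg_left hy2 hb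
  have h1 : (a.Ncritic : ℝ) + 1 + 2 * a.NFC + a.Nactor ≤ (4 * b + 1) * y ^ 2 := by nlinarith
  have h2 := mul_le_mul hT h1 (by positivity) (by positivity)
  rw [Params.samplesPerTask]
  push_cast
  refine h2.trans_eq ?_
  ring

/-- The total of the error terms of MTAC-FC, each multiplied by its sample size. -/
def rateConst (β c γ Cφ κ ρ lamA B : ℝ) : ℝ :=
  8 / (1 - γ) ^ 2 * (2 * (2 / c + 1 / β) + 9 / 2 * Cφ ^ 4 * |criticConst Cφ κ ρ lamA B|
    + 17 / 8 * (Cφ ^ 2 * B) ^ 2 + 1 / 2 * (Cφ ^ 2 * B) ^ 2)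

/-- The coefficient of the function approximation error. -/
def approxConst (γ Cφ B : ℝ) : ℝ :=
  8 / (1 - γ) ^ 2 * (9 / 2 * Cφ ^ 2 * (Cφ * B + (1 - γ)⁻¹))

namespace MultiTaskMDP

variable {S A : Type*} [MeasurableSpace S] [MeasurableSpace A] {K p m : ℕ}
  {M : MultiTaskMDP S A K p m} {a : Params}
  {Cφ Cπ Lφ κ ρ : ℝ}

theorem Analysis.error_le (h : M.Analysis a Cφ Cπ Lφ κ ρ) {b ε : ℝ} (hb : 1 ≤ b) (hε : 0 < ε)
    (hR : rateConst a.β a.c M.γ Cφ κ ρ a.lamA a.B ≤ b) {T : ℕ} (hT : b * ε⁻¹ ≤ T)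
    (hc : b ^ 2 * ε⁻¹ ^ 2 ≤ a.Ncritic) (hf : b * ε⁻¹ ≤ a.NFC) (ha : b * ε⁻¹ ≤ a.Nactor) :
    8 / (1 - M.γ) ^ 2 * (2 * (2 / a.c + 1 / a.β) / T + M.stepErr a Cφ κ ρ)
      ≤ ε + approxConst M.γ Cφ a.B * M.εapp := by
  have hb0 : 0 < b := by linarith
  have hγ := M.one_sub_γ_pos
  have hc0 := h.c_pos
  have hβ := h.β_pos
  have hs : b * ε⁻¹ ≤ √a.Ncritic := Real.le_sqrt_of_sq_le (by rw [mul_pow]; exact hc)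
  have hT' := div_le_of_mul_inv_le (X := 2 * (2 / a.c + 1 / a.β)) hb0 hε (by positivity) hT
  have hf' := div_le_of_mul_inv_le (X := (Cφ ^ 2 * a.B) ^ 2) hb0 hε (sq_nonneg _) hf
  have ha' := div_le_of_mul_inv_le (X := (Cφ ^ 2 * a.B) ^ 2) hb0 hε (sq_nonneg _) ha
  have hc' : criticConst Cφ κ ρ a.lamA a.B / √a.Ncritic
      ≤ |criticConst Cφ κ ρ a.lamA a.B| * (ε / b) :=
    (div_le_div_of_nonneg_right (le_abs_self _) (Real.sqrt_nonneg _)).trans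
      (div_le_of_mul_inv_le hb0 hε (abs_nonneg _) hs)
  have hc'' := mul_le_mul_of_nonneg_left hc' (by positivity : 0 ≤ 9 / 2 * Cφ ^ 4)
  -- The analysis yields `εapp²`; the a priori bound on `εapp` makes it linear, as the claim
  -- requires.
  have happ : M.εapp ^ 2 ≤ (Cφ * a.B + (1 - M.γ)⁻¹) * M.εapp := by
    rw [sq]
    exact mul_le_mul_of_nonneg_right
      (εapp_le h.smooth.feature_le h.wStar_le h.Cφ_nonneg h.B_nonneg) εapp_nonneg
  have happ' := mul_le_mul_of_nonneg_left happ (by positivity : 0 ≤ 9 / 2 * Cφ ^ 2)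
  have hsum : 2 * (2 / a.c + 1 / a.β) / T + M.stepErr a Cφ κ ρ
      ≤ (2 * (2 / a.c + 1 / a.β) + 9 / 2 * Cφ ^ 4 * |criticConst Cφ κ ρ a.lamA a.B|
          + 17 / 8 * (Cφ ^ 2 * a.B) ^ 2 + 1 / 2 * (Cφ ^ 2 * a.B) ^ 2) * (ε / b)
        + 9 / 2 * Cφ ^ 2 * (Cφ * a.B + (1 - M.γ)⁻¹) * M.εapp := by
    rw [stepErr]
    linarith
  refine (mul_le_mul_of_nonneg_left hsum (by positivity)).trans ?_
  have e : 8 / (1 - M.γ) ^ 2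
      * ((2 * (2 / a.c + 1 / a.β) + 9 / 2 * Cφ ^ 4 * |criticConst Cφ κ ρ a.lamA a.B|
          + 17 / 8 * (Cφ ^ 2 * a.B) ^ 2 + 1 / 2 * (Cφ ^ 2 * a.B) ^ 2) * (ε / b)
        + 9 / 2 * Cφ ^ 2 * (Cφ * a.B + (1 - M.γ)⁻¹) * M.εapp)
      = rateConst a.β a.c M.γ Cφ κ ρ a.lamA a.B * (ε / b)
        + approxConst M.γ Cφ a.B * M.εapp := by
    rw [rateConst, approxConst]; ring
  rw [e]
  have h1 := mul_le_mul_of_nonneg_right hR (by positivity : 0 ≤ ε / b)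
  have h2 : b * (ε / b) = ε := by field_simp
  linarith

end MultiTaskMDP

end MTAC

end

theorem mainTheorem5 (K : ℕ) (hK : 0 < K)
    (γ Cφ Cπ Lφ κ ρ lamA B : ℝ) (hγ0 : 0 ≤ γ) (hγ1 : γ < 1) (hCφ : 0 < Cφ) (hCπ : 0 < Cπ)
    (hLφ : 0 < Lφ) (hκ : 0 < κ) (hρ0 : 0 < ρ) (hρ1 : ρ < 1) (hlamA : 0 < lamA) (hB : 0 < B) :
    ∃ cmax : ℝ, 0 < cmax ∧ cmax ≤ 1 / (8 * Cφ ^ 2 * B) ∧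
    ∀ β c : ℝ, 0 < β → 0 < c → c ≤ cmax →
    ∃ b₀ C : ℝ, 0 < b₀ ∧ 0 < C ∧ ∀ b₁ : ℝ, b₀ ≤ b₁ → ∃ C' : ℝ, 0 < C' ∧
    ∀ (S A : Type*) [MeasurableSpace S] [MeasurableSpace A] (p m : ℕ)
      (M : MTAC.MultiTaskMDP S A K p m), M.γ = γ →
      M.Smooth Cφ Cπ Lφ → M.UniformlyErgodic κ ρ → M.Solvable lamA →
      (∀ k θ, ‖M.wStar k θ‖ ≤ B) → β * M.lipJ ≤ 1 →
      (∀ k, Differentiable ℝ (M.J k)) ∧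
      ∀ (x₀ : MTAC.State K p m), x₀.2.2 ∈ MTAC.simplex K →
      ∀ (twoBatches : Bool) (ε : ℝ), 0 < ε → ε ≤ 1 →
      ∀ T Ncritic NFC Nactor : ℕ,
        b₀ * ε⁻¹ ≤ T → T ≤ b₁ * ε⁻¹ →
        b₀ * (ε⁻¹) ^ 2 ≤ Ncritic → Ncritic ≤ b₁ * (ε⁻¹) ^ 2 →
        b₀ * ε⁻¹ ≤ NFC → NFC ≤ b₁ * ε⁻¹ →
        b₀ * ε⁻¹ ≤ Nactor → Nactor ≤ b₁ * ε⁻¹ →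
        M.IsParetoStationary
            (M.outputLaw ⟨β, c, lamA, B, Ncritic, NFC, Nactor, twoBatches⟩ x₀ T)
            (ε + C * M.εapp) ∧
          ((MTAC.Params.samplesPerTask
            ⟨β, c, lamA, B, Ncritic, NFC, Nactor, twoBatches⟩ T : ℕ) : ℝ) ≤ C' * (ε⁻¹) ^ 3 := by

  have hγ : 0 < 1 - γ := sub_pos.2 hγ1
  have hK' : (0 : ℝ) < K := by exact_mod_cast hK
  have hV : 0 < K * (Cφ ^ 2 * B) ^ 2 := by positivity
  -- The first entry is the stated upper limit for `cmax`; the second is what the weight step needs,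
  -- `c K (Cφ² B)² ≤ 1/4`.
  refine ⟨min (1 / (8 * Cφ ^ 2 * B)) (1 / (4 * (K * (Cφ ^ 2 * B) ^ 2))),
    lt_min (by positivity) (by positivity), min_le_left _ _, fun β c hβ hc0 hcm => ?_⟩
  have hc4 : c * (K * (Cφ ^ 2 * B) ^ 2) ≤ 1 / 4 := by
    have := mul_le_mul_of_nonneg_right (hcm.trans (min_le_right _ _)) hV.le
    refine this.trans_eq ?_
    field_simp
  obtain ⟨b, hb⟩ : ∃ b, b = 1 + |MTAC.rateConst β c γ Cφ κ ρ lamA B| := ⟨_, rfl⟩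
  have hb1 : 1 ≤ b := by rw [hb]; linarith [abs_nonneg (MTAC.rateConst β c γ Cφ κ ρ lamA B)]
  have hbR : MTAC.rateConst β c γ Cφ κ ρ lamA B ≤ b := by
    rw [hb]; linarith [le_abs_self (MTAC.rateConst β c γ Cφ κ ρ lamA B)]
  have hb2 : b ≤ b ^ 2 := by nlinarith
  have hC : 0 < MTAC.approxConst γ Cφ B := by
    have := inv_pos.2 hγ
    unfold MTAC.approxConst
    positivity
  -- The critic error decays like `1/√N`, so `N ≥ b² ε⁻²` is needed for `√N ≥ b ε⁻¹`. As `b ≥ 1`,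
  -- the choice `b₀ = b²` also covers the sizes that need only `b ε⁻¹`.
  refine ⟨b ^ 2, MTAC.approxConst γ Cφ B, by positivity, hC, fun b₁ hb₁ => ?_⟩
  have hb₁0 : 0 < b₁ := by nlinarith
  refine ⟨b₁ * (4 * b₁ + 1), by positivity, ?_⟩
  intro S A _ _ p m M hMγ hS hE hsol hw hlip
  subst hMγ
  refine ⟨fun k θ => (hE.hasGradientAt_J hρ0.le hρ1 hS k θ).differentiableAt, ?_⟩
  intro x₀ hx₀ twoBatches ε hε hε1 T Ncritic NFC Nactor hT hT' hc hc' hf hf' ha ha'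
  have hy : 1 ≤ ε⁻¹ := (one_le_inv₀ hε).2 hε1
  have hone : ∀ {N : ℕ} {y : ℝ}, 1 ≤ y → b ^ 2 * y ≤ N → 1 ≤ N := fun {N y} hy hN => by
    have h1 : (1 : ℝ) ≤ N := by nlinarith
    exact_mod_cast h1
  have hle : ∀ {N : ℝ}, b ^ 2 * ε⁻¹ ≤ N → b * ε⁻¹ ≤ N := fun hN =>
    (mul_le_mul_of_nonneg_right hb2 (by linarith)).trans hN
  have h : M.Analysis ⟨β, c, lamA, B, Ncritic, NFC, Nactor, twoBatches⟩ Cφ Cπ Lφ κ ρ :=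
    { Cφ_nonneg := hCφ.le
      Lφ_nonneg := hLφ.le
      κ_nonneg := hκ.le
      ρ_nonneg := hρ0.le
      ρ_lt_one := hρ1
      lamA_pos := hlamA
      B_nonneg := hB.le
      β_pos := hβ
      c_pos := hc0
      c_le := hc4
      smooth := hS
      ergodic := hE
      solvable := hsol
      wStar_le := hw
      lip := hlip
      one_le_Ncritic := hone (one_le_pow₀ hy) hc
      one_le_NFC := hone hy hf
      one_le_Nactor := hone hy ha }
  obtain ⟨h1, h2, h3⟩ := h.isParetoStationary hx₀ (hone hy hT)
  refine ⟨⟨h1, h2, h3.trans (h.error_le hb1 hε hbR (hle hT) hc (hle hf) (hle ha))⟩, ?_⟩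
  exact MTAC.samplesPerTask_le hb₁0.le hy hT' hc' hf' ha'
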